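/- Setting. Let $n\ge 2$. The endowment vector has finite support $\mathcal Y\subset\mathbb R^n_{++}$ with at least two elements and probability mass function $e>0$ on $\mathcal Y$, and there is $\boldsymbol y'\in\mathcal Y$ with $\boldsymbol y'-\boldsymbol y\gg 0$ for every other $\boldsymbol y\in\mathcal Y$. Let $1/2<\beta<1$ and $\overline b>0$. The utility $U:\mathbb R^n_+\to\mathbb R$ is continuous, strictly increasing ($\boldsymbol x\ge\boldsymbol x'$, $\boldsymbol x\neq\boldsymbol x'$ imply $U(\boldsymbol x)>U(\boldsymbol x')$), strictly concave, continuously differentiable on $\mathbb R^n_{++}$, and for some $j$ its right partial derivative $\partial U(0)/\partial x_j$ is $+\infty$. For $\boldsymbol p\gg 0$ and $c\ge 0$ let $\boldsymbol x^*(c,\boldsymbol p)$ maximize $U$ over $X(c,\boldsymbol p)=\{\boldsymbol x\in\mathbb R^n_+:\boldsymbol p\cdot\boldsymbol x=c\}$, and assume that for every $\boldsymbol p\gg0$ the function $u_{\boldsymbol p}(c)=U(\boldsymbol x^*(c,\boldsymbol p))$ is continuously differentiable on $(0,\infty)$ with $u_{\boldsymbol p}'(c)\to 0$ as $c\to\infty$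 and $u_{\boldsymbol p}'(c)\to\infty$ as $c\to 0$. For $\boldsymbol p\gg0$ and $r\in(0,1)$ put $\underline b=-\min_{\boldsymbol y\in\mathcal Y}\boldsymbol p\cdot\boldsymbol y/r$, $B=\sum_i p_i\overline b/(1-r)^2$, $C(a)=[\underline b,\min\{a,B\}]$ and $A(\boldsymbol p,r)=[(1+r)\underline b+\min_{\boldsymbol y}\boldsymbol p\cdot\boldsymbol y,\ (1+r)B+\max_{\boldsymbol y}\boldsymbol p\cdot\boldsymbol y]$. A strategy assigns to each finite history $(a(1),\dots,a(t))$ of wealth levels in $A(\boldsymbol p,r)$ a bundle $\boldsymbol x(t)\in\mathbb R^n_+$ with $a(t)-\boldsymbol p\cdot\boldsymbol x(t)\in C(a(t))$; wealth evolves by $a(t+1)=(1+r)(a(t)-\boldsymbol p\cdot\boldsymbol x(t))+\boldsymbol p\cdot\boldsymbol y(t+1)$ with $\boldsymbol y(2),\boldsymbol y(3),\dots$ independent draws from $e$. Let $V(a)$ be the supremum over strategies of $\mathbb E\sum_{t\ge1}\beta^{t-1}U(\boldsymbol x(t))$ given $a(1)=a$, and let the savings policy $g(a)=g(a,\boldsymbol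 p,r)$ be the maximizer over $b\in C(a)$ of $U(\boldsymbol x^*(a-b,\boldsymbol p))+\beta\sum_{\boldsymbol y}e(\boldsymbol y)V((1+r)b+\boldsymbol p\cdot\boldsymbol y)$. Let $\mu=\mu(\cdot;\boldsymbol p,r)$ be the invariant wealth distribution, i.e. the probability measure on $A(\boldsymbol p,r)$ with $\mu(D)=\int\sum_{\boldsymbol y}e(\boldsymbol y)1_D((1+r)g(a)+\boldsymbol p\cdot\boldsymbol y)\,\mu(da)$ for all Borel $D$. Let $\Lambda=\{(\boldsymbol p,r)\in\mathbb R^n_+\times\mathbb R_+:\sum_i p_i+r=1\}$ and $\boldsymbol P=\{(\boldsymbol p,r)\in\Lambda:\boldsymbol p\gg0,\ r>0\}$. The excess demand function $\zeta:\boldsymbol P\to\mathbb R^{n+1}$ is $$\zeta_i(\boldsymbol p,r)=\int_{A(\boldsymbol p,r)} x_i^*(a-g(a),\boldsymbol p)\,\mu(da)-\sum_{\boldsymbol y}e(\boldsymbol y)y_i\quad(1\le i\le n),\qquad \zeta_{n+1}(\boldsymbol p,r)=-\int_{A(\boldsymbol p,r)} g(a)\,\mu(da).$$ Proposition. For every $(\boldsymbol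 p,r)\in\boldsymbol P$ the excess demand is well defined ($\boldsymbol x^*(c,\boldsymbol p)$ for $c\ge0$ and $g(a)$ for $a\in A(\boldsymbol p,r)$ exist and are unique, there is exactly one invariant wealth distribution, and the integrals exist), and: (i) $\zeta$ is continuous on $\boldsymbol P$. (ii) $\sum_{i=1}^n p_i\zeta_i(\boldsymbol p,r)+r\,\zeta_{n+1}(\boldsymbol p,r)=0$ for all $(\boldsymbol p,r)\in\boldsymbol P$. (iii) If $(\boldsymbol p_q,r_q)\in\boldsymbol P$ converges to $(\boldsymbol p,r)\in\Lambda\setminus\boldsymbol P$ with $p_k>0$ for some $1\le k\le n$, then $\|\zeta(\boldsymbol p_q,r_q)\|_1\to\infty$. (iv) If $(\boldsymbol p_q,r_q)\in\boldsymbol P$ converges to $(\boldsymbol p,r)$ and $p_k>0$ for some $1\le k\le n$, then the sequence $\zeta_k(\boldsymbol p_q,r_q)$ is bounded; if $r\in(0,1)$, then the sequence $\zeta_{n+1}(\boldsymbol p_q,r_q)$ is bounded. (v) There is $\xi>0$ with $\zeta_i(\boldsymbol p,r)\ge-\xi$ for all $1\le i\le n$ and all $(\boldsymbol p,r)\in\boldsymbol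 P$; and for every $\delta\in(0,1)$ there is $\xi>0$ with $\zeta_{n+1}(\boldsymbol p,r)\ge-\xi$ for all $(\boldsymbol p,r)\in\boldsymbol P$ with $r\le\delta$. -/

import Mathlib

open Set Filter Topology MeasureTheory

noncomputable section

/-- Primitives of the exchange economy with `n` goods. `Y` is the (finite) support of the joint
law of the endowment vector and `e` its probability mass function; `β` is the discount factor,
`bbar` the constant in the upper bound on savings and `U` the utility function over bundles (only
its values on the nonnegative orthant are ever used). The endowment is genuinely random and has a
state that is strictly better in all goods than every other state. -/
structure Economy (n : ℕ) where
  Y : Finset (Fin n → ℝ)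
  e : (Fin n → ℝ) → ℝ
  β : ℝ
  bbar : ℝ
  U : (Fin n → ℝ) → ℝ
  Y_nontrivial : Y.Nontrivial
  e_pos : ∀ y ∈ Y, 0 < e y
  e_sum : ∑ y ∈ Y, e y = 1
  Y_pos : ∀ y ∈ Y, ∀ i, 0 < y i
  Y_top : ∃ y' ∈ Y, ∀ y ∈ Y, y ≠ y' → ∀ i, y i < y' i
  β_gt : 1 / 2 < β
  β_lt : β < 1
  bbar_pos : 0 < bbar

namespace Economy

variable {n : ℕ} (E : Economy n)

/-- The value `p · x` of a bundle. -/
def cost (p x : Fin n → ℝ) : ℝ := ∑ i, p i * x i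

/-- The smallest value of an endowment, `min_{y ∈ Y} p · y`. -/
def minEndow (p : Fin n → ℝ) : ℝ := E.Y.inf' E.Y_nontrivial.nonempty (cost p)

/-- The largest value of an endowment, `max_{y ∈ Y} p · y`. -/
def maxEndow (p : Fin n → ℝ) : ℝ := E.Y.sup' E.Y_nontrivial.nonempty (cost p)

/-- The borrowing limit (lower bound on savings). -/
def borrowLimit (p : Fin n → ℝ) (r : ℝ) : ℝ := -(E.minEndow p / r)

/-- The upper bound on savings. -/
def savingsCap (p : Fin n → ℝ) (r : ℝ) : ℝ := ∑ i, p i * E.bbar / (1 - r) ^ 2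

/-- `C(a, p)`: the savings levels available at wealth `a`. -/
def savingsSet (p : Fin n → ℝ) (r a : ℝ) : Set ℝ :=
  Icc (E.borrowLimit p r) (min a (E.savingsCap p r))

/-- `A(p, r)`: the possible wealth levels. -/
def wealthSet (p : Fin n → ℝ) (r : ℝ) : Set ℝ :=
  Icc ((1 + r) * E.borrowLimit p r + E.minEndow p) ((1 + r) * E.savingsCap p r + E.maxEndow p)

/-- `X(c, p)`: the nonnegative bundles on which exactly `c` is spent. -/
def bundles (p : Fin n → ℝ) (c : ℝ) : Set (Fin n → ℝ) :=
  {x | (∀ i, 0 ≤ x i) ∧ cost p x = c}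

/-- `x` maximizes utility over the bundles on which `c` is spent. -/
def IsDemand (p : Fin n → ℝ) (c : ℝ) (x : Fin n → ℝ) : Prop :=
  x ∈ bundles p c ∧ ∀ x' ∈ bundles p c, E.U x' ≤ E.U x

/-- The demand function `x*(c, p)`. -/
def demand (p : Fin n → ℝ) (c : ℝ) : Fin n → ℝ := Classical.epsilon (E.IsDemand p c)

/-- The indirect utility function `u_p(c) = U (x*(c, p))`. -/
def indirectUtility (p : Fin n → ℝ) (c : ℝ) : ℝ := E.U (E.demand p c)

/-- The assumptions on the utility function. -/
structure UtilityAssumption : Prop where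
  strictMono : StrictMonoOn E.U {x | ∀ i, 0 ≤ x i}
  continuousOn : ContinuousOn E.U {x | ∀ i, 0 ≤ x i}
  contDiffOn : ContDiffOn ℝ 1 E.U {x | ∀ i, 0 < x i}
  strictConcave : StrictConcaveOn ℝ {x | ∀ i, 0 ≤ x i} E.U
  partial_zero : ∃ j : Fin n,
    Tendsto (fun t : ℝ => (E.U (Pi.single j t) - E.U 0) / t) (𝓝[>] 0) atTop
  indirect_contDiffOn : ∀ p : Fin n → ℝ, (∀ i, 0 < p i) →
    ContDiffOn ℝ 1 (E.indirectUtility p) (Ioi 0)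
  inada_top : ∀ p : Fin n → ℝ, (∀ i, 0 < p i) →
    Tendsto (deriv (E.indirectUtility p)) atTop (𝓝 0)
  inada_zero : ∀ p : Fin n → ℝ, (∀ i, 0 < p i) →
    Tendsto (deriv (E.indirectUtility p)) (𝓝[>] 0) atTop

/-- A strategy assigns a bundle to every finite history `[a(1), …, a(t)]` of wealth levels (in
chronological order, so `a(t)` is current wealth). It is feasible if after every history the bundle
is nonnegative and leaves an admissible level of savings `a(t) - p · x`. -/
def IsStrategy (p : Fin n → ℝ) (r : ℝ) (π : List ℝ → Fin n → ℝ) : Prop :=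
  ∀ h : List ℝ, (∀ a ∈ h, a ∈ E.wealthSet p r) → ∀ a ∈ E.wealthSet p r,
    (∀ i, 0 ≤ π (h ++ [a]) i) ∧ a - cost p (π (h ++ [a])) ∈ E.savingsSet p r a

/-- The history of wealth levels `[a(1), …, a(t+1)]` that results from the strategy `π`, the
initial wealth `a(1) = a` and the endowments `[y(2), …, y(t+1)]`, where
`a(s+1) = (1 + r) (a(s) - p · π(a(1), …, a(s))) + p · y(s+1)`. -/
def history (p : Fin n → ℝ) (r : ℝ) : (List ℝ → Fin n → ℝ) → ℝ → List (Fin n → ℝ) → List ℝ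
  | _, a, [] => [a]
  | π, a, y :: ys =>
      a :: history p r (fun h => π (a :: h)) ((1 + r) * (a - cost p (π [a])) + cost p y) ys

/-- The expectation of the utility in period `t + 1`, the endowments `y(2), …, y(t+1)` being
independent draws from `e`. -/
def expectedUtility (p : Fin n → ℝ) (r : ℝ) (π : List ℝ → Fin n → ℝ) (a : ℝ) (t : ℕ) : ℝ :=
  ∑ ω : Fin t → E.Y, (∏ s, E.e (ω s)) *
    E.U (π (history p r π a (List.ofFn fun s => (ω s : Fin n → ℝ))))

/-- `V_π(a)`: the expected present discounted utility of the strategy `π`. -/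
def strategyValue (p : Fin n → ℝ) (r : ℝ) (π : List ℝ → Fin n → ℝ) (a : ℝ) : ℝ :=
  ∑' t : ℕ, E.β ^ t * E.expectedUtility p r π a t

/-- The value function `V(a) = sup_π V_π(a)`. -/
def value (p : Fin n → ℝ) (r a : ℝ) : ℝ :=
  sSup {v | ∃ π, E.IsStrategy p r π ∧ v = E.strategyValue p r π a}

/-- The objective of the savings problem at wealth `a`, as a function of savings `b`. -/
def savingsObjective (p : Fin n → ℝ) (r a b : ℝ) : ℝ :=
  E.U (E.demand p (a - b)) + E.β * ∑ y ∈ E.Y, E.e y * E.value p r ((1 + r) * b + cost p y)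

/-- `b` is an optimal level of savings at wealth `a`. -/
def IsOptimalSavings (p : Fin n → ℝ) (r a b : ℝ) : Prop :=
  b ∈ E.savingsSet p r a ∧
    ∀ b' ∈ E.savingsSet p r a, E.savingsObjective p r a b' ≤ E.savingsObjective p r a b

/-- The savings policy function `g(a, p, r)`. -/
def savings (p : Fin n → ℝ) (r a : ℝ) : ℝ := Classical.epsilon (E.IsOptimalSavings p r a)

/-- `μ` is an invariant wealth distribution: a probability measure carried by `A(p, r)` with
`μ = M μ`, where
`M μ (D) = ∫_{A(p,r)} ∑_y e(y) 1_D((1 + r) g(a, p, r) + p · y) μ(da)`. -/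
def IsInvariant (p : Fin n → ℝ) (r : ℝ) (μ : Measure ℝ) : Prop :=
  IsProbabilityMeasure μ ∧ μ (E.wealthSet p r)ᶜ = 0 ∧
    ∀ D : Set ℝ, MeasurableSet D →
      μ D = ∫⁻ a in E.wealthSet p r, ∑ y ∈ E.Y, ENNReal.ofReal (E.e y) *
        D.indicator (fun _ => 1) ((1 + r) * E.savings p r a + cost p y) ∂μ

/-- The invariant wealth distribution `μ(·; p, r)`. -/
def invariant (p : Fin n → ℝ) (r : ℝ) : Measure ℝ := Classical.epsilon (E.IsInvariant p r)

/-- The excess demand for good `i`. -/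
def excessGood (p : Fin n → ℝ) (r : ℝ) (i : Fin n) : ℝ :=
  (∫ a in E.wealthSet p r, E.demand p (a - E.savings p r a) i ∂(E.invariant p r)) -
    ∑ y ∈ E.Y, E.e y * y i

/-- The excess demand for savings. -/
def excessSavings (p : Fin n → ℝ) (r : ℝ) : ℝ :=
  -∫ a in E.wealthSet p r, E.savings p r a ∂(E.invariant p r)

/-- The excess demand function `ζ`: the components of the `n` goods, then that of savings. -/
def excessDemand (z : (Fin n → ℝ) × ℝ) : (Fin n → ℝ) × ℝ :=
  (E.excessGood z.1 z.2, E.excessSavings z.1 z.2)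

/-- All objects that enter `ζ(p, r)` are well defined: the demand function and the savings policy
are single-valued, there is exactly one invariant wealth distribution, and the integrals exist. -/
structure WellDefinedAt (p : Fin n → ℝ) (r : ℝ) : Prop where
  demand_unique : ∀ c : ℝ, 0 ≤ c → ∃! x, E.IsDemand p c x
  savings_unique : ∀ a ∈ E.wealthSet p r, ∃! b, E.IsOptimalSavings p r a b
  invariant_unique : ∃! μ : Measure ℝ, E.IsInvariant p r μ
  integrable_demand : ∀ i, IntegrableOn (fun a => E.demand p (a - E.savings p r a) i)
    (E.wealthSet p r) (E.invariant p r)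
  integrable_savings : IntegrableOn (E.savings p r) (E.wealthSet p r) (E.invariant p r)

end Economy

/-- The closed price simplex `Λ`. -/
def closedPriceSimplex (n : ℕ) : Set ((Fin n → ℝ) × ℝ) :=
  {z | (∀ i, 0 ≤ z.1 i) ∧ 0 ≤ z.2 ∧ ∑ i, z.1 i + z.2 = 1}

/-- The open price simplex `P`. -/
def openPriceSimplex (n : ℕ) : Set ((Fin n → ℝ) × ℝ) :=
  {z ∈ closedPriceSimplex n | (∀ i, 0 < z.1 i) ∧ 0 < z.2}

/-- The norm `‖·‖₁` on `ℝⁿ × ℝ`. -/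
def l1Norm {n : ℕ} (z : (Fin n → ℝ) × ℝ) : ℝ := ∑ i, |z.1 i| + |z.2|

end

/-! ### Consumer demand and indirect utility. -/

noncomputable section

/-! Individual problem. Strict concavity makes demand single-valued, and limits of maximizers are
maximizers, so it is continuous. The Bellman equation (`isLUB_savingsObjective`) follows by pasting
nearly optimal continuation strategies. Since `β < 1`, value iteration converges locally uniformly
in prices, so its continuity and concavity pass to the value function, and the savings policy is
single-valued and jointly continuous (`continuous_savings`). The value function is strictly concave,
because an affine piece would reproduce itself stretched by the factor `1 + r` inside a bounded
interval. The envelope theorem then identifies its derivative with the marginal utility of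
consumption, which is strictly decreasing in wealth and satisfies an Euler inequality, with equality
below the savings cap.

Invariant distribution. Savings increase with wealth. If `β (1 + r) ≤ 1`, the Euler inequality
leaves the borrowing limit as the only fixed point under the worst endowment; if `β (1 + r) ≥ 1`,
the top is the only fixed point under the best one. Either way a run of bad draws from the top ends
below a run of good draws from the bottom (`exists_crossing`), so the Markov operator contracts the
range of monotone functions (`exists_contraction`). An invariant mean of a monotone function lies
between its `N`-step means from the two extremes. This gives uniqueness, and continuity of such
means in prices; polynomials in relative wealth extend the continuity to all continuous integrands
(`continuous_integral_invariant`).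

Walras' law is invariance of mean wealth combined with the budget identity. The bounds hold because
savings lie between the borrowing limit and the cap, which equals `bbar / (1 - r)` on the simplex,
and because spending on one good is at most total spending.

Boundary. Suppose excess demand stays bounded by `M` along a subsequence; then mean savings and mean
total demand are bounded. If a good becomes free while `r` stays positive, mean expenditure stays
away from zero and expenditure is bounded, so demand explodes on a non-negligible part of the
population (`false_of_bounded_of_pos`). If a good becomes free and `r → 0`, bounded mean savings
keep most consumers out of deep debt; these spend an amount bounded away from zero, and again demand
explodes (`false_of_bounded_of_free`). If `r → 0` at positive prices, some moderately indebted
consumer spends a moderate amount. Descending from that wealth in `T` fixed steps multiplies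
marginal utility by at least `β' ^ (-T)`, for a fixed `β'` in `(β, 1)`, yet even there consumption,
hence marginal utility, is controlled uniformly (`false_of_bounded_of_interior`). -/

theorem IsCompact.exists_tendsto_ultrafilter {X α : Type*} [TopologicalSpace α] {K : Set α}
    (hK : IsCompact K) {f : Ultrafilter X} {g : X → α} (hg : ∀ᶠ x in (f : Filter X), g x ∈ K) :
    ∃ a ∈ K, Tendsto g f (𝓝 a) :=
  hK.ultrafilter_le_nhds (f.map g) (le_principal_iff.2 hg)

/-- If every limit point of the maximizers along an ultrafilter is a maximizer of the limit problem, which has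
only one maximizer, then the maximizers converge. -/
theorem tendsto_of_unique_ultrafilter_limit {X α : Type*} [TopologicalSpace α] {l : Filter X}
    {g : X → α} {K : Set α} (hK : IsCompact K) (hg : ∀ᶠ x in l, g x ∈ K) {a : α}
    (h : ∀ (f : Ultrafilter X) (b : α), ↑f ≤ l → Tendsto g f (𝓝 b) → b = a) :
    Tendsto g l (𝓝 a) := by
  rw [tendsto_iff_ultrafilter]
  intro f hf
  obtain ⟨b, -, hb⟩ := hK.exists_tendsto_ultrafilter (hf hg)
  rwa [← h f b hf hb]

namespace Economy

variable {n : ℕ} {E : Economy n} {p : Fin n → ℝ} {r c : ℝ}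

theorem dim_pos (E : Economy n) : 0 < n := by
  rcases Nat.eq_zero_or_pos n with rfl | h
  · obtain ⟨a, -, b, -, hab⟩ := E.Y_nontrivial
    exact (hab (Subsingleton.elim _ _)).elim
  · exact h

theorem univ_nonempty (E : Economy n) : (Finset.univ : Finset (Fin n)).Nonempty :=
  ⟨⟨0, E.dim_pos⟩, Finset.mem_univ _⟩

theorem sum_pos (E : Economy n) (hp : ∀ i, 0 < p i) : 0 < ∑ i, p i :=
  Finset.sum_pos (fun i _ => hp i) E.univ_nonempty

theorem cost_add (p x y : Fin n → ℝ) : cost p (x + y) = cost p x + cost p y := by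
  simp [cost, mul_add, Finset.sum_add_distrib]

theorem cost_smul (p x : Fin n → ℝ) (t : ℝ) : cost p (t • x) = t * cost p x := by
  simp only [cost, Pi.smul_apply, smul_eq_mul, Finset.mul_sum]
  exact Finset.sum_congr rfl fun i _ => by ring

theorem cost_one (p : Fin n → ℝ) : cost p 1 = ∑ i, p i := by simp [cost]

theorem continuous_cost : Continuous fun q : (Fin n → ℝ) × (Fin n → ℝ) => cost q.1 q.2 := by
  unfold cost; fun_prop

theorem continuous_cost_left (x : Fin n → ℝ) : Continuous fun p : Fin n → ℝ => cost p x := by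
  unfold cost; fun_prop

theorem continuous_cost_right (p : Fin n → ℝ) : Continuous (cost p) := by
  unfold cost; fun_prop

theorem cost_nonneg {x : Fin n → ℝ} (hp : ∀ i, 0 ≤ p i) (hx : ∀ i, 0 ≤ x i) : 0 ≤ cost p x :=
  Finset.sum_nonneg fun i _ => mul_nonneg (hp i) (hx i)

theorem mul_le_cost {x : Fin n → ℝ} (hp : ∀ i, 0 ≤ p i) (hx : ∀ i, 0 ≤ x i) (i : Fin n) :
    p i * x i ≤ cost p x :=
  Finset.single_le_sum (f := fun i => p i * x i) (fun j _ => mul_nonneg (hp j) (hx j))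
    (Finset.mem_univ i)

theorem bundles_subset_Icc (hp : ∀ i, 0 < p i) : bundles p c ⊆ Icc 0 (fun i => c / p i) := by
  rintro x ⟨hx, rfl⟩
  refine ⟨hx, fun i => ?_⟩
  rw [le_div_iff₀ (hp i), mul_comm]
  exact mul_le_cost (fun i => (hp i).le) hx i

theorem isCompact_bundles (hp : ∀ i, 0 < p i) : IsCompact (bundles p c) := by
  refine isCompact_Icc.of_isClosed_subset ?_ (bundles_subset_Icc hp)
  have : bundles p c = (⋂ i, {x | 0 ≤ x i}) ∩ {x | cost p x = c} := by
    ext x; simp [bundles]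
  rw [this]
  exact (isClosed_iInter fun i => isClosed_le continuous_const (continuous_apply i)).inter
    (isClosed_eq (continuous_cost_right p) continuous_const)

theorem uniform_mem_bundles (E : Economy n) (hp : ∀ i, 0 < p i) (hc : 0 ≤ c) :
    (c / ∑ i, p i) • (1 : Fin n → ℝ) ∈ bundles p c := by
  have := E.sum_pos hp
  refine ⟨fun i => ?_, ?_⟩
  · simpa using div_nonneg hc this.le
  · rw [cost_smul, cost_one, div_mul_cancel₀ _ this.ne']

theorem convex_bundles (p : Fin n → ℝ) {c c' : ℝ} {x x' : Fin n → ℝ} (hx : x ∈ bundles p c)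
    (hx' : x' ∈ bundles p c') {s t : ℝ} (hs : 0 ≤ s) (ht : 0 ≤ t) :
    s • x + t • x' ∈ bundles p (s * c + t * c') := by
  refine ⟨fun i => ?_, ?_⟩
  · simpa using add_nonneg (mul_nonneg hs (hx.1 i)) (mul_nonneg ht (hx'.1 i))
  · rw [cost_add, cost_smul, cost_smul, hx.2, hx'.2]

theorem existsUnique_isDemand (hU : E.UtilityAssumption) (hp : ∀ i, 0 < p i) (hc : 0 ≤ c) :
    ∃! x, E.IsDemand p c x := by
  obtain ⟨x, hx, hmax⟩ := (isCompact_bundles (c := c) hp).exists_isMaxOn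
    ⟨_, E.uniform_mem_bundles hp hc⟩ (hU.continuousOn.mono fun x hx => hx.1)
  refine ⟨x, ⟨hx, fun x' hx' => hmax hx'⟩, fun x' hx' => ?_⟩
  by_contra hne
  have h1 := hU.strictConcave.2 hx'.1.1 hx.1 hne (show (0 : ℝ) < 1 / 2 by norm_num)
    (show (0 : ℝ) < 1 / 2 by norm_num) (by norm_num)
  have h2 : (1 / 2 : ℝ) • x' + (1 / 2 : ℝ) • x ∈ bundles p c := by
    have := convex_bundles p hx'.1 hx (s := 1 / 2) (t := 1 / 2) (by norm_num) (by norm_num)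
    rwa [← add_mul, add_halves, one_mul] at this
  have h3 := hx'.2 _ h2
  have h4 := hx'.2 _ hx
  have h5 : E.U x' ≤ E.U x := hmax hx'.1
  simp only [smul_eq_mul] at h1
  linarith

theorem isDemand_demand (hU : E.UtilityAssumption) (hp : ∀ i, 0 < p i) (hc : 0 ≤ c) :
    E.IsDemand p c (E.demand p c) :=
  Classical.epsilon_spec (existsUnique_isDemand hU hp hc).exists

theorem IsDemand.eq_demand (hU : E.UtilityAssumption) (hp : ∀ i, 0 < p i) (hc : 0 ≤ c)
    {x : Fin n → ℝ} (hx : E.IsDemand p c x) : x = E.demand p c :=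
  (existsUnique_isDemand hU hp hc).unique hx (isDemand_demand hU hp hc)

theorem demand_nonneg (hU : E.UtilityAssumption) (hp : ∀ i, 0 < p i) (hc : 0 ≤ c) (i : Fin n) :
    0 ≤ E.demand p c i :=
  (isDemand_demand hU hp hc).1.1 i

theorem cost_demand (hU : E.UtilityAssumption) (hp : ∀ i, 0 < p i) (hc : 0 ≤ c) :
    cost p (E.demand p c) = c :=
  (isDemand_demand hU hp hc).1.2

theorem le_indirectUtility (hU : E.UtilityAssumption) (hp : ∀ i, 0 < p i) {x : Fin n → ℝ}
    (hx : ∀ i, 0 ≤ x i) : E.U x ≤ E.indirectUtility p (cost p x) :=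
  (isDemand_demand hU hp (cost_nonneg (fun i => (hp i).le) hx)).2 x ⟨hx, rfl⟩

theorem indirectUtility_strictMonoOn (hU : E.UtilityAssumption) (hp : ∀ i, 0 < p i) :
    StrictMonoOn (E.indirectUtility p) (Ici 0) := by
  intro c hc c' hc' hlt
  have hd := isDemand_demand hU hp hc
  have hS := E.sum_pos hp
  have ht : 0 < (c' - c) / ∑ i, p i := div_pos (sub_pos.2 hlt) hS
  -- The extra expenditure buys the same additional quantity of every good.
  set x := E.demand p c + ((c' - c) / ∑ i, p i) • (1 : Fin n → ℝ) with hx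
  have hx0 : ∀ i, 0 ≤ x i := fun i => by simpa [hx] using add_nonneg (hd.1.1 i) ht.le
  have hcost : cost p x = c' := by
    rw [hx, cost_add, hd.1.2, cost_smul, cost_one, div_mul_cancel₀ _ hS.ne']; ring
  have h1 : E.U (E.demand p c) < E.U x := by
    refine hU.strictMono hd.1.1 hx0 (lt_of_le_of_ne (fun i => ?_) fun h => ?_)
    · simp [hx, ht.le]
    · have := congrFun h ⟨0, E.dim_pos⟩
      simp [hx] at this
      rcases this with h | h
      · linarith
      · exact hS.ne' h
  have h2 := le_indirectUtility hU hp hx0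
  rw [hcost] at h2
  exact h1.trans_le h2

/-- The mixture of two optimal bundles is affordable at the mixed expenditure. The bundles differ
because their costs do, so strict concavity of `U` applies. -/
theorem indirectUtility_strictConcaveOn (hU : E.UtilityAssumption) (hp : ∀ i, 0 < p i) :
    StrictConcaveOn ℝ (Ici 0) (E.indirectUtility p) := by
  refine ⟨convex_Ici 0, fun c hc c' hc' hne s t hs ht hst => ?_⟩
  have hd := isDemand_demand hU hp hc
  have hd' := isDemand_demand hU hp hc'
  have hne' : E.demand p c ≠ E.demand p c' := fun h => hne (by rw [← hd.1.2, ← hd'.1.2, h])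
  have h1 := hU.strictConcave.2 hd.1.1 hd'.1.1 hne' hs ht hst
  have h2 := convex_bundles p hd.1 hd'.1 hs.le ht.le
  have h3 := le_indirectUtility hU hp h2.1
  rw [h2.2] at h3
  exact h1.trans_le h3

/-- Prices and expenditures at which the demand function is considered. -/
def demandDomain (n : ℕ) : Set ((Fin n → ℝ) × ℝ) := {q | (∀ i, 0 < q.1 i) ∧ 0 ≤ q.2}

/-- A maximum theorem: demand stays in a compact box near `(p, c)`, and every limit point is
affordable and at least as good as any affordable `x`, since `x` is itself a limit of bundles
affordable at nearby prices. -/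
theorem continuousOn_demand (hU : E.UtilityAssumption) :
    ContinuousOn (fun q : (Fin n → ℝ) × ℝ => E.demand q.1 q.2) (demandDomain n) := by
  rintro ⟨p, c⟩ ⟨hp, hc⟩
  simp only at hp hc
  have hfst : Tendsto (fun q : (Fin n → ℝ) × ℝ => q.1) (𝓝[demandDomain n] (p, c)) (𝓝 p) :=
    continuous_fst.continuousAt.continuousWithinAt
  have hsnd : Tendsto (fun q : (Fin n → ℝ) × ℝ => q.2) (𝓝[demandDomain n] (p, c)) (𝓝 c) :=
    continuous_snd.continuousAt.continuousWithinAt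
  have hmem : ∀ᶠ q in 𝓝[demandDomain n] (p, c), q ∈ demandDomain n := self_mem_nhdsWithin
  have hbound : ∀ᶠ q in 𝓝[demandDomain n] (p, c), ∀ i, q.2 / q.1 i ≤ c / p i + 1 := by
    refine eventually_all.2 fun i => ?_
    have : Tendsto (fun q : (Fin n → ℝ) × ℝ => q.2 / q.1 i) (𝓝[demandDomain n] (p, c))
        (𝓝 (c / p i)) := hsnd.div (tendsto_pi_nhds.1 hfst i) (hp i).ne'
    exact (this.eventually (gt_mem_nhds (lt_add_one _))).mono fun q hq => hq.le
  refine tendsto_of_unique_ultrafilter_limit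
    (isCompact_Icc (a := (0 : Fin n → ℝ)) (b := fun i => c / p i + 1)) ?_ ?_
  · filter_upwards [hmem, hbound] with q hq hb
    have := bundles_subset_Icc hq.1 (isDemand_demand hU hq.1 hq.2).1
    exact ⟨this.1, fun i => (this.2 i).trans (hb i)⟩
  · intro f b hf hb
    have hmemf := hf hmem
    have hfstf := hfst.mono_left hf
    have hsndf := hsnd.mono_left hf
    have hb0 : ∀ i, 0 ≤ b i := fun i => by
      refine ge_of_tendsto (tendsto_pi_nhds.1 hb i) ?_
      filter_upwards [hmemf] with q hq using demand_nonneg hU hq.1 hq.2 i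
    have hbc : cost p b = c := by
      have h1 : Tendsto (fun q : (Fin n → ℝ) × ℝ => cost q.1 (E.demand q.1 q.2)) f
          (𝓝 (cost p b)) :=
        (continuous_cost.tendsto (p, b)).comp (hfstf.prodMk_nhds hb)
      refine tendsto_nhds_unique h1 (hsndf.congr' ?_)
      filter_upwards [hmemf] with q hq using (cost_demand hU hq.1 hq.2).symm
    refine IsDemand.eq_demand hU hp hc ⟨⟨hb0, hbc⟩, fun x hx => ?_⟩
    -- approximate `x` by bundles that are affordable at nearby prices
    obtain ⟨w, hw, hwx⟩ : ∃ w : (Fin n → ℝ) × ℝ → Fin n → ℝ,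
        (∀ᶠ q in (f : Filter _), w q ∈ bundles q.1 q.2) ∧ Tendsto w f (𝓝 x) := by
      -- Rescaling `x` to the nearby budget divides by the cost of `x`, which vanishes for `c = 0`;
      -- in that case `x = 0` is the only bundle and uniform bundles approximate it.
      rcases hc.eq_or_lt with h0 | h0
      · refine ⟨fun q => (q.2 / ∑ i, q.1 i) • (1 : Fin n → ℝ), ?_, ?_⟩
        · filter_upwards [hmemf] with q hq using E.uniform_mem_bundles hq.1 hq.2
        · have hx0 : x = (c / ∑ i, p i) • (1 : Fin n → ℝ) := by
            have h2 := bundles_subset_Icc hp hx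
            funext i
            have h3 := h2.2 i
            simp only [← h0, zero_div] at h3
            simpa [← h0] using le_antisymm h3 (h2.1 i)
          rw [hx0]
          have hsum : Tendsto (fun q : (Fin n → ℝ) × ℝ => ∑ i, q.1 i) f (𝓝 (∑ i, p i)) :=
            tendsto_finsetSum _ fun i _ => tendsto_pi_nhds.1 hfstf i
          exact (hsndf.div hsum (E.sum_pos hp).ne').smul_const _
      · have hcost : Tendsto (fun q : (Fin n → ℝ) × ℝ => cost q.1 x) f (𝓝 c) := by
          have := ((continuous_cost_left x).tendsto p).comp hfstf
          rwa [hx.2] at this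
        refine ⟨fun q => (q.2 / cost q.1 x) • x, ?_, ?_⟩
        · filter_upwards [hmemf, hcost.eventually (lt_mem_nhds h0)] with q hq hq'
          refine ⟨fun i => ?_, ?_⟩
          · simpa using mul_nonneg (div_nonneg hq.2 hq'.le) (hx.1 i)
          · rw [cost_smul, div_mul_cancel₀ _ hq'.ne']
        · have := (hsndf.div hcost h0.ne').smul_const x
          rwa [div_self h0.ne', one_smul] at this
    have hUw : Tendsto (fun q => E.U (w q)) f (𝓝 (E.U x)) :=
      ((hU.continuousOn x hx.1).tendsto).comp (tendsto_nhdsWithin_iff.2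
        ⟨hwx, hw.mono fun q hq => hq.1⟩)
    have hUb : Tendsto (fun q : (Fin n → ℝ) × ℝ => E.U (E.demand q.1 q.2)) f (𝓝 (E.U b)) := by
      refine ((hU.continuousOn b hb0).tendsto).comp (tendsto_nhdsWithin_iff.2 ⟨hb, ?_⟩)
      filter_upwards [hmemf] with q hq using demand_nonneg hU hq.1 hq.2
    refine le_of_tendsto_of_tendsto hUw hUb ?_
    filter_upwards [hmemf, hw] with q hq hq' using (isDemand_demand hU hq.1 hq.2).2 _ hq'

theorem continuousOn_indirectUtility (hU : E.UtilityAssumption) :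
    ContinuousOn (fun q : (Fin n → ℝ) × ℝ => E.indirectUtility q.1 q.2) (demandDomain n) :=
  hU.continuousOn.comp (continuousOn_demand hU) fun _ hq => demand_nonneg hU hq.1 hq.2

theorem continuousOn_indirectUtility_right (hU : E.UtilityAssumption) (hp : ∀ i, 0 < p i) :
    ContinuousOn (E.indirectUtility p) (Ici 0) :=
  (continuousOn_indirectUtility hU).comp (f := fun c => (p, c)) (by fun_prop) fun _ hc => ⟨hp, hc⟩

theorem continuousOn_demand_right (hU : E.UtilityAssumption) (hp : ∀ i, 0 < p i) :
    ContinuousOn (E.demand p) (Ici 0) :=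
  (continuousOn_demand hU).comp (f := fun c => (p, c)) (by fun_prop) fun _ hc => ⟨hp, hc⟩

theorem differentiableAt_indirectUtility (hU : E.UtilityAssumption) (hp : ∀ i, 0 < p i)
    (hc : 0 < c) : DifferentiableAt ℝ (E.indirectUtility p) c :=
  ((hU.indirect_contDiffOn p hp).differentiableOn (by norm_num)).differentiableAt (Ioi_mem_nhds hc)

/-- Along prices that converge to a boundary point at which some good is free while some other price stays
positive, the demand blows up, uniformly over expenditures in a compact subset of `(0, ∞)`. -/
theorem tendsto_demand_boundary (hU : E.UtilityAssumption) {ps : ℕ → Fin n → ℝ}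
    (hps : ∀ q i, 0 < ps q i) (hlim : Tendsto ps atTop (𝓝 p)) {i : Fin n} (hi : p i = 0)
    {δ L : ℝ} (hδ : 0 < δ) (M : ℝ) :
    ∀ᶠ q in atTop, ∀ c ∈ Icc δ L, M < ∑ j, E.demand (ps q) c j := by
  by_contra hcon
  rw [not_eventually] at hcon
  have hcon' : ∃ᶠ q in atTop, ∃ c, c ∈ Icc δ L ∧ ∑ j, E.demand (ps q) c j ≤ M := by
    refine hcon.mono fun q hq => ?_
    push Not at hq
    exact hq
  -- Selects an offending expenditure for every index; the value `0` at the other indices is never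
  -- used.
  have hex : ∀ q, ∃ c, (∃ c, c ∈ Icc δ L ∧ ∑ j, E.demand (ps q) c j ≤ M) →
      c ∈ Icc δ L ∧ ∑ j, E.demand (ps q) c j ≤ M := fun q => by
    by_cases h : ∃ c, c ∈ Icc δ L ∧ ∑ j, E.demand (ps q) c j ≤ M
    · obtain ⟨c, hc⟩ := h
      exact ⟨c, fun _ => hc⟩
    · exact ⟨0, fun h' => (h h').elim⟩
  choose cs hcs using hex
  -- An ultrafilter concentrated on the offending indices, along which demands and expenditures both
  -- converge by compactness.
  obtain ⟨f, hf, hfQ⟩ : ∃ f : Ultrafilter ℕ, (f : Filter ℕ) ≤ atTop ∧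
      ∀ᶠ q in (f : Filter ℕ), cs q ∈ Icc δ L ∧ ∑ j, E.demand (ps q) (cs q) j ≤ M := by
    have : (atTop ⊓ 𝓟 {q | ∃ c, c ∈ Icc δ L ∧ ∑ j, E.demand (ps q) c j ≤ M} : Filter ℕ).NeBot :=
      frequently_mem_iff_neBot.1 hcon'
    refine ⟨Ultrafilter.of (atTop ⊓ 𝓟 {q | ∃ c, c ∈ Icc δ L ∧
      ∑ j, E.demand (ps q) c j ≤ M}), (Ultrafilter.of_le _).trans inf_le_left, ?_⟩
    have h1 : ∀ᶠ q in (Ultrafilter.of (atTop ⊓ 𝓟 {q | ∃ c, c ∈ Icc δ L ∧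
        ∑ j, E.demand (ps q) c j ≤ M}) : Filter ℕ), q ∈ {q | ∃ c, c ∈ Icc δ L ∧
        ∑ j, E.demand (ps q) c j ≤ M} :=
      (Ultrafilter.of_le _).trans inf_le_right (mem_principal_self _)
    exact h1.mono fun q hq => hcs q hq
  have hx0 : ∀ᶠ q in (f : Filter ℕ), ∀ j, 0 ≤ E.demand (ps q) (cs q) j := by
    filter_upwards [hfQ] with q hq using demand_nonneg hU (hps q) (hδ.le.trans hq.1.1)
  obtain ⟨x, hxK, hx⟩ := (isCompact_Icc (a := (0 : Fin n → ℝ))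
    (b := fun _ => M)).exists_tendsto_ultrafilter (f := f)
    (g := fun q => E.demand (ps q) (cs q)) (by
      filter_upwards [hfQ, hx0] with q hq hq0
      exact ⟨hq0, fun j => (Finset.single_le_sum (fun j _ => hq0 j) (Finset.mem_univ j)).trans hq.2⟩)
  obtain ⟨c₀, hc₀, hc⟩ := (isCompact_Icc (a := δ) (b := L)).exists_tendsto_ultrafilter (f := f) (g := cs) (by
    filter_upwards [hfQ] with q hq using hq.1)
  have hlimf := hlim.mono_left hf
  have hcx : cost p x = c₀ := by
    have h1 : Tendsto (fun q => cost (ps q) (E.demand (ps q) (cs q))) f (𝓝 (cost p x)) :=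
      (continuous_cost.tendsto (p, x)).comp (hlimf.prodMk_nhds hx)
    refine tendsto_nhds_unique h1 (hc.congr' ?_)
    filter_upwards [hfQ] with q hq using (cost_demand hU (hps q) (hδ.le.trans hq.1.1)).symm
  have hc₀pos : 0 < c₀ := hδ.trans_le hc₀.1
  -- the bundle `t • x + e_i` with `t < 1` close to `1` is better than `x` and eventually cheaper
  have hup : E.U x < E.U (x + Pi.single i 1) := by
    refine hU.strictMono hxK.1 (fun j => add_nonneg (hxK.1 j) ?_) ?_
    · by_cases h : j = i
      · subst h; simp
      · simp [h]
    · refine lt_of_le_of_ne (fun j => ?_) fun h => ?_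
      · by_cases h : j = i
        · subst h; simp
        · simp [h]
      · have := congrFun h i
        simp at this
  have hcontt : Tendsto (fun t : ℝ => t • x + Pi.single i 1) (𝓝[Icc 0 1] 1)
      (𝓝[{x | ∀ i, 0 ≤ x i}] (x + Pi.single i 1)) := by
    refine tendsto_nhdsWithin_iff.2 ⟨?_, ?_⟩
    · have : Continuous fun t : ℝ => t • x + (Pi.single i 1 : Fin n → ℝ) := by fun_prop
      have h2 := this.tendsto 1
      rw [one_smul] at h2
      exact h2.mono_left nhdsWithin_le_nhds
    · filter_upwards [self_mem_nhdsWithin] with t ht j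
      refine add_nonneg (mul_nonneg ht.1 (hxK.1 j)) ?_
      by_cases h : j = i
      · subst h; simp
      · simp [h]
  have hev : ∀ᶠ t in 𝓝[Icc 0 1] (1 : ℝ), E.U x < E.U (t • x + Pi.single i 1) := by
    refine ((hU.continuousOn _ ?_).tendsto.comp hcontt).eventually (lt_mem_nhds hup)
    intro j
    refine add_nonneg (hxK.1 j) ?_
    by_cases h : j = i
    · subst h; simp
    · simp [h]
  obtain ⟨t, ht0, ht1, htU⟩ : ∃ t : ℝ, 0 ≤ t ∧ t < 1 ∧ E.U x < E.U (t • x + Pi.single i 1) := by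
    have h1 : 𝓝[Ico 0 1] (1 : ℝ) ≤ 𝓝[Icc 0 1] 1 := nhdsWithin_mono _ Ico_subset_Icc_self
    have hne : (𝓝[Ico 0 1] (1 : ℝ)).NeBot := by
      refine mem_closure_iff_nhdsWithin_neBot.1 ?_
      rw [closure_Ico (by norm_num)]; simp
    obtain ⟨t, h2, h3⟩ := ((hev.filter_mono h1).and self_mem_nhdsWithin).exists
    exact ⟨t, h3.1, h3.2, h2⟩
  set w : Fin n → ℝ := t • x + Pi.single i 1 with hw
  have hw0 : ∀ j, 0 ≤ w j := fun j => by
    refine add_nonneg (mul_nonneg ht0 (hxK.1 j)) ?_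
    by_cases h : j = i
    · subst h; simp
    · simp [h]
  have hcostw : cost p w < c₀ := by
    have : cost p (Pi.single i 1) = 0 := by
      simp [cost, Pi.single_apply, hi]
    rw [hw, cost_add, cost_smul, hcx, this]
    nlinarith
  have h1 : Tendsto (fun q => cs q - cost (ps q) w) f (𝓝 (c₀ - cost p w)) :=
    hc.sub (((continuous_cost_left w).tendsto p).comp hlimf)
  have h2 : Tendsto (fun q => E.U (E.demand (ps q) (cs q))) f (𝓝 (E.U x)) :=
    ((hU.continuousOn x hxK.1).tendsto).comp (tendsto_nhdsWithin_iff.2 ⟨hx, hx0⟩)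
  -- At such an index `w` costs less than the expenditure `cs q` but is strictly better than the
  -- demanded bundle.
  obtain ⟨q, hq1, hq2, hq3⟩ := ((h1.eventually (lt_mem_nhds (sub_pos.2 hcostw))).and
    ((h2.eventually (gt_mem_nhds htU)).and hfQ)).exists
  have h3 := le_indirectUtility hU (hps q) hw0
  have h4 : E.indirectUtility (ps q) (cost (ps q) w) ≤ E.indirectUtility (ps q) (cs q) :=
    (indirectUtility_strictMonoOn hU (hps q)).monotoneOn
      (cost_nonneg (fun i => (hps q i).le) hw0) (hδ.le.trans hq3.1.1) (by linarith)
  have h5 : E.indirectUtility (ps q) (cs q) = E.U (E.demand (ps q) (cs q)) := rfl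
  linarith

end Economy

end

/-! ### Wealth levels, strategies and the Bellman equation. -/

noncomputable section

namespace Economy

variable {n : ℕ} {E : Economy n} {p : Fin n → ℝ} {r a b c : ℝ}

theorem minEndow_le {y : Fin n → ℝ} (hy : y ∈ E.Y) : E.minEndow p ≤ cost p y :=
  Finset.inf'_le _ hy

theorem le_maxEndow {y : Fin n → ℝ} (hy : y ∈ E.Y) : cost p y ≤ E.maxEndow p :=
  Finset.le_sup' (cost p) hy

theorem exists_minEndow (E : Economy n) (p : Fin n → ℝ) : ∃ y ∈ E.Y, E.minEndow p = cost p y :=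
  Finset.exists_mem_eq_inf' E.Y_nontrivial.nonempty _

theorem cost_lt_cost (E : Economy n) (hp : ∀ i, 0 < p i) {x y : Fin n → ℝ}
    (h : ∀ i, x i < y i) : cost p x < cost p y :=
  Finset.sum_lt_sum_of_nonempty E.univ_nonempty fun i _ => mul_lt_mul_of_pos_left (h i) (hp i)

theorem cost_pos (hp : ∀ i, 0 < p i) {y : Fin n → ℝ} (hy : y ∈ E.Y) : 0 < cost p y :=
  Finset.sum_pos (fun i _ => mul_pos (hp i) (E.Y_pos y hy i)) E.univ_nonempty

theorem minEndow_pos (hp : ∀ i, 0 < p i) : 0 < E.minEndow p := by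
  obtain ⟨y, hy, h⟩ := E.exists_minEndow p
  rw [h]; exact cost_pos hp hy

/-- The endowment that dominates all others yields the largest income, which exceeds the smallest. -/
theorem exists_maxEndow (E : Economy n) (hp : ∀ i, 0 < p i) :
    ∃ y ∈ E.Y, cost p y = E.maxEndow p ∧ E.minEndow p < E.maxEndow p := by
  obtain ⟨y', hy', h⟩ := E.Y_top
  have hmax : cost p y' = E.maxEndow p := by
    refine le_antisymm (le_maxEndow hy') (Finset.sup'_le _ _ fun y hy => ?_)
    rcases eq_or_ne y y' with rfl | hne
    · exact le_rfl
    · exact (E.cost_lt_cost hp (h y hy hne)).le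
  obtain ⟨y, hy, hne⟩ := E.Y_nontrivial.exists_ne y'
  refine ⟨y', hy', hmax, ?_⟩
  rw [← hmax]
  exact (minEndow_le hy).trans_lt (E.cost_lt_cost hp (h y hy hne))

theorem savingsCap_eq (E : Economy n) (p : Fin n → ℝ) (r : ℝ) :
    E.savingsCap p r = (∑ i, p i) * E.bbar / (1 - r) ^ 2 := by
  simp [savingsCap, Finset.sum_div, Finset.sum_mul]

theorem savingsCap_pos (hp : ∀ i, 0 < p i) (hr1 : r < 1) : 0 < E.savingsCap p r := by
  rw [savingsCap_eq]
  exact div_pos (mul_pos (E.sum_pos hp) E.bbar_pos) (pow_pos (by linarith) 2)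

theorem borrowLimit_neg (hp : ∀ i, 0 < p i) (hr : 0 < r) : E.borrowLimit p r < 0 :=
  neg_neg_of_pos (div_pos (minEndow_pos hp) hr)

theorem borrowLimit_lt_savingsCap (hp : ∀ i, 0 < p i) (hr : 0 < r) (hr1 : r < 1) :
    E.borrowLimit p r < E.savingsCap p r :=
  (borrowLimit_neg hp hr).trans (savingsCap_pos hp hr1)

/-- The borrowing limit is the natural one: the smallest endowment just pays the interest on it.
Hence the least admissible savings and the least wealth level coincide. -/
theorem borrowLimit_fixed (hr : 0 < r) :
    (1 + r) * E.borrowLimit p r + E.minEndow p = E.borrowLimit p r := by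
  unfold borrowLimit
  field_simp
  ring

/-- The largest wealth level. -/
def wealthTop (E : Economy n) (p : Fin n → ℝ) (r : ℝ) : ℝ :=
  (1 + r) * E.savingsCap p r + E.maxEndow p

theorem wealthSet_eq (hr : 0 < r) :
    E.wealthSet p r = Icc (E.borrowLimit p r) (E.wealthTop p r) := by
  rw [wealthSet, borrowLimit_fixed hr, wealthTop]

theorem savingsCap_lt_wealthTop (hp : ∀ i, 0 < p i) (hr : 0 < r) (hr1 : r < 1) :
    E.savingsCap p r < E.wealthTop p r := by
  have h1 := savingsCap_pos (E := E) hp hr1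
  obtain ⟨y, hy, h2, -⟩ := E.exists_maxEndow hp
  have h3 := cost_pos hp hy
  unfold wealthTop
  nlinarith

theorem borrowLimit_lt_wealthTop (hp : ∀ i, 0 < p i) (hr : 0 < r) (hr1 : r < 1) :
    E.borrowLimit p r < E.wealthTop p r :=
  (borrowLimit_lt_savingsCap hp hr hr1).trans (savingsCap_lt_wealthTop hp hr hr1)

theorem borrowLimit_le_next (hr : 0 < r) (hb : E.borrowLimit p r ≤ b)
    {y : Fin n → ℝ} (hy : y ∈ E.Y) : E.borrowLimit p r ≤ (1 + r) * b + cost p y := by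
  have h1 := borrowLimit_fixed (E := E) (p := p) hr
  have h2 := minEndow_le (p := p) hy
  nlinarith

theorem next_mem_wealthSet (hr : 0 < r)
    (hb : b ∈ Icc (E.borrowLimit p r) (E.savingsCap p r)) {y : Fin n → ℝ} (hy : y ∈ E.Y) :
    (1 + r) * b + cost p y ∈ E.wealthSet p r := by
  rw [wealthSet_eq hr]
  refine ⟨borrowLimit_le_next hr hb.1 hy, ?_⟩
  have h2 := le_maxEndow (p := p) hy
  have h3 := hb.2
  unfold wealthTop
  nlinarith

theorem savingsSet_subset (E : Economy n) (p : Fin n → ℝ) (r a : ℝ) :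
    E.savingsSet p r a ⊆ Icc (E.borrowLimit p r) (E.savingsCap p r) :=
  Icc_subset_Icc_right (min_le_right _ _)

theorem borrowLimit_mem_savingsSet (hp : ∀ i, 0 < p i) (hr : 0 < r) (hr1 : r < 1)
    (ha : E.borrowLimit p r ≤ a) : E.borrowLimit p r ∈ E.savingsSet p r a :=
  ⟨le_rfl, le_min ha (borrowLimit_lt_savingsCap hp hr hr1).le⟩

/-! ### Strategies -/

theorem IsStrategy.shift {π : List ℝ → Fin n → ℝ} (hπ : E.IsStrategy p r π)
    (ha : a ∈ E.wealthSet p r) : E.IsStrategy p r fun h => π (a :: h) :=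
  fun h hh a' ha' => hπ (a :: h) (by simpa using ⟨ha, hh⟩) a' ha'

theorem IsStrategy.first {π : List ℝ → Fin n → ℝ} (hπ : E.IsStrategy p r π)
    (ha : a ∈ E.wealthSet p r) :
    (∀ i, 0 ≤ π [a] i) ∧ a - cost p (π [a]) ∈ E.savingsSet p r a :=
  hπ [] (by simp) a ha

theorem expectedUtility_zero (π : List ℝ → Fin n → ℝ) :
    E.expectedUtility p r π a 0 = E.U (π [a]) := by
  simp [expectedUtility, history]

/-- Conditioning on the first of the `t + 1` draws: what remains is the problem over `t` periods for
the continuation strategy. -/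
theorem expectedUtility_succ (π : List ℝ → Fin n → ℝ) (t : ℕ) :
    E.expectedUtility p r π a (t + 1) = ∑ y ∈ E.Y, E.e y *
      E.expectedUtility p r (fun h => π (a :: h)) ((1 + r) * (a - cost p (π [a])) + cost p y) t := by
  rw [← Finset.sum_coe_sort E.Y]
  unfold expectedUtility
  simp_rw [Finset.mul_sum]
  rw [← Fintype.sum_prod_type' (f := fun (y : E.Y) (ω : Fin t → E.Y) => E.e y *
    ((∏ s, E.e (ω s)) * E.U (π (a :: history p r (fun h => π (a :: h))
      ((1 + r) * (a - cost p (π [a])) + cost p y) (List.ofFn fun s => (ω s : Fin n → ℝ))))))]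
  refine (Fintype.sum_equiv (Fin.consEquiv fun _ : Fin (t + 1) => (E.Y : Type _)) _ _ ?_).symm
  rintro ⟨y, ω⟩
  simp [Fin.prod_univ_succ, List.ofFn_succ, history, Fin.consEquiv, mul_assoc]

/-- A bound on the utility of all bundles that can be afforded at some wealth level. -/
def utilityBound (E : Economy n) (p : Fin n → ℝ) (r : ℝ) : ℝ :=
  |E.indirectUtility p 0| + |E.indirectUtility p (E.wealthTop p r - E.borrowLimit p r)|

theorem abs_indirectUtility_le (hU : E.UtilityAssumption) (hp : ∀ i, 0 < p i) (hc : 0 ≤ c)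
    (hc' : c ≤ E.wealthTop p r - E.borrowLimit p r) :
    |E.indirectUtility p c| ≤ E.utilityBound p r := by
  have hm := (indirectUtility_strictMonoOn hU hp).monotoneOn
  have h1 := hm (mem_Ici.2 le_rfl) (mem_Ici.2 hc) hc
  have h2 := hm (mem_Ici.2 hc) (mem_Ici.2 (hc.trans hc')) hc'
  unfold utilityBound
  rw [abs_le]
  constructor
  · linarith [neg_abs_le (E.indirectUtility p 0),
      abs_nonneg (E.indirectUtility p (E.wealthTop p r - E.borrowLimit p r))]
  · linarith [le_abs_self (E.indirectUtility p (E.wealthTop p r - E.borrowLimit p r)),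
      abs_nonneg (E.indirectUtility p 0)]

/-- The lower bound is `U 0`, which equals the indirect utility of zero because at positive prices
only the zero bundle costs nothing. -/
theorem abs_utility_le (hU : E.UtilityAssumption) (hp : ∀ i, 0 < p i) {x : Fin n → ℝ}
    (hx : ∀ i, 0 ≤ x i) (hx' : cost p x ≤ E.wealthTop p r - E.borrowLimit p r) :
    |E.U x| ≤ E.utilityBound p r := by
  have h0 := abs_indirectUtility_le (r := r) hU hp (cost_nonneg (fun i => (hp i).le) hx) hx'
  have h1 := abs_indirectUtility_le (r := r) hU hp le_rfl
    ((cost_nonneg (fun i => (hp i).le) hx).trans hx')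
  have h2 := le_indirectUtility hU hp hx
  have hd : E.demand p 0 = 0 := by
    have h3 := bundles_subset_Icc hp (isDemand_demand hU hp le_rfl).1
    funext i
    exact le_antisymm (by simpa using h3.2 i) (h3.1 i)
  have h3 : E.indirectUtility p 0 ≤ E.U x := by
    rw [indirectUtility, hd]
    exact hU.strictMono.monotoneOn (fun i => le_rfl) hx hx
  rw [abs_le] at *
  exact ⟨h1.1.trans h3, h2.trans h0.2⟩

theorem abs_first_le (hU : E.UtilityAssumption) (hp : ∀ i, 0 < p i) (hr : 0 < r)
    {π : List ℝ → Fin n → ℝ} (hπ : E.IsStrategy p r π) (ha : a ∈ E.wealthSet p r) :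
    |E.U (π [a])| ≤ E.utilityBound p r := by
  have h := hπ.first ha
  rw [wealthSet_eq hr] at ha
  exact abs_utility_le hU hp h.1 (by linarith [h.2.1, ha.2])

theorem abs_sum_le (E : Economy n) {f : (Fin n → ℝ) → ℝ} {M : ℝ} (h : ∀ y ∈ E.Y, |f y| ≤ M) :
    |∑ y ∈ E.Y, E.e y * f y| ≤ M := by
  calc |∑ y ∈ E.Y, E.e y * f y| ≤ ∑ y ∈ E.Y, |E.e y * f y| := Finset.abs_sum_le_sum_abs _ _
    _ ≤ ∑ y ∈ E.Y, E.e y * M := Finset.sum_le_sum fun y hy => by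
        rw [abs_mul, abs_of_pos (E.e_pos y hy)]
        exact mul_le_mul_of_nonneg_left (h y hy) (E.e_pos y hy).le
    _ = M := by rw [← Finset.sum_mul, E.e_sum, one_mul]

theorem abs_expectedUtility_le (hU : E.UtilityAssumption) (hp : ∀ i, 0 < p i) (hr : 0 < r)
    (t : ℕ) : ∀ {π : List ℝ → Fin n → ℝ} {a : ℝ}, E.IsStrategy p r π → a ∈ E.wealthSet p r →
      |E.expectedUtility p r π a t| ≤ E.utilityBound p r := by
  induction t with
  | zero =>
    intro π a hπ ha
    rw [expectedUtility_zero]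
    exact abs_first_le hU hp hr hπ ha
  | succ t ih =>
    intro π a hπ ha
    rw [expectedUtility_succ]
    exact E.abs_sum_le fun y hy => ih (hπ.shift ha)
      (next_mem_wealthSet hr (E.savingsSet_subset p r a (hπ.first ha).2) hy)

theorem β_pos (E : Economy n) : 0 < E.β := by linarith [E.β_gt]

theorem summable_discounted (hU : E.UtilityAssumption) (hp : ∀ i, 0 < p i) (hr : 0 < r)
    {π : List ℝ → Fin n → ℝ} (hπ : E.IsStrategy p r π) (ha : a ∈ E.wealthSet p r) :
    Summable fun t => E.β ^ t * E.expectedUtility p r π a t := by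
  refine Summable.of_norm_bounded
    ((summable_geometric_of_lt_one E.β_pos.le E.β_lt).mul_right (E.utilityBound p r)) fun t => ?_
  rw [norm_mul, norm_pow, Real.norm_eq_abs, Real.norm_eq_abs, abs_of_pos E.β_pos]
  exact mul_le_mul_of_nonneg_left (abs_expectedUtility_le hU hp hr t hπ ha)
    (pow_nonneg E.β_pos.le t)

theorem abs_strategyValue_le (hU : E.UtilityAssumption) (hp : ∀ i, 0 < p i) (hr : 0 < r)
    {π : List ℝ → Fin n → ℝ} (hπ : E.IsStrategy p r π) (ha : a ∈ E.wealthSet p r) :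
    |E.strategyValue p r π a| ≤ E.utilityBound p r / (1 - E.β) := by
  have h := tsum_of_norm_bounded
    ((hasSum_geometric_of_lt_one E.β_pos.le E.β_lt).mul_right (E.utilityBound p r))
    (f := fun t => E.β ^ t * E.expectedUtility p r π a t) fun t => by
      rw [norm_mul, norm_pow, Real.norm_eq_abs, Real.norm_eq_abs, abs_of_pos E.β_pos]
      exact mul_le_mul_of_nonneg_left (abs_expectedUtility_le hU hp hr t hπ ha)
        (pow_nonneg E.β_pos.le t)
  rwa [Real.norm_eq_abs, inv_mul_eq_div] at h

theorem strategyValue_eq (hU : E.UtilityAssumption) (hp : ∀ i, 0 < p i) (hr : 0 < r)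
    {π : List ℝ → Fin n → ℝ} (hπ : E.IsStrategy p r π) (ha : a ∈ E.wealthSet p r) :
    E.strategyValue p r π a = E.U (π [a]) + E.β * ∑ y ∈ E.Y, E.e y *
      E.strategyValue p r (fun h => π (a :: h))
        ((1 + r) * (a - cost p (π [a])) + cost p y) := by
  rw [strategyValue, (summable_discounted hU hp hr hπ ha).tsum_eq_zero_add,
    expectedUtility_zero, pow_zero, one_mul]
  congr 1
  simp_rw [expectedUtility_succ, strategyValue, ← tsum_mul_left]
  rw [← Summable.tsum_finsetSum, ← tsum_mul_left]
  · refine tsum_congr fun t => ?_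
    rw [Finset.mul_sum, Finset.mul_sum]
    refine Finset.sum_congr rfl fun y _ => ?_
    ring
  · intro y hy
    exact (summable_discounted hU hp hr (hπ.shift ha)
      (next_mem_wealthSet hr (E.savingsSet_subset p r a (hπ.first ha).2) hy)).mul_left _

/-- The values of the strategies at wealth `a`. -/
def strategyValues (E : Economy n) (p : Fin n → ℝ) (r a : ℝ) : Set ℝ :=
  {v | ∃ π, E.IsStrategy p r π ∧ v = E.strategyValue p r π a}

/-- Pasting: save `b` at initial wealth `a`, then follow the strategy assigned to the wealth `a'` of
the second period, as if the problem began there. -/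
theorem exists_isStrategy_of_feasible (hU : E.UtilityAssumption) (hp : ∀ i, 0 < p i) (hr : 0 < r)
    (hr1 : r < 1) (πs : ℝ → List ℝ → Fin n → ℝ) (hπs : ∀ a, E.IsStrategy p r (πs a))
    (ha : a ∈ E.wealthSet p r) (hb : b ∈ E.savingsSet p r a) :
    ∃ π, E.IsStrategy p r π ∧ π [a] = E.demand p (a - b) ∧
      ∀ a' h, π (a :: a' :: h) = πs a' (a' :: h) := by
  classical
  refine ⟨fun h => match h with
    -- No feasibility condition concerns the empty history. At initial wealth other than `a` any
    -- feasible choice would do; borrowing to the limit is always one.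
    | [] => 0
    | [a'] => if a' = a then E.demand p (a - b) else E.demand p (a' - E.borrowLimit p r)
    | _ :: a' :: h => πs a' (a' :: h), ?_, by simp, fun a' h => rfl⟩
  intro h hh a' ha'
  match h with
  | [] =>
    rw [wealthSet_eq hr] at ha ha'
    have hab : 0 ≤ a - b := sub_nonneg.2 (hb.2.trans (min_le_left _ _))
    simp only [List.nil_append]
    split_ifs with h
    · subst h
      refine ⟨demand_nonneg hU hp hab, ?_⟩
      rw [cost_demand hU hp hab, sub_sub_cancel]
      exact hb
    · have h1 := sub_nonneg.2 ha'.1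
      refine ⟨demand_nonneg hU hp h1, ?_⟩
      rw [cost_demand hU hp h1, sub_sub_cancel]
      exact borrowLimit_mem_savingsSet hp hr hr1 ha'.1
  | [a₁] => exact hπs a' [] (by simp) a' ha'
  | a₁ :: a₂ :: h =>
    exact hπs a₂ (a₂ :: h) (fun x hx => hh x (List.mem_cons_of_mem _ hx)) a' ha'

theorem exists_isStrategy (hU : E.UtilityAssumption) (hp : ∀ i, 0 < p i) (hr : 0 < r)
    (hr1 : r < 1) : ∃ π, E.IsStrategy p r π := by
  refine ⟨fun h => E.demand p (h.getLast?.getD 0 - E.borrowLimit p r), fun h _ a ha => ?_⟩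
  rw [wealthSet_eq hr] at ha
  have h1 := sub_nonneg.2 ha.1
  simp only [List.getLast?_append, List.getLast?_singleton, Option.some_or, Option.getD_some]
  refine ⟨demand_nonneg hU hp h1, ?_⟩
  rw [cost_demand hU hp h1, sub_sub_cancel]
  exact borrowLimit_mem_savingsSet hp hr hr1 ha.1

theorem isLUB_value (hU : E.UtilityAssumption) (hp : ∀ i, 0 < p i) (hr : 0 < r)
    (hr1 : r < 1) (ha : a ∈ E.wealthSet p r) :
    IsLUB (E.strategyValues p r a) (E.value p r a) := by
  refine isLUB_csSup ?_ ?_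
  · obtain ⟨π, hπ⟩ := exists_isStrategy hU hp hr hr1
    exact ⟨_, π, hπ, rfl⟩
  · refine ⟨E.utilityBound p r / (1 - E.β), ?_⟩
    rintro _ ⟨π, hπ, rfl⟩
    exact (abs_le.1 (abs_strategyValue_le hU hp hr hπ ha)).2

theorem abs_value_le (hU : E.UtilityAssumption) (hp : ∀ i, 0 < p i) (hr : 0 < r)
    (hr1 : r < 1) (ha : a ∈ E.wealthSet p r) :
    |E.value p r a| ≤ E.utilityBound p r / (1 - E.β) := by
  have h := isLUB_value hU hp hr hr1 ha
  rw [abs_le]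
  constructor
  · obtain ⟨π, hπ⟩ := exists_isStrategy hU hp hr hr1
    exact (abs_le.1 (abs_strategyValue_le hU hp hr hπ ha)).1.trans (h.1 ⟨π, hπ, rfl⟩)
  · refine h.2 ?_
    rintro _ ⟨π, hπ, rfl⟩
    exact (abs_le.1 (abs_strategyValue_le hU hp hr hπ ha)).2

/-- The Bellman equation. -/
theorem isLUB_savingsObjective (hU : E.UtilityAssumption) (hp : ∀ i, 0 < p i) (hr : 0 < r)
    (hr1 : r < 1) (ha : a ∈ E.wealthSet p r) :
    IsLUB (E.savingsObjective p r a '' E.savingsSet p r a) (E.value p r a) := by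
  constructor
  · rintro _ ⟨b, hb, rfl⟩
    -- Saving `b` and continuing with an `ε`-optimal strategy from each second-period wealth loses
    -- at most `β ε ≤ ε`.
    refine le_of_forall_pos_le_add fun ε hε => ?_
    have hex : ∀ a', ∃ π, E.IsStrategy p r π ∧
        (a' ∈ E.wealthSet p r → E.value p r a' - ε < E.strategyValue p r π a') := by
      intro a'
      by_cases ha' : a' ∈ E.wealthSet p r
      · obtain ⟨_, ⟨π, hπ, rfl⟩, h, -⟩ :=
          (isLUB_value hU hp hr hr1 ha').exists_between (sub_lt_self _ hε)
        exact ⟨π, hπ, fun _ => h⟩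
      · obtain ⟨π, hπ⟩ := exists_isStrategy hU hp hr hr1
        exact ⟨π, hπ, fun h => (ha' h).elim⟩
    choose πs hπs hval using hex
    obtain ⟨π, hπ, hfirst, hrest⟩ :=
      exists_isStrategy_of_feasible hU hp hr hr1 πs hπs ha hb
    have hab : 0 ≤ a - b := sub_nonneg.2 (hb.2.trans (min_le_left _ _))
    have h1 := (isLUB_value hU hp hr hr1 ha).1 ⟨π, hπ, rfl⟩
    rw [strategyValue_eq hU hp hr hπ ha, hfirst, cost_demand hU hp hab, sub_sub_cancel] at h1
    have h2 : ∀ y ∈ E.Y, E.value p r ((1 + r) * b + cost p y) - ε ≤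
        E.strategyValue p r (fun h => π (a :: h)) ((1 + r) * b + cost p y) := by
      intro y hy
      have hm := next_mem_wealthSet hr (E.savingsSet_subset p r a hb) hy
      refine (hval _ hm).le.trans (le_of_eq ?_)
      -- Started at `a'`, a strategy is evaluated only on histories that begin with `a'`, and these
      -- are the only ones on which the pasted strategy agrees with `πs a'`.
      have key : ∀ (ρ σ : List ℝ → Fin n → ℝ) (a' : ℝ), (∀ h, ρ (a' :: h) = σ (a' :: h)) →
          E.strategyValue p r ρ a' = E.strategyValue p r σ a' := by
        intro ρ σ a' hρσ
        have : ∀ ys, ρ (history p r ρ a' ys) = σ (history p r σ a' ys) := by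
          intro ys
          cases ys with
          | nil => simp only [history]; exact hρσ []
          | cons y ys =>
            simp only [history]
            rw [hρσ [], hρσ, show (fun h => ρ (a' :: h)) = fun h => σ (a' :: h) from funext hρσ]
        simp only [strategyValue, expectedUtility, this]
      exact key _ _ _ fun h => (hrest _ h).symm
    have h3 : ∑ y ∈ E.Y, E.e y * (E.value p r ((1 + r) * b + cost p y) - ε) ≤
        ∑ y ∈ E.Y, E.e y * E.strategyValue p r (fun h => π (a :: h)) ((1 + r) * b + cost p y) :=
      Finset.sum_le_sum fun y hy => mul_le_mul_of_nonneg_left (h2 y hy) (E.e_pos y hy).le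
    simp only [mul_sub, Finset.sum_sub_distrib, ← Finset.sum_mul, E.e_sum, one_mul] at h3
    have h4 := mul_le_mul_of_nonneg_left h3 E.β_pos.le
    unfold savingsObjective
    nlinarith [E.β_lt]
  · intro v hv
    refine (isLUB_value hU hp hr hr1 ha).2 ?_
    rintro _ ⟨π, hπ, rfl⟩
    have hf := hπ.first ha
    refine le_trans ?_ (hv ⟨_, hf.2, rfl⟩)
    rw [strategyValue_eq hU hp hr hπ ha, savingsObjective, sub_sub_cancel]
    refine add_le_add (le_indirectUtility hU hp hf.1) (mul_le_mul_of_nonneg_left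
      (Finset.sum_le_sum fun y hy => mul_le_mul_of_nonneg_left ?_ (E.e_pos y hy).le) E.β_pos.le)
    exact (isLUB_value hU hp hr hr1 (next_mem_wealthSet hr
      (E.savingsSet_subset p r a hf.2) hy)).1 ⟨_, hπ.shift ha, rfl⟩

end Economy

end

/-! ### Value iteration: continuity and concavity of the value function. -/

noncomputable section

/-- Suprema are 1-Lipschitz in the uniform distance; this is what makes the Bellman operator a
contraction. -/
theorem abs_sub_le_of_isLUB {α : Type*} {f g : α → ℝ} {S : Set α} {x y d : ℝ}
    (hx : IsLUB (f '' S) x) (hy : IsLUB (g '' S) y) (h : ∀ b ∈ S, |f b - g b| ≤ d) :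
    |x - y| ≤ d := by
  have h1 : x ≤ y + d := hx.2 (by
    rintro _ ⟨b, hb, rfl⟩
    linarith [(abs_le.1 (h b hb)).2, hy.1 (mem_image_of_mem g hb)])
  have h2 : y ≤ x + d := hy.2 (by
    rintro _ ⟨b, hb, rfl⟩
    linarith [(abs_le.1 (h b hb)).1, hx.1 (mem_image_of_mem f hb)])
  rw [abs_le]
  constructor <;> linarith

namespace Economy

variable {n : ℕ} {E : Economy n} {p : Fin n → ℝ} {r a b c : ℝ}

/-- Positive prices together with an interest rate in `(0, 1)`. -/
abbrev PriceDomain (n : ℕ) : Type :=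
  {z : (Fin n → ℝ) × ℝ // (∀ i, 0 < z.1 i) ∧ 0 < z.2 ∧ z.2 < 1}

theorem continuous_minEndow (E : Economy n) : Continuous E.minEndow := by
  unfold minEndow
  exact Continuous.finset_inf'_apply _ fun y _ => continuous_cost_left y

theorem continuous_maxEndow (E : Economy n) : Continuous E.maxEndow := by
  unfold maxEndow
  exact Continuous.finset_sup'_apply _ fun y _ => continuous_cost_left y

theorem continuous_borrowLimit (E : Economy n) :
    Continuous fun z : PriceDomain n => E.borrowLimit z.1.1 z.1.2 := by
  unfold borrowLimit
  refine Continuous.neg (Continuous.div ?_ (by fun_prop) fun z => z.2.2.1.ne')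
  exact E.continuous_minEndow.comp (by fun_prop)

theorem continuous_savingsCap (E : Economy n) :
    Continuous fun z : PriceDomain n => E.savingsCap z.1.1 z.1.2 := by
  unfold savingsCap
  refine continuous_finsetSum _ fun i _ => Continuous.div (by fun_prop) (by fun_prop) fun z => ?_
  exact pow_ne_zero 2 (sub_pos.2 z.2.2.2).ne'

theorem continuous_wealthTop (E : Economy n) :
    Continuous fun z : PriceDomain n => E.wealthTop z.1.1 z.1.2 := by
  unfold wealthTop
  have h1 := E.continuous_savingsCap
  have h2 : Continuous fun z : PriceDomain n => E.maxEndow z.1.1 :=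
    E.continuous_maxEndow.comp (by fun_prop)
  fun_prop

theorem continuous_indirectUtility_max (hU : E.UtilityAssumption) :
    Continuous fun q : PriceDomain n × ℝ => E.indirectUtility q.1.1.1 (max q.2 0) :=
  (continuousOn_indirectUtility hU).comp_continuous
    (f := fun q : PriceDomain n × ℝ => (q.1.1.1, max q.2 0)) (by fun_prop)
    fun q => ⟨q.1.2.1, le_max_right _ _⟩

theorem continuous_utilityBound (hU : E.UtilityAssumption) :
    Continuous fun z : PriceDomain n => E.utilityBound z.1.1 z.1.2 := by
  have h0 : Continuous fun z : PriceDomain n => E.indirectUtility z.1.1 0 := by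
    refine ((continuous_indirectUtility_max hU).comp
      (f := fun z : PriceDomain n => (z, (0 : ℝ))) (by fun_prop)).congr fun z => ?_
    simp only [Function.comp, max_self]
  have h1 : Continuous fun z : PriceDomain n => E.indirectUtility z.1.1
      (E.wealthTop z.1.1 z.1.2 - E.borrowLimit z.1.1 z.1.2) := by
    refine ((continuous_indirectUtility_max hU).comp (f := fun z : PriceDomain n =>
      (z, E.wealthTop z.1.1 z.1.2 - E.borrowLimit z.1.1 z.1.2))
      (continuous_id.prodMk (E.continuous_wealthTop.sub E.continuous_borrowLimit))).congr fun z => ?_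
    simp only [Function.comp]
    rw [max_eq_left]
    exact (sub_pos.2 (borrowLimit_lt_wealthTop z.2.1 z.2.2.1 z.2.2.2)).le
  exact h0.abs.add h1.abs

/-- The nearest point of the wealth set. -/
def clamp (E : Economy n) (p : Fin n → ℝ) (r a : ℝ) : ℝ :=
  max (E.borrowLimit p r) (min a (E.wealthTop p r))

theorem clamp_mem (hp : ∀ i, 0 < p i) (hr : 0 < r) (hr1 : r < 1) (a : ℝ) :
    E.clamp p r a ∈ E.wealthSet p r := by
  rw [wealthSet_eq hr]
  exact ⟨le_max_left _ _, max_le (borrowLimit_lt_wealthTop hp hr hr1).le (min_le_right _ _)⟩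

theorem clamp_of_mem (hr : 0 < r) (ha : a ∈ E.wealthSet p r) : E.clamp p r a = a := by
  rw [wealthSet_eq hr] at ha
  rw [clamp, min_eq_left ha.2, max_eq_right ha.1]

theorem continuous_clamp (E : Economy n) :
    Continuous fun q : PriceDomain n × ℝ => E.clamp q.1.1.1 q.1.1.2 q.2 :=
  (E.continuous_borrowLimit.comp continuous_fst).max
    (continuous_snd.min (E.continuous_wealthTop.comp continuous_fst))

/-- The objective of the savings problem with continuation value `v`. -/
def objectiveOf (E : Economy n) (p : Fin n → ℝ) (r : ℝ) (v : ℝ → ℝ) (a b : ℝ) : ℝ :=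
  E.indirectUtility p (a - b) + E.β * ∑ y ∈ E.Y, E.e y * v ((1 + r) * b + cost p y)

theorem savingsObjective_eq (E : Economy n) (p : Fin n → ℝ) (r a b : ℝ) :
    E.savingsObjective p r a b = E.objectiveOf p r (E.value p r) a b := rfl

/-- Value iteration, starting from the zero function. -/
def valueIter (E : Economy n) (p : Fin n → ℝ) (r : ℝ) : ℕ → ℝ → ℝ
  | 0 => fun _ => 0
  | N + 1 => fun a => sSup (E.objectiveOf p r (valueIter E p r N) a '' E.savingsSet p r a)

/-- The savings level at relative position `θ` of the savings set. -/
def savingsAt (E : Economy n) (p : Fin n → ℝ) (r a θ : ℝ) : ℝ :=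
  E.borrowLimit p r + θ * (min a (E.savingsCap p r) - E.borrowLimit p r)

/-- Turns maximization over a moving interval into maximization over the fixed compact set `[0, 1]`,
for which suprema of jointly continuous functions are continuous. -/
theorem savingsAt_image (hp : ∀ i, 0 < p i) (hr : 0 < r) (hr1 : r < 1)
    (ha : E.borrowLimit p r ≤ a) : E.savingsAt p r a '' Icc 0 1 = E.savingsSet p r a := by
  have hle : E.borrowLimit p r ≤ min a (E.savingsCap p r) :=
    le_min ha (borrowLimit_lt_savingsCap hp hr hr1).le
  rw [savingsSet, ← segment_eq_Icc hle, segment_eq_image']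
  rfl

/-- Truncating consumption at zero and clamping next wealth extends the objective continuously to
all wealth and savings levels; on feasible savings nothing changes, by `objectiveOf_eq`. -/
theorem continuous_iterObjective (hU : E.UtilityAssumption) {v : PriceDomain n → ℝ → ℝ}
    (hv : Continuous fun q : PriceDomain n × ℝ => v q.1 (E.clamp q.1.1.1 q.1.1.2 q.2)) :
    Continuous fun q : PriceDomain n × ℝ × ℝ =>
      E.indirectUtility q.1.1.1 (max (q.2.1 - q.2.2) 0) + E.β * ∑ y ∈ E.Y, E.e y *
        v q.1 (E.clamp q.1.1.1 q.1.1.2 ((1 + q.1.1.2) * q.2.2 + cost q.1.1.1 y)) := by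
  refine ((continuous_indirectUtility_max hU).comp (f := fun q : PriceDomain n × ℝ × ℝ =>
    (q.1, q.2.1 - q.2.2)) (by fun_prop)).add (continuous_const.mul
      (continuous_finsetSum _ fun y _ => continuous_const.mul ?_))
  refine hv.comp (f := fun q : PriceDomain n × ℝ × ℝ =>
    (q.1, (1 + q.1.1.2) * q.2.2 + cost q.1.1.1 y)) ?_
  have := (continuous_cost_left y).comp (f := fun q : PriceDomain n × ℝ × ℝ => q.1.1.1) (by fun_prop)
  simp only [Function.comp_def] at this
  fun_prop

theorem objectiveOf_eq (hr : 0 < r) (v : ℝ → ℝ) (hb : b ∈ E.savingsSet p r a) :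
    E.objectiveOf p r v a b = E.indirectUtility p (max (a - b) 0) + E.β * ∑ y ∈ E.Y, E.e y *
      v (E.clamp p r ((1 + r) * b + cost p y)) := by
  rw [objectiveOf, max_eq_left (sub_nonneg.2 (hb.2.trans (min_le_left _ _)))]
  congr 2
  refine Finset.sum_congr rfl fun y hy => ?_
  rw [clamp_of_mem hr (next_mem_wealthSet hr (E.savingsSet_subset p r a hb) hy)]

theorem continuous_valueIter (hU : E.UtilityAssumption) (N : ℕ) :
    Continuous fun q : PriceDomain n × ℝ =>
      E.valueIter q.1.1.1 q.1.1.2 N (E.clamp q.1.1.1 q.1.1.2 q.2) := by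
  induction N with
  | zero => exact continuous_const
  | succ N ih =>
    have h1 := continuous_iterObjective hU (v := fun z => E.valueIter z.1.1 z.1.2 N) ih
    have hs : Continuous fun w : (PriceDomain n × ℝ) × ℝ => E.savingsAt w.1.1.1.1 w.1.1.1.2
        (E.clamp w.1.1.1.1 w.1.1.1.2 w.1.2) w.2 := by
      have h2 := E.continuous_borrowLimit.comp (f := fun w : (PriceDomain n × ℝ) × ℝ => w.1.1)
        (by fun_prop)
      have h3 := E.continuous_savingsCap.comp (f := fun w : (PriceDomain n × ℝ) × ℝ => w.1.1)
        (by fun_prop)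
      have h4 := E.continuous_clamp.comp (f := fun w : (PriceDomain n × ℝ) × ℝ => w.1) (by fun_prop)
      exact h2.add (continuous_snd.mul ((h4.min h3).sub h2))
    have h4 := E.continuous_clamp.comp (f := fun w : (PriceDomain n × ℝ) × ℝ => w.1) (by fun_prop)
    have h5 := h1.comp (f := fun w : (PriceDomain n × ℝ) × ℝ => (w.1.1,
      E.clamp w.1.1.1.1 w.1.1.1.2 w.1.2, E.savingsAt w.1.1.1.1 w.1.1.1.2
        (E.clamp w.1.1.1.1 w.1.1.1.2 w.1.2) w.2)) ((by fun_prop : Continuous _).prodMk (h4.prodMk hs))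
    refine (isCompact_Icc.continuous_sSup (K := Icc (0 : ℝ) 1) (f := fun (q : PriceDomain n × ℝ) θ =>
      E.indirectUtility q.1.1.1 (max (E.clamp q.1.1.1 q.1.1.2 q.2 -
        E.savingsAt q.1.1.1 q.1.1.2 (E.clamp q.1.1.1 q.1.1.2 q.2) θ) 0) + E.β * ∑ y ∈ E.Y, E.e y *
        E.valueIter q.1.1.1 q.1.1.2 N (E.clamp q.1.1.1 q.1.1.2 ((1 + q.1.1.2) *
          E.savingsAt q.1.1.1 q.1.1.2 (E.clamp q.1.1.1 q.1.1.2 q.2) θ + cost q.1.1.1 y)))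
        h5).congr fun q => ?_
    obtain ⟨⟨⟨p, r⟩, hp, hr, hr1⟩, a⟩ := q
    simp only at hp hr hr1 ⊢
    have ha := clamp_mem (E := E) hp hr hr1 a
    rw [wealthSet_eq hr] at ha
    simp only [valueIter]
    rw [← savingsAt_image hp hr hr1 ha.1, image_image]
    congr 1
    refine image_congr fun θ hθ => ?_
    have hm : E.savingsAt p r (E.clamp p r a) θ ∈ E.savingsSet p r (E.clamp p r a) := by
      rw [← savingsAt_image hp hr hr1 ha.1]
      exact mem_image_of_mem _ hθ
    exact (objectiveOf_eq hr _ hm).symm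

/-- The objective is continuous in savings if the continuation value is continuous. -/
theorem continuousOn_objectiveOf (hU : E.UtilityAssumption) (hp : ∀ i, 0 < p i) (hr : 0 < r)
    {v : ℝ → ℝ} (hv : ContinuousOn v (E.wealthSet p r)) (a : ℝ) :
    ContinuousOn (E.objectiveOf p r v a) (E.savingsSet p r a) := by
  refine ContinuousOn.add ?_ (continuousOn_const.mul (continuousOn_finsetSum _ fun y hy =>
    continuousOn_const.mul ?_))
  · exact (continuousOn_indirectUtility_right hU hp).comp (by fun_prop)
      fun b hb => sub_nonneg.2 (hb.2.trans (min_le_left _ _))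
  · exact hv.comp (by fun_prop) fun b hb =>
      next_mem_wealthSet hr (E.savingsSet_subset p r a hb) hy

theorem exists_isMaxOn_objectiveOf (hU : E.UtilityAssumption) (hp : ∀ i, 0 < p i) (hr : 0 < r)
    (hr1 : r < 1) {v : ℝ → ℝ} (hv : ContinuousOn v (E.wealthSet p r))
    (ha : E.borrowLimit p r ≤ a) :
    ∃ b ∈ E.savingsSet p r a, IsMaxOn (E.objectiveOf p r v a) (E.savingsSet p r a) b :=
  isCompact_Icc.exists_isMaxOn ⟨_, borrowLimit_mem_savingsSet hp hr hr1 ha⟩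
    (continuousOn_objectiveOf hU hp hr hv a)

theorem continuousOn_of_clamp (hp : ∀ i, 0 < p i) (hr : 0 < r) (hr1 : r < 1)
    {v : PriceDomain n → ℝ → ℝ}
    (hv : Continuous fun q : PriceDomain n × ℝ => v q.1 (E.clamp q.1.1.1 q.1.1.2 q.2)) :
    ContinuousOn (v ⟨(p, r), hp, hr, hr1⟩) (E.wealthSet p r) := by
  refine (hv.comp (f := fun a => (⟨(p, r), hp, hr, hr1⟩, a)) (by fun_prop)).continuousOn.congr
    fun a ha => ?_
  simp only [Function.comp]
  rw [clamp_of_mem hr ha]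

theorem continuousOn_valueIter (hU : E.UtilityAssumption) (hp : ∀ i, 0 < p i) (hr : 0 < r)
    (hr1 : r < 1) (N : ℕ) : ContinuousOn (E.valueIter p r N) (E.wealthSet p r) :=
  continuousOn_of_clamp (v := fun z => E.valueIter z.1.1 z.1.2 N) hp hr hr1
    (continuous_valueIter hU N)

theorem isLUB_valueIter (hU : E.UtilityAssumption) (hp : ∀ i, 0 < p i) (hr : 0 < r)
    (hr1 : r < 1) (N : ℕ) (ha : E.borrowLimit p r ≤ a) :
    IsLUB (E.objectiveOf p r (E.valueIter p r N) a '' E.savingsSet p r a)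
      (E.valueIter p r (N + 1) a) :=
  isLUB_csSup (Set.Nonempty.image _ ⟨_, borrowLimit_mem_savingsSet hp hr hr1 ha⟩)
    (isCompact_Icc.bddAbove_image (continuousOn_objectiveOf hU hp hr
      (continuousOn_valueIter hU hp hr hr1 N) a))

/-- Both sides are suprema of objectives that differ only in the discounted continuation value, so
each iteration shrinks the error by `β`. The initial error is the bound on the value itself. -/
theorem abs_valueIter_sub_le (hU : E.UtilityAssumption) (hp : ∀ i, 0 < p i) (hr : 0 < r)
    (hr1 : r < 1) (N : ℕ) : ∀ {a : ℝ}, a ∈ E.wealthSet p r →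
    |E.valueIter p r N a - E.value p r a| ≤ E.β ^ N * (E.utilityBound p r / (1 - E.β)) := by
  induction N with
  | zero =>
    intro a ha
    simpa [valueIter] using abs_value_le hU hp hr hr1 ha
  | succ N ih =>
    intro a ha
    have ha' := ha
    rw [wealthSet_eq hr] at ha'
    refine abs_sub_le_of_isLUB (isLUB_valueIter hU hp hr hr1 N ha'.1)
      (isLUB_savingsObjective hU hp hr hr1 ha) fun b hb => ?_
    have h : E.objectiveOf p r (E.valueIter p r N) a b - E.savingsObjective p r a b =
        E.β * ∑ y ∈ E.Y, E.e y * (E.valueIter p r N ((1 + r) * b + cost p y) -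
          E.value p r ((1 + r) * b + cost p y)) := by
      simp only [savingsObjective_eq, objectiveOf, mul_sub, Finset.sum_sub_distrib]
      ring
    rw [h, abs_mul, abs_of_pos E.β_pos, pow_succ', mul_assoc]
    exact mul_le_mul_of_nonneg_left (E.abs_sum_le fun y hy =>
      ih (next_mem_wealthSet hr (E.savingsSet_subset p r a hb) hy)) E.β_pos.le

/-- The value function is jointly continuous in prices, the interest rate and wealth. -/
theorem continuous_value (hU : E.UtilityAssumption) :
    Continuous fun q : PriceDomain n × ℝ =>
      E.value q.1.1.1 q.1.1.2 (E.clamp q.1.1.1 q.1.1.2 q.2) := by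
  refine TendstoLocallyUniformly.continuous (p := atTop) (F := fun N (q : PriceDomain n × ℝ) =>
    E.valueIter q.1.1.1 q.1.1.2 N (E.clamp q.1.1.1 q.1.1.2 q.2)) ?_
    (Eventually.of_forall fun N => continuous_valueIter hU N).frequently
  rw [Metric.tendstoLocallyUniformly_iff]
  intro ε hε q
  -- The error bound of value iteration has a constant continuous in prices, so convergence is
  -- uniform on a neighbourhood where it is below `C q + 1`.
  set C : PriceDomain n × ℝ → ℝ := fun q => E.utilityBound q.1.1.1 q.1.1.2 / (1 - E.β) with hC
  have hCc : Continuous C := ((continuous_utilityBound hU).comp continuous_fst).div_const _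
  refine ⟨{x | C x < C q + 1}, (isOpen_lt hCc continuous_const).mem_nhds (lt_add_one (C q)), ?_⟩
  have hlim : Tendsto (fun N : ℕ => E.β ^ N * (C q + 1)) atTop (𝓝 0) := by
    simpa using (tendsto_pow_atTop_nhds_zero_of_lt_one E.β_pos.le E.β_lt).mul_const (C q + 1)
  filter_upwards [hlim.eventually (gt_mem_nhds hε)] with N hN x hx
  rw [dist_comm, Real.dist_eq]
  refine (abs_valueIter_sub_le hU x.1.2.1 x.1.2.2.1 x.1.2.2.2 N
    (clamp_mem x.1.2.1 x.1.2.2.1 x.1.2.2.2 _)).trans_lt (lt_of_le_of_lt ?_ hN)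
  exact mul_le_mul_of_nonneg_left (le_of_lt hx) (pow_nonneg E.β_pos.le N)

theorem continuousOn_value (hU : E.UtilityAssumption) (hp : ∀ i, 0 < p i) (hr : 0 < r)
    (hr1 : r < 1) : ContinuousOn (E.value p r) (E.wealthSet p r) :=
  continuousOn_of_clamp (v := fun z => E.value z.1.1 z.1.2) hp hr hr1 (continuous_value hU)

theorem convex_savingsSet {a' b' s t : ℝ} (hb : b ∈ E.savingsSet p r a)
    (hb' : b' ∈ E.savingsSet p r a') (hs : 0 ≤ s) (ht : 0 ≤ t) (hst : s + t = 1) :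
    s * b + t * b' ∈ E.savingsSet p r (s * a + t * a') := by
  simp only [savingsSet, mem_Icc, le_min_iff] at *
  have key : ∀ x : ℝ, x = s * x + t * x := fun x => by rw [← add_mul, hst, one_mul]
  refine ⟨?_, ?_, ?_⟩
  · rw [key (E.borrowLimit p r)]
    exact add_le_add (mul_le_mul_of_nonneg_left hb.1 hs) (mul_le_mul_of_nonneg_left hb'.1 ht)
  · exact add_le_add (mul_le_mul_of_nonneg_left hb.2.1 hs) (mul_le_mul_of_nonneg_left hb'.2.1 ht)
  · rw [key (E.savingsCap p r)]
    exact add_le_add (mul_le_mul_of_nonneg_left hb.2.2 hs) (mul_le_mul_of_nonneg_left hb'.2.2 ht)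

theorem sum_concave (E : Economy n) {f : (Fin n → ℝ) → ℝ} {g h : (Fin n → ℝ) → ℝ} {s t : ℝ}
    (hfg : ∀ y ∈ E.Y, s * g y + t * h y ≤ f y) :
    s * ∑ y ∈ E.Y, E.e y * g y + t * ∑ y ∈ E.Y, E.e y * h y ≤ ∑ y ∈ E.Y, E.e y * f y := by
  rw [Finset.mul_sum, Finset.mul_sum, ← Finset.sum_add_distrib]
  refine Finset.sum_le_sum fun y hy => ?_
  have := mul_le_mul_of_nonneg_left (hfg y hy) (E.e_pos y hy).le
  linarith

theorem next_convex {b' s t : ℝ} (hst : s + t = 1) (y : Fin n → ℝ) :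
    (1 + r) * (s * b + t * b') + cost p y =
      s * ((1 + r) * b + cost p y) + t * ((1 + r) * b' + cost p y) := by
  linear_combination -(cost p y) * hst

/-- The objective is jointly concave in wealth and savings if the continuation value is concave. -/
theorem objectiveOf_concave (hU : E.UtilityAssumption) (hp : ∀ i, 0 < p i) (hr : 0 < r)
    {v : ℝ → ℝ} (hv : ConcaveOn ℝ (E.wealthSet p r) v) {a' b' s t : ℝ}
    (hb : b ∈ E.savingsSet p r a)
    (hb' : b' ∈ E.savingsSet p r a') (hs : 0 ≤ s) (ht : 0 ≤ t) (hst : s + t = 1) :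
    s * E.objectiveOf p r v a b + t * E.objectiveOf p r v a' b' ≤
      E.objectiveOf p r v (s * a + t * a') (s * b + t * b') := by
  have h1 := (indirectUtility_strictConcaveOn hU hp).concaveOn.2
    (show a - b ∈ Ici 0 from sub_nonneg.2 (hb.2.trans (min_le_left _ _)))
    (show a' - b' ∈ Ici 0 from sub_nonneg.2 (hb'.2.trans (min_le_left _ _))) hs ht hst
  have h2 := E.sum_concave (f := fun y => v ((1 + r) * (s * b + t * b') + cost p y))
    (g := fun y => v ((1 + r) * b + cost p y)) (h := fun y => v ((1 + r) * b' + cost p y))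
    (s := s) (t := t) fun y hy => by
      rw [next_convex hst]
      exact hv.2 (next_mem_wealthSet hr (E.savingsSet_subset p r a hb) hy)
        (next_mem_wealthSet hr (E.savingsSet_subset p r a' hb') hy) hs ht hst
  have h3 := mul_le_mul_of_nonneg_left h2 E.β_pos.le
  simp only [smul_eq_mul] at h1
  rw [show s * (a - b) + t * (a' - b') = s * a + t * a' - (s * b + t * b') by ring] at h1
  simp only [objectiveOf]
  linarith

theorem concaveOn_valueIter (hU : E.UtilityAssumption) (hp : ∀ i, 0 < p i) (hr : 0 < r)
    (hr1 : r < 1) (N : ℕ) : ConcaveOn ℝ (E.wealthSet p r) (E.valueIter p r N) := by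
  induction N with
  | zero => exact concaveOn_const 0 (convex_Icc _ _)
  | succ N ih =>
    refine ⟨convex_Icc _ _, fun a ha a' ha' s t hs ht hst => ?_⟩
    have hm : s • a + t • a' ∈ E.wealthSet p r := convex_Icc _ _ ha ha' hs ht hst
    rw [wealthSet_eq hr] at ha ha' hm
    obtain ⟨b, hb, hmax⟩ := exists_isMaxOn_objectiveOf hU hp hr hr1
      (continuousOn_valueIter hU hp hr hr1 N) ha.1
    obtain ⟨b', hb', hmax'⟩ := exists_isMaxOn_objectiveOf hU hp hr hr1
      (continuousOn_valueIter hU hp hr hr1 N) ha'.1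
    have h1 : E.valueIter p r (N + 1) a ≤ E.objectiveOf p r (E.valueIter p r N) a b :=
      (isLUB_valueIter hU hp hr hr1 N ha.1).2 (by rintro _ ⟨x, hx, rfl⟩; exact hmax hx)
    have h2 : E.valueIter p r (N + 1) a' ≤ E.objectiveOf p r (E.valueIter p r N) a' b' :=
      (isLUB_valueIter hU hp hr hr1 N ha'.1).2 (by rintro _ ⟨x, hx, rfl⟩; exact hmax' hx)
    have h3 := objectiveOf_concave hU hp hr ih hb hb' hs ht hst
    have h4 := (isLUB_valueIter hU hp hr hr1 N hm.1).1
      (mem_image_of_mem _ (convex_savingsSet hb hb' hs ht hst))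
    have h5 := mul_le_mul_of_nonneg_left h1 hs
    have h6 := mul_le_mul_of_nonneg_left h2 ht
    simp only [smul_eq_mul] at h4 ⊢
    linarith

theorem tendsto_valueIter (hU : E.UtilityAssumption) (hp : ∀ i, 0 < p i) (hr : 0 < r)
    (hr1 : r < 1) (ha : a ∈ E.wealthSet p r) :
    Tendsto (fun N => E.valueIter p r N a) atTop (𝓝 (E.value p r a)) := by
  rw [tendsto_iff_dist_tendsto_zero]
  refine squeeze_zero (fun _ => dist_nonneg)
    (fun N => abs_valueIter_sub_le hU hp hr hr1 N ha) ?_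
  simpa using (tendsto_pow_atTop_nhds_zero_of_lt_one E.β_pos.le E.β_lt).mul_const
    (E.utilityBound p r / (1 - E.β))

theorem concaveOn_value (hU : E.UtilityAssumption) (hp : ∀ i, 0 < p i) (hr : 0 < r)
    (hr1 : r < 1) : ConcaveOn ℝ (E.wealthSet p r) (E.value p r) := by
  have hc : Convex ℝ (E.wealthSet p r) := convex_Icc _ _
  refine ⟨hc, fun a ha a' ha' s t hs ht hst => ?_⟩
  exact le_of_tendsto_of_tendsto'
    (((tendsto_valueIter hU hp hr hr1 ha).const_smul s).add
      ((tendsto_valueIter hU hp hr hr1 ha').const_smul t))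
    (tendsto_valueIter hU hp hr hr1 (hc ha ha' hs ht hst))
    fun N => (concaveOn_valueIter hU hp hr hr1 N).2 ha ha' hs ht hst

end Economy

end

/-! ### The savings policy, the envelope theorem and the Euler inequality. -/

noncomputable section

/-- The inner points are convex combinations of the outer ones with exchanged weights. This drives
the exchange arguments that show savings and consumption to be monotone. -/
theorem ConcaveOn.add_le_add_of_between {S : Set ℝ} {f : ℝ → ℝ} (hf : ConcaveOn ℝ S f)
    {x y z w : ℝ} (hx : x ∈ S) (hw : w ∈ S) (hxy : x ≤ y) (hyw : y ≤ w)
    (h : x + w = y + z) : f x + f w ≤ f y + f z := by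
  rcases eq_or_lt_of_le (hxy.trans hyw) with heq | hlt
  · have h1 : y = x := le_antisymm (by linarith) hxy
    have h2 : z = w := by linarith
    rw [h1, h2]
  · have hd : 0 < w - x := sub_pos.2 hlt
    have hs : 0 ≤ (w - y) / (w - x) := div_nonneg (by linarith) hd.le
    have ht : 0 ≤ (y - x) / (w - x) := div_nonneg (by linarith) hd.le
    have hst : (w - y) / (w - x) + (y - x) / (w - x) = 1 := by field_simp; ring
    have h1 := hf.2 hx hw hs ht hst
    have h2 := hf.2 hx hw ht hs (by rw [add_comm]; exact hst)
    have e1 : (w - y) / (w - x) * x + (y - x) / (w - x) * w = y := by field_simp; ring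
    have e2 : (y - x) / (w - x) * x + (w - y) / (w - x) * w = z := by
      rw [show z = x + w - y by linarith]; field_simp; ring
    simp only [smul_eq_mul] at h1 h2
    rw [e1] at h1
    rw [e2] at h2
    linear_combination h1 + h2 - (f x + f w) * hst

theorem ConcaveOn.slope_le_slope {S : Set ℝ} {f : ℝ → ℝ} (hf : ConcaveOn ℝ S f)
    {x y z w : ℝ} (hx : x ∈ S) (hy : y ∈ S) (hz : z ∈ S) (hw : w ∈ S) (hxy : x < y) (hyz : y ≤ z)
    (hzw : z < w) : (f w - f z) / (w - z) ≤ (f y - f x) / (y - x) := by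
  rcases eq_or_lt_of_le hyz with rfl | hlt
  · exact hf.slope_anti_adjacent hx hw hxy hzw
  · exact (hf.slope_anti_adjacent hy hw hlt hzw).trans (hf.slope_anti_adjacent hx hz hxy hlt)

/-- A concave function that is supported from below at `a` by a differentiable function is differentiable
at `a`. -/
theorem ConcaveOn.hasDerivAt_of_support {S : Set ℝ} {f φ : ℝ → ℝ} {a d : ℝ} (hf : ConcaveOn ℝ S f)
    (hS : S ∈ 𝓝 a) (hφ : HasDerivAt φ d a) (heq : φ a = f a) (hle : ∀ᶠ x in 𝓝 a, φ x ≤ f x) :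
    HasDerivAt f d a := by
  have hslope := hasDerivAt_iff_tendsto_slope.1 hφ
  have hleft : Tendsto (slope φ a) (𝓝[<] a) (𝓝 d) :=
    hslope.mono_left (nhdsWithin_mono _ fun x hx => ne_of_lt hx)
  have hright : Tendsto (slope φ a) (𝓝[>] a) (𝓝 d) :=
    hslope.mono_left (nhdsWithin_mono _ fun x hx => ne_of_gt hx)
  have ha : a ∈ S := mem_of_mem_nhds hS
  -- The tangent line of `φ` dominates `f`: slopes of `f` across `a` are bounded by those of `φ`,
  -- through concavity and `φ ≤ f`.
  have hup : ∀ x ∈ S, f x ≤ f a + d * (x - a) := by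
    intro x hx
    rcases lt_trichotomy x a with hlt | rfl | hlt
    · have h1 : d ≤ (f a - f x) / (a - x) := by
        refine le_of_tendsto hright ?_
        filter_upwards [self_mem_nhdsWithin, hle.filter_mono nhdsWithin_le_nhds,
          mem_nhdsWithin_of_mem_nhds hS] with y hy hy' hyS
        rw [slope_def_field]
        refine le_trans ?_ (hf.slope_anti_adjacent hx hyS hlt hy)
        exact div_le_div_of_nonneg_right (by rw [heq]; linarith) (sub_pos.2 hy).le
      rw [le_div_iff₀ (sub_pos.2 hlt)] at h1
      linarith
    · simp
    · have h1 : (f x - f a) / (x - a) ≤ d := by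
        refine ge_of_tendsto hleft ?_
        filter_upwards [self_mem_nhdsWithin, hle.filter_mono nhdsWithin_le_nhds,
          mem_nhdsWithin_of_mem_nhds hS] with y hy hy' hyS
        rw [slope_comm, slope_def_field]
        refine (hf.slope_anti_adjacent hyS hx hy hlt).trans ?_
        exact div_le_div_of_nonneg_right (by rw [heq]; linarith) (sub_pos.2 hy).le
      rw [div_le_iff₀ (sub_pos.2 hlt)] at h1
      linarith
  -- Since `f` lies between `φ` and the tangent line, its remainder is at most that of `φ`.
  rw [hasDerivAt_iff_isLittleO] at hφ ⊢
  refine Asymptotics.IsBigO.trans_isLittleO (Asymptotics.IsBigO.of_bound 1 ?_) hφ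
  filter_upwards [hle, hS] with x hx hxS
  have h1 := hup x hxS
  simp only [smul_eq_mul, one_mul, Real.norm_eq_abs]
  rw [heq, abs_of_nonpos (by linarith), abs_of_nonpos (by linarith)]
  linarith

namespace Economy

variable {n : ℕ} {E : Economy n} {p : Fin n → ℝ} {r a b c : ℝ}

/-- The expected discounted value of savings `b`. -/
def contValue (E : Economy n) (p : Fin n → ℝ) (r b : ℝ) : ℝ :=
  E.β * ∑ y ∈ E.Y, E.e y * E.value p r ((1 + r) * b + cost p y)

theorem savingsObjective_eq_add (E : Economy n) (p : Fin n → ℝ) (r a b : ℝ) :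
    E.savingsObjective p r a b = E.indirectUtility p (a - b) + E.contValue p r b := rfl

theorem sub_nonneg_of_mem (hb : b ∈ E.savingsSet p r a) : 0 ≤ a - b :=
  sub_nonneg.2 (hb.2.trans (min_le_left _ _))

theorem concaveOn_contValue (hU : E.UtilityAssumption) (hp : ∀ i, 0 < p i) (hr : 0 < r)
    (hr1 : r < 1) :
    ConcaveOn ℝ (Icc (E.borrowLimit p r) (E.savingsCap p r)) (E.contValue p r) := by
  refine ⟨convex_Icc _ _, fun b hb b' hb' s t hs ht hst => ?_⟩
  have h2 := E.sum_concave
    (f := fun y => E.value p r ((1 + r) * (s * b + t * b') + cost p y))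
    (g := fun y => E.value p r ((1 + r) * b + cost p y))
    (h := fun y => E.value p r ((1 + r) * b' + cost p y)) (s := s) (t := t) fun y hy => by
      rw [next_convex hst]
      exact (concaveOn_value hU hp hr hr1).2 (next_mem_wealthSet hr hb hy)
        (next_mem_wealthSet hr hb' hy) hs ht hst
  have h3 := mul_le_mul_of_nonneg_left h2 E.β_pos.le
  simp only [contValue, smul_eq_mul]
  linarith

theorem existsUnique_isOptimalSavings (hU : E.UtilityAssumption) (hp : ∀ i, 0 < p i) (hr : 0 < r)
    (hr1 : r < 1) (ha : E.borrowLimit p r ≤ a) : ∃! b, E.IsOptimalSavings p r a b := by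
  obtain ⟨b, hb, hmax⟩ := exists_isMaxOn_objectiveOf hU hp hr hr1
    (continuousOn_value hU hp hr hr1) ha
  refine ⟨b, ⟨hb, fun b' hb' => hmax hb'⟩, fun b' hb' => ?_⟩
  by_contra hne
  have h1 := (indirectUtility_strictConcaveOn hU hp).2
    (show a - b' ∈ Ici 0 from sub_nonneg_of_mem hb'.1) (show a - b ∈ Ici 0 from sub_nonneg_of_mem hb)
    (fun h => hne (by linarith)) (show (0 : ℝ) < 1 / 2 by norm_num)
    (show (0 : ℝ) < 1 / 2 by norm_num) (by norm_num)
  have h2 := (concaveOn_contValue hU hp hr hr1).2 (E.savingsSet_subset p r a hb'.1)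
    (E.savingsSet_subset p r a hb) (show (0 : ℝ) ≤ 1 / 2 by norm_num)
    (show (0 : ℝ) ≤ 1 / 2 by norm_num) (by norm_num)
  have h3 : (1 / 2 : ℝ) * b' + 1 / 2 * b ∈ E.savingsSet p r a :=
    convex_Icc _ _ hb'.1 hb (show (0 : ℝ) ≤ 1 / 2 by norm_num)
      (show (0 : ℝ) ≤ 1 / 2 by norm_num) (by norm_num)
  have h4 := hb'.2 _ h3
  have h5 := hb'.2 _ hb
  have h6 : E.savingsObjective p r a b' ≤ E.savingsObjective p r a b := hmax hb'.1
  simp only [smul_eq_mul, savingsObjective_eq_add] at *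
  rw [show 1 / 2 * (a - b') + 1 / 2 * (a - b) = a - (1 / 2 * b' + 1 / 2 * b) by ring] at h1
  linarith

theorem isOptimalSavings_savings (hU : E.UtilityAssumption) (hp : ∀ i, 0 < p i) (hr : 0 < r)
    (hr1 : r < 1) (ha : E.borrowLimit p r ≤ a) : E.IsOptimalSavings p r a (E.savings p r a) :=
  Classical.epsilon_spec (existsUnique_isOptimalSavings hU hp hr hr1 ha).exists

theorem savings_mem (hU : E.UtilityAssumption) (hp : ∀ i, 0 < p i) (hr : 0 < r)
    (hr1 : r < 1) (ha : E.borrowLimit p r ≤ a) : E.savings p r a ∈ E.savingsSet p r a :=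
  (isOptimalSavings_savings hU hp hr hr1 ha).1

theorem savings_mem_Icc (hU : E.UtilityAssumption) (hp : ∀ i, 0 < p i) (hr : 0 < r)
    (hr1 : r < 1) (ha : E.borrowLimit p r ≤ a) :
    E.savings p r a ∈ Icc (E.borrowLimit p r) (E.savingsCap p r) :=
  E.savingsSet_subset p r a (savings_mem hU hp hr hr1 ha)

theorem savings_le (hU : E.UtilityAssumption) (hp : ∀ i, 0 < p i) (hr : 0 < r)
    (hr1 : r < 1) (ha : E.borrowLimit p r ≤ a) : E.savings p r a ≤ a :=
  (savings_mem hU hp hr hr1 ha).2.trans (min_le_left _ _)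

theorem IsOptimalSavings.eq_savings (hU : E.UtilityAssumption) (hp : ∀ i, 0 < p i) (hr : 0 < r)
    (hr1 : r < 1) (ha : E.borrowLimit p r ≤ a) (hb : E.IsOptimalSavings p r a b) :
    b = E.savings p r a :=
  (existsUnique_isOptimalSavings hU hp hr hr1 ha).unique hb
    (isOptimalSavings_savings hU hp hr hr1 ha)

theorem savingsObjective_lt (hU : E.UtilityAssumption) (hp : ∀ i, 0 < p i) (hr : 0 < r)
    (hr1 : r < 1) (ha : E.borrowLimit p r ≤ a) (hb : b ∈ E.savingsSet p r a)
    (hne : b ≠ E.savings p r a) :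
    E.savingsObjective p r a b < E.savingsObjective p r a (E.savings p r a) := by
  have h := isOptimalSavings_savings hU hp hr hr1 ha
  refine lt_of_le_of_ne (h.2 b hb) fun heq => hne ?_
  exact IsOptimalSavings.eq_savings hU hp hr hr1 ha ⟨hb, fun b' hb' => heq ▸ h.2 b' hb'⟩

/-- The value of the optimal policy; it extends the value function to all wealth levels above the
borrowing limit. -/
def policyValue (E : Economy n) (p : Fin n → ℝ) (r a : ℝ) : ℝ :=
  E.savingsObjective p r a (E.savings p r a)

theorem le_policyValue (hU : E.UtilityAssumption) (hp : ∀ i, 0 < p i) (hr : 0 < r)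
    (hr1 : r < 1) (ha : E.borrowLimit p r ≤ a) (hb : b ∈ E.savingsSet p r a) :
    E.indirectUtility p (a - b) + E.contValue p r b ≤ E.policyValue p r a :=
  (isOptimalSavings_savings hU hp hr hr1 ha).2 b hb

theorem policyValue_eq (E : Economy n) (p : Fin n → ℝ) (r a : ℝ) :
    E.policyValue p r a = E.indirectUtility p (a - E.savings p r a) +
      E.contValue p r (E.savings p r a) := rfl

theorem policyValue_eq_value (hU : E.UtilityAssumption) (hp : ∀ i, 0 < p i) (hr : 0 < r)
    (hr1 : r < 1) (ha : a ∈ E.wealthSet p r) : E.policyValue p r a = E.value p r a := by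
  have h := isLUB_savingsObjective hU hp hr hr1 ha
  have ha' := ha
  rw [wealthSet_eq hr] at ha'
  have hs := isOptimalSavings_savings hU hp hr hr1 ha'.1
  refine le_antisymm (h.1 ⟨_, hs.1, rfl⟩) (h.2 ?_)
  rintro _ ⟨b, hb, rfl⟩
  exact hs.2 b hb

theorem savingsSet_mono {a' : ℝ} (h : a ≤ a') : E.savingsSet p r a ⊆ E.savingsSet p r a' :=
  Icc_subset_Icc_right (min_le_min_right _ h)

theorem policyValue_monotoneOn (hU : E.UtilityAssumption) (hp : ∀ i, 0 < p i) (hr : 0 < r)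
    (hr1 : r < 1) : MonotoneOn (E.policyValue p r) (Ici (E.borrowLimit p r)) := by
  intro a ha a' ha' h
  have hs := savings_mem hU hp hr hr1 ha
  refine le_trans ?_ (le_policyValue hU hp hr hr1 ha' (savingsSet_mono h hs))
  rw [policyValue_eq]
  have := (indirectUtility_strictMonoOn hU hp).monotoneOn
    (show a - E.savings p r a ∈ Ici 0 from sub_nonneg_of_mem hs)
    (show a' - E.savings p r a ∈ Ici 0 from (sub_nonneg_of_mem hs).trans (by linarith))
    (by linarith)
  linarith

/-- If the richer consumer saved less, exchanging the two savings levels would be feasible for both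
and strictly worse for each, while concavity of indirect utility makes the exchange no worse in
total. -/
theorem savings_monotoneOn (hU : E.UtilityAssumption) (hp : ∀ i, 0 < p i) (hr : 0 < r)
    (hr1 : r < 1) : MonotoneOn (E.savings p r) (Ici (E.borrowLimit p r)) := by
  intro a ha a' ha' h
  by_contra! hlt
  have hs := savings_mem hU hp hr hr1 ha
  have hs' := savings_mem hU hp hr hr1 ha'
  have h1 := savingsObjective_lt hU hp hr hr1 ha ⟨hs'.1, hlt.le.trans hs.2⟩ hlt.ne
  have h2 := savingsObjective_lt hU hp hr hr1 ha' (savingsSet_mono h hs) hlt.ne'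
  simp only [savingsObjective_eq_add] at h1 h2
  have h3 := (indirectUtility_strictConcaveOn hU hp).concaveOn.add_le_add_of_between
    (x := a - E.savings p r a) (y := a - E.savings p r a') (z := a' - E.savings p r a)
    (w := a' - E.savings p r a') (sub_nonneg_of_mem hs) (sub_nonneg_of_mem hs')
    (by linarith) (by linarith) (by ring)
  linarith

/-- Consumption expenditure is nondecreasing in wealth. -/
theorem consumption_monotoneOn (hU : E.UtilityAssumption) (hp : ∀ i, 0 < p i) (hr : 0 < r)
    (hr1 : r < 1) : MonotoneOn (fun a => a - E.savings p r a) (Ici (E.borrowLimit p r)) := by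
  intro a ha a' ha' h
  simp only
  by_contra! hlt
  have hs := savings_mem hU hp hr hr1 ha
  have hs' := savings_mem hU hp hr hr1 ha'
  have hc := sub_nonneg_of_mem hs
  have hc' := sub_nonneg_of_mem hs'
  -- Here the consumption levels are exchanged, and concavity of the continuation value gives the
  -- contradiction.
  have hm : a - (a' - E.savings p r a') ∈ E.savingsSet p r a :=
    ⟨by linarith [hs.1], le_min (by linarith) (by linarith [hs'.2.trans (min_le_right _ _)])⟩
  have hm' : a' - (a - E.savings p r a) ∈ E.savingsSet p r a' :=
    ⟨by linarith [hs.1], le_min (by linarith) (by linarith [hs'.2.trans (min_le_right _ _)])⟩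
  have h1 := savingsObjective_lt hU hp hr hr1 ha hm (by linarith)
  have h2 := savingsObjective_lt hU hp hr hr1 ha' hm' (by linarith)
  simp only [savingsObjective_eq_add, sub_sub_cancel] at h1 h2
  have h3 := (concaveOn_contValue hU hp hr hr1).add_le_add_of_between
    (x := E.savings p r a) (y := a - (a' - E.savings p r a')) (z := a' - (a - E.savings p r a))
    (w := E.savings p r a') (E.savingsSet_subset p r a hs) (E.savingsSet_subset p r a' hs')
    (by linarith) (by linarith) (by ring)
  linarith

/-- The savings policy is jointly continuous in prices, the interest rate and wealth. -/
theorem continuous_savings (hU : E.UtilityAssumption) :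
    Continuous fun q : PriceDomain n × ℝ =>
      E.savings q.1.1.1 q.1.1.2 (E.clamp q.1.1.1 q.1.1.2 q.2) := by
  rw [continuous_iff_continuousAt]
  intro q
  have hlo : Continuous fun q : PriceDomain n × ℝ => E.borrowLimit q.1.1.1 q.1.1.2 :=
    E.continuous_borrowLimit.comp continuous_fst
  have hcap : Continuous fun q : PriceDomain n × ℝ => E.savingsCap q.1.1.1 q.1.1.2 :=
    E.continuous_savingsCap.comp continuous_fst
  have hcl := E.continuous_clamp
  have hmem : ∀ q : PriceDomain n × ℝ, E.clamp q.1.1.1 q.1.1.2 q.2 ∈ E.wealthSet q.1.1.1 q.1.1.2 :=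
    fun q => clamp_mem q.1.2.1 q.1.2.2.1 q.1.2.2.2 _
  have hge : ∀ q : PriceDomain n × ℝ,
      E.borrowLimit q.1.1.1 q.1.1.2 ≤ E.clamp q.1.1.1 q.1.1.2 q.2 := fun q => le_max_left _ _
  have hopt : ∀ q : PriceDomain n × ℝ, E.IsOptimalSavings q.1.1.1 q.1.1.2
      (E.clamp q.1.1.1 q.1.1.2 q.2) (E.savings q.1.1.1 q.1.1.2 (E.clamp q.1.1.1 q.1.1.2 q.2)) :=
    fun q => isOptimalSavings_savings hU q.1.2.1 q.1.2.2.1 q.1.2.2.2 (hge q)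
  refine tendsto_of_unique_ultrafilter_limit (isCompact_Icc
    (a := E.borrowLimit q.1.1.1 q.1.1.2 - 1) (b := E.savingsCap q.1.1.1 q.1.1.2 + 1)) ?_ ?_
  · filter_upwards [hlo.continuousAt.eventually (lt_mem_nhds (sub_one_lt _)),
      hcap.continuousAt.eventually (gt_mem_nhds (lt_add_one _))] with x hx hx'
    exact ⟨hx.le.trans (hopt x).1.1, ((hopt x).1.2.trans (min_le_right _ _)).trans hx'.le⟩
  · intro f b hf hb
    have hobj := continuous_iterObjective hU (v := fun z => E.value z.1.1 z.1.2)
      (continuous_value hU)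
    have hbm : b ∈ E.savingsSet q.1.1.1 q.1.1.2 (E.clamp q.1.1.1 q.1.1.2 q.2) :=
      ⟨le_of_tendsto_of_tendsto' ((hlo.tendsto q).mono_left hf) hb fun x => (hopt x).1.1,
        le_of_tendsto_of_tendsto' hb (((hcl.min hcap).tendsto q).mono_left hf)
          fun x => (hopt x).1.2⟩
    refine IsOptimalSavings.eq_savings hU q.1.2.1 q.1.2.2.1 q.1.2.2.2 (hge q) ⟨hbm, fun b' hb' => ?_⟩
    have himg := savingsAt_image q.1.2.1 q.1.2.2.1 q.1.2.2.2 (hge q)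
    -- A competing savings level is followed to nearby parameters by keeping its relative position
    -- `θ`.
    obtain ⟨θ, hθ, rfl⟩ := himg.symm ▸ hb'
    have hat : Continuous fun x : PriceDomain n × ℝ =>
        E.savingsAt x.1.1.1 x.1.1.2 (E.clamp x.1.1.1 x.1.1.2 x.2) θ :=
      hlo.add (continuous_const.mul ((hcl.min hcap).sub hlo))
    have hatm : ∀ x : PriceDomain n × ℝ, E.savingsAt x.1.1.1 x.1.1.2
        (E.clamp x.1.1.1 x.1.1.2 x.2) θ ∈ E.savingsSet x.1.1.1 x.1.1.2
        (E.clamp x.1.1.1 x.1.1.2 x.2) := fun x => by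
      rw [← savingsAt_image x.1.2.1 x.1.2.2.1 x.1.2.2.2 (hge x)]
      exact mem_image_of_mem _ hθ
    have h1 := ((hobj.comp (continuous_fst.prodMk (hcl.prodMk hat))).tendsto q).mono_left hf
    have h2 := (hobj.tendsto (q.1, E.clamp q.1.1.1 q.1.1.2 q.2, b)).comp
      (((continuous_fst.tendsto q).mono_left hf).prodMk_nhds
        (((hcl.tendsto q).mono_left hf).prodMk_nhds hb))
    rw [savingsObjective_eq, savingsObjective_eq, objectiveOf_eq q.1.2.2.1 _ hb',
      objectiveOf_eq q.1.2.2.1 _ hbm]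
    refine le_of_tendsto_of_tendsto' h1 h2 fun x => ?_
    have h3 := (hopt x).2 _ (hatm x)
    rw [savingsObjective_eq, savingsObjective_eq, objectiveOf_eq x.1.2.2.1 _ (hatm x),
      objectiveOf_eq x.1.2.2.1 _ (hopt x).1] at h3
    exact h3

theorem continuousOn_savings (hU : E.UtilityAssumption) (hp : ∀ i, 0 < p i) (hr : 0 < r)
    (hr1 : r < 1) : ContinuousOn (E.savings p r) (E.wealthSet p r) :=
  continuousOn_of_clamp (v := fun z => E.savings z.1.1 z.1.2) hp hr hr1 (continuous_savings hU)

theorem concaveOn_policyValue (hU : E.UtilityAssumption) (hp : ∀ i, 0 < p i) (hr : 0 < r)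
    (hr1 : r < 1) : ConcaveOn ℝ (Ici (E.borrowLimit p r)) (E.policyValue p r) := by
  refine ⟨convex_Ici _, fun a ha a' ha' s t hs ht hst => ?_⟩
  have hb := savings_mem hU hp hr hr1 ha
  have hb' := savings_mem hU hp hr hr1 ha'
  refine le_trans (objectiveOf_concave hU hp hr (concaveOn_value hU hp hr hr1) hb hb' hs ht hst) ?_
  exact le_policyValue hU hp hr hr1 (convex_Ici _ ha ha' hs ht hst)
    (convex_savingsSet hb hb' hs ht hst)

/-- If the value function were affine along a segment, then it would be so along a longer segment in the
wealth set. -/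
theorem exists_longer_segment (hU : E.UtilityAssumption) (hp : ∀ i, 0 < p i) (hr : 0 < r)
    (hr1 : r < 1) {a' s t : ℝ} (ha : E.borrowLimit p r ≤ a) (ha' : E.borrowLimit p r ≤ a')
    (hs : 0 < s) (ht : 0 < t) (hst : s + t = 1)
    (h : E.policyValue p r (s * a + t * a') ≤ s * E.policyValue p r a + t * E.policyValue p r a') :
    ∃ x ∈ E.wealthSet p r, ∃ x' ∈ E.wealthSet p r, x' - x = (1 + r) * (a' - a) ∧
      E.policyValue p r (s * x + t * x') ≤ s * E.policyValue p r x + t * E.policyValue p r x' := by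
  have hb := savings_mem hU hp hr hr1 ha
  have hb' := savings_mem hU hp hr hr1 ha'
  set b := E.savings p r a with hbdef
  set b' := E.savings p r a' with hbdef'
  have hmix : s * a + t * a' ∈ Ici (E.borrowLimit p r) := convex_Ici _ ha ha' hs.le ht.le hst
  have h1 := le_policyValue hU hp hr hr1 hmix (convex_savingsSet hb hb' hs.le ht.le hst)
  rw [policyValue_eq E p r a, policyValue_eq E p r a', ← hbdef, ← hbdef'] at h
  have h2 := (concaveOn_contValue hU hp hr hr1).2 (E.savingsSet_subset p r a hb)
    (E.savingsSet_subset p r a' hb') hs.le ht.le hst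
  simp only [smul_eq_mul] at h2
  -- Different consumption levels would give a strict gain from mixing. Hence the whole wealth
  -- difference is saved, and it grows by the factor `1 + r`.
  have heq : a - b = a' - b' := by
    by_contra hne
    have h3 := (indirectUtility_strictConcaveOn hU hp).2
      (show a - b ∈ Ici 0 from sub_nonneg_of_mem hb)
      (show a' - b' ∈ Ici 0 from sub_nonneg_of_mem hb') hne hs ht hst
    simp only [smul_eq_mul] at h3
    rw [show s * (a - b) + t * (a' - b') = s * a + t * a' - (s * b + t * b') by ring] at h3
    linarith
  have h3 : s * a + t * a' - (s * b + t * b') = a - b := by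
    rw [show s * a + t * a' - (s * b + t * b') = s * (a - b) + t * (a' - b') by ring, ← heq,
      ← add_mul, hst, one_mul]
  rw [h3] at h1
  rw [← heq] at h
  have h4 : E.contValue p r (s * b + t * b') ≤ s * E.contValue p r b + t * E.contValue p r b' := by
    have : E.indirectUtility p (a - b) =
      s * E.indirectUtility p (a - b) + t * E.indirectUtility p (a - b) := by
      rw [← add_mul, hst, one_mul]
    linarith
  have hm : ∀ y ∈ E.Y, (1 + r) * b + cost p y ∈ E.wealthSet p r := fun y hy =>
    next_mem_wealthSet hr (E.savingsSet_subset p r a hb) hy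
  have hm' : ∀ y ∈ E.Y, (1 + r) * b' + cost p y ∈ E.wealthSet p r := fun y hy =>
    next_mem_wealthSet hr (E.savingsSet_subset p r a' hb') hy
  -- The continuation value is an average with positive weights, so the reversed inequality must
  -- hold for at least one endowment.
  obtain ⟨y, hy, hle⟩ : ∃ y ∈ E.Y, E.value p r ((1 + r) * (s * b + t * b') + cost p y) ≤
      s * E.value p r ((1 + r) * b + cost p y) + t * E.value p r ((1 + r) * b' + cost p y) := by
    by_contra! hcon
    have h5 := Finset.sum_lt_sum_of_nonempty E.Y_nontrivial.nonempty fun y hy =>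
      mul_lt_mul_of_pos_left (hcon y hy) (E.e_pos y hy)
    have h6 := mul_lt_mul_of_pos_left h5 E.β_pos
    simp only [contValue] at h4
    have h7 : ∑ y ∈ E.Y, E.e y * (s * E.value p r ((1 + r) * b + cost p y) +
        t * E.value p r ((1 + r) * b' + cost p y)) =
        s * ∑ y ∈ E.Y, E.e y * E.value p r ((1 + r) * b + cost p y) +
        t * ∑ y ∈ E.Y, E.e y * E.value p r ((1 + r) * b' + cost p y) := by
      rw [Finset.mul_sum, Finset.mul_sum, ← Finset.sum_add_distrib]
      exact Finset.sum_congr rfl fun y _ => by ring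
    rw [h7] at h6
    linarith
  refine ⟨_, hm y hy, _, hm' y hy, by rw [show a' = b' + (a - b) by linarith]; ring, ?_⟩
  rw [next_convex hst] at hle
  have hc : s * ((1 + r) * b + cost p y) + t * ((1 + r) * b' + cost p y) ∈ E.wealthSet p r :=
    convex_Icc _ _ (hm y hy) (hm' y hy) hs.le ht.le hst
  rwa [policyValue_eq_value hU hp hr hr1 hc, policyValue_eq_value hU hp hr hr1 (hm y hy),
    policyValue_eq_value hU hp hr hr1 (hm' y hy)]

/-- Repeated use of `exists_longer_segment` would produce segments of length `(1 + r) ^ N * |a' -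
a|`, which cannot all fit into the wealth set. -/
theorem strictConcaveOn_policyValue (hU : E.UtilityAssumption) (hp : ∀ i, 0 < p i) (hr : 0 < r)
    (hr1 : r < 1) : StrictConcaveOn ℝ (Ici (E.borrowLimit p r)) (E.policyValue p r) := by
  refine ⟨convex_Ici _, fun a ha a' ha' hne s t hs ht hst => ?_⟩
  by_contra! hcon
  simp only [smul_eq_mul] at hcon
  have hseg : ∀ N : ℕ, ∃ x x', E.borrowLimit p r ≤ x ∧ E.borrowLimit p r ≤ x' ∧
      x' - x = (1 + r) ^ N * (a' - a) ∧
      E.policyValue p r (s * x + t * x') ≤ s * E.policyValue p r x + t * E.policyValue p r x' := by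
    intro N
    induction N with
    | zero => exact ⟨a, a', ha, ha', by simp, hcon⟩
    | succ N ih =>
      obtain ⟨x, x', hx, hx', hd, hle⟩ := ih
      obtain ⟨z, hz, z', hz', hd', hle'⟩ :=
        exists_longer_segment hU hp hr hr1 hx hx' hs ht hst hle
      rw [wealthSet_eq hr] at hz hz'
      exact ⟨z, z', hz.1, hz'.1, by rw [hd', hd, pow_succ]; ring, hle'⟩
  have hpos : 0 < |a' - a| := abs_pos.2 (sub_ne_zero.2 hne.symm)
  obtain ⟨N, hN⟩ := pow_unbounded_of_one_lt
    ((E.wealthTop p r - E.borrowLimit p r) / |a' - a|) (show 1 < 1 + r by linarith)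
  obtain ⟨x, x', hx, hx', hd, hle⟩ := hseg N
  -- One more step is needed because `hseg` keeps endpoints above the borrowing limit only, whereas
  -- the new ones lie in the bounded wealth set.
  obtain ⟨z, hz, z', hz', hd', -⟩ := exists_longer_segment hU hp hr hr1 hx hx' hs ht hst hle
  rw [wealthSet_eq hr] at hz hz'
  have h1 : |z' - z| ≤ E.wealthTop p r - E.borrowLimit p r := by
    rw [abs_le]; constructor <;> linarith [hz.1, hz.2, hz'.1, hz'.2]
  have hpow : 0 < (1 + r) ^ N := pow_pos (by linarith) N
  rw [hd', hd, abs_mul, abs_mul, abs_of_pos hpow, abs_of_pos (by linarith : 0 < 1 + r)] at h1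
  rw [div_lt_iff₀ hpos] at hN
  nlinarith [mul_pos hpow hpos]

/-- Marginal utility is infinite at zero. -/
theorem eventually_mul_lt_indirectUtility (hU : E.UtilityAssumption) (hp : ∀ i, 0 < p i) (M : ℝ) :
    ∀ᶠ ε in 𝓝[>] (0 : ℝ), M * ε < E.indirectUtility p ε - E.indirectUtility p 0 := by
  filter_upwards [(hU.inada_zero p hp).eventually_gt_atTop M, self_mem_nhdsWithin] with ε hε hpos
  have h := (indirectUtility_strictConcaveOn hU hp).concaveOn.deriv_le_slope
    (mem_Ici.2 le_rfl) (mem_Ici.2 (le_of_lt hpos)) hpos (differentiableAt_indirectUtility hU hp hpos)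
  rw [slope_def_field, sub_zero, le_div_iff₀ hpos] at h
  exact lt_of_lt_of_le (mul_lt_mul_of_pos_right hε hpos) h

/-- Zero consumption is never optimal: saving `ε` less costs at most `S * ε` in continuation value,
by concavity, while infinite marginal utility at zero yields more than `S * ε`. -/
theorem savings_lt (hU : E.UtilityAssumption) (hp : ∀ i, 0 < p i) (hr : 0 < r)
    (hr1 : r < 1) (ha : E.borrowLimit p r < a) : E.savings p r a < a := by
  refine lt_of_le_of_ne (savings_le hU hp hr hr1 ha.le) fun heq => ?_
  have hs := isOptimalSavings_savings hU hp hr hr1 ha.le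
  rw [heq] at hs
  have hcap : a ≤ E.savingsCap p r := hs.1.2.trans (min_le_right _ _)
  set lo := E.borrowLimit p r with hlo
  set mid := (lo + a) / 2 with hmid
  set S := (E.contValue p r mid - E.contValue p r lo) / (mid - lo) with hS
  obtain ⟨ε, h1, h2, h3⟩ := ((eventually_mul_lt_indirectUtility hU hp S).and
    (Ioo_mem_nhdsGT (show (0 : ℝ) < (a - lo) / 2 by linarith))).exists
  have h4 := hs.2 (a - ε) ⟨by linarith, le_min (by linarith) (by linarith)⟩
  simp only [savingsObjective_eq_add, sub_sub_cancel, sub_self] at h4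
  have h5 := (concaveOn_contValue hU hp hr hr1).slope_le_slope (x := lo) (y := mid) (z := a - ε)
    (w := a) ⟨le_rfl, by linarith⟩ ⟨by linarith, by linarith⟩ ⟨by linarith, by linarith⟩
    ⟨by linarith, hcap⟩ (by linarith) (by linarith) (by linarith)
  rw [← hS, sub_sub_cancel, div_le_iff₀ h2] at h5
  linarith

theorem indirectUtility_le_policyValue_sub (hU : E.UtilityAssumption) (hp : ∀ i, 0 < p i)
    (hr : 0 < r) (hr1 : r < 1) {δ : ℝ} (hδ : 0 ≤ δ) :
    E.indirectUtility p δ - E.indirectUtility p 0 ≤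
      E.policyValue p r (E.borrowLimit p r + δ) - E.policyValue p r (E.borrowLimit p r) := by
  have h1 := le_policyValue hU hp hr hr1 (le_add_of_nonneg_right hδ)
    (borrowLimit_mem_savingsSet hp hr hr1 (le_add_of_nonneg_right hδ))
  have h2 : E.savings p r (E.borrowLimit p r) = E.borrowLimit p r :=
    le_antisymm (savings_le hU hp hr hr1 le_rfl) (savings_mem hU hp hr hr1 le_rfl).1
  rw [policyValue_eq E p r (E.borrowLimit p r), h2, sub_self]
  rw [add_sub_cancel_left] at h1
  linarith

/-- At the limit the worst endowment leaves wealth at the limit, where extra wealth has infinite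
marginal value. Saving `ε` more thus gains over `S * ε` through the worst state alone and costs at
most `S * ε` of present utility. -/
theorem borrowLimit_lt_savings (hU : E.UtilityAssumption) (hp : ∀ i, 0 < p i) (hr : 0 < r)
    (hr1 : r < 1) (ha : E.borrowLimit p r < a) : E.borrowLimit p r < E.savings p r a := by
  refine lt_of_le_of_ne (savings_mem hU hp hr hr1 ha.le).1 fun heq => ?_
  have hs := isOptimalSavings_savings hU hp hr hr1 ha.le
  rw [← heq] at hs
  have hloc := borrowLimit_lt_savingsCap (E := E) hp hr hr1
  obtain ⟨y₀, hy₀, hmin⟩ := E.exists_minEndow p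
  have he := E.e_pos y₀ hy₀
  have hfix := borrowLimit_fixed (E := E) (p := p) hr
  set lo := E.borrowLimit p r with hlo
  set c := a - lo with hc
  set S := (E.indirectUtility p (c / 2) - E.indirectUtility p 0) / (c / 2 - 0) with hS
  obtain ⟨ε, h1, h2, h3⟩ := ((eventually_mul_lt_indirectUtility hU hp (S / (E.β * E.e y₀))).and
    (Ioo_mem_nhdsGT (show (0 : ℝ) < min (c / 2) (E.savingsCap p r - lo) from
      lt_min (by linarith) (by linarith)))).exists
  rw [lt_min_iff] at h3
  have hm : lo + ε ∈ E.savingsSet p r a := ⟨by linarith, le_min (by linarith) (by linarith)⟩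
  have h4 := hs.2 (lo + ε) hm
  simp only [savingsObjective_eq_add] at h4
  have h5 := (indirectUtility_strictConcaveOn hU hp).concaveOn.slope_le_slope (x := 0) (y := c / 2)
    (z := a - (lo + ε)) (w := a - lo) (mem_Ici.2 le_rfl) (mem_Ici.2 (by linarith))
    (mem_Ici.2 (by linarith)) (mem_Ici.2 (by linarith)) (by linarith) (by linarith) (by linarith)
  rw [← hS, show a - lo - (a - (lo + ε)) = ε by ring, div_le_iff₀ h2] at h5
  have h6 : E.β * (E.e y₀ * (E.indirectUtility p ε - E.indirectUtility p 0)) ≤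
      E.contValue p r (lo + ε) - E.contValue p r lo := by
    simp only [contValue]
    rw [← mul_sub, ← Finset.sum_sub_distrib]
    refine mul_le_mul_of_nonneg_left ?_ E.β_pos.le
    have hmono : ∀ y ∈ E.Y, 0 ≤ E.e y * E.value p r ((1 + r) * (lo + ε) + cost p y) -
        E.e y * E.value p r ((1 + r) * lo + cost p y) := by
      intro y hy
      have hm1 := next_mem_wealthSet hr (E.savingsSet_subset p r a hm) hy
      have hm2 := next_mem_wealthSet hr (E.savingsSet_subset p r a hs.1) hy
      rw [← mul_sub]
      refine mul_nonneg (E.e_pos y hy).le (sub_nonneg.2 ?_)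
      rw [← policyValue_eq_value hU hp hr hr1 hm1, ← policyValue_eq_value hU hp hr hr1 hm2]
      rw [wealthSet_eq hr] at hm1 hm2
      exact policyValue_monotoneOn hU hp hr hr1 hm2.1 hm1.1 (by nlinarith)
    refine le_trans ?_ (Finset.single_le_sum hmono hy₀)
    rw [← mul_sub]
    refine mul_le_mul_of_nonneg_left ?_ he.le
    have hm1 := next_mem_wealthSet hr (E.savingsSet_subset p r a hm) hy₀
    have hm2 := next_mem_wealthSet hr (E.savingsSet_subset p r a hs.1) hy₀
    rw [← policyValue_eq_value hU hp hr hr1 hm1, ← policyValue_eq_value hU hp hr hr1 hm2, ← hmin,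
      hfix, show (1 + r) * (lo + ε) + E.minEndow p = lo + (1 + r) * ε by linear_combination hfix]
    refine le_trans ?_ (indirectUtility_le_policyValue_sub hU hp hr hr1 (by positivity))
    exact sub_le_sub_right ((indirectUtility_strictMonoOn hU hp).monotoneOn (mem_Ici.2 h2.le)
      (mem_Ici.2 (by positivity)) (by nlinarith)) _
  have h7 := mul_lt_mul_of_pos_left h1 (mul_pos E.β_pos he)
  rw [← mul_assoc, mul_div_cancel₀ _ (mul_pos E.β_pos he).ne'] at h7
  linarith

/-- Marginal utility of optimal consumption at wealth `a`. -/
def marginal (E : Economy n) (p : Fin n → ℝ) (r a : ℝ) : ℝ :=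
  deriv (E.indirectUtility p) (a - E.savings p r a)

/-- The envelope theorem. -/
theorem hasDerivAt_policyValue (hU : E.UtilityAssumption) (hp : ∀ i, 0 < p i) (hr : 0 < r)
    (hr1 : r < 1) (ha : E.borrowLimit p r < a) :
    HasDerivAt (E.policyValue p r) (E.marginal p r a) a := by
  have hlt := savings_lt hU hp hr hr1 ha
  have hs := savings_mem hU hp hr hr1 ha.le
  have hd := (differentiableAt_indirectUtility hU hp (sub_pos.2 hlt)).hasDerivAt
  refine (concaveOn_policyValue hU hp hr hr1).hasDerivAt_of_support (Ici_mem_nhds ha)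
    -- Holding savings fixed at their optimum for `a` gives a differentiable lower support of the
    -- value.
    (φ := fun x => E.indirectUtility p (x - E.savings p r a) + E.contValue p r (E.savings p r a))
    ((hd.comp_sub_const a _).add_const _) rfl ?_
  filter_upwards [Ioi_mem_nhds hlt, Ioi_mem_nhds ha] with x hx hx'
  exact le_policyValue hU hp hr hr1 (le_of_lt hx')
    ⟨hs.1, le_min (le_of_lt hx) (hs.2.trans (min_le_right _ _))⟩

theorem marginal_strictAntiOn (hU : E.UtilityAssumption) (hp : ∀ i, 0 < p i) (hr : 0 < r)
    (hr1 : r < 1) : StrictAntiOn (E.marginal p r) (Ioi (E.borrowLimit p r)) := by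
  have h := ((strictConcaveOn_policyValue hU hp hr hr1).subset Ioi_subset_Ici_self
    (convex_Ioi _)).strictAntiOn_deriv fun x hx =>
      (hasDerivAt_policyValue hU hp hr hr1 hx).differentiableAt
  intro x hx y hy hxy
  have := h hx hy hxy
  rwa [(hasDerivAt_policyValue hU hp hr hr1 hx).deriv,
    (hasDerivAt_policyValue hU hp hr hr1 hy).deriv] at this

theorem deriv_indirectUtility_pos (hU : E.UtilityAssumption) (hp : ∀ i, 0 < p i) (hc : 0 < c) :
    0 < deriv (E.indirectUtility p) c := by
  have h := (indirectUtility_strictConcaveOn hU hp).concaveOn.slope_le_deriv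
    (mem_Ici.2 hc.le) (mem_Ici.2 (show 0 ≤ c + 1 by linarith)) (lt_add_one c)
    (differentiableAt_indirectUtility hU hp hc)
  rw [slope_def_field] at h
  refine lt_of_lt_of_le (div_pos (sub_pos.2 ?_) (by linarith)) h
  exact indirectUtility_strictMonoOn hU hp (mem_Ici.2 hc.le)
    (mem_Ici.2 (show 0 ≤ c + 1 by linarith)) (lt_add_one c)

theorem marginal_pos (hU : E.UtilityAssumption) (hp : ∀ i, 0 < p i) (hr : 0 < r)
    (hr1 : r < 1) (ha : E.borrowLimit p r < a) : 0 < E.marginal p r a :=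
  deriv_indirectUtility_pos hU hp (sub_pos.2 (savings_lt hU hp hr hr1 ha))

theorem borrowLimit_lt_next (hr : 0 < r) (hb : E.borrowLimit p r < b)
    {y : Fin n → ℝ} (hy : y ∈ E.Y) : E.borrowLimit p r < (1 + r) * b + cost p y := by
  have h1 := borrowLimit_fixed (E := E) (p := p) hr
  have h2 := minEndow_le (p := p) hy
  nlinarith

/-- Expected marginal utility of next period's consumption when `b` is saved. -/
def nextMarginal (E : Economy n) (p : Fin n → ℝ) (r b : ℝ) : ℝ :=
  ∑ y ∈ E.Y, E.e y * E.marginal p r ((1 + r) * b + cost p y)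

/-- The continuation value uses `policyValue`, which agrees with the value function on reachable
wealth but extends beyond the top. This keeps the derivative two-sided even at the savings cap. -/
theorem hasDerivAt_euler (hU : E.UtilityAssumption) (hp : ∀ i, 0 < p i) (hr : 0 < r)
    (hr1 : r < 1) (ha : E.borrowLimit p r < a) :
    HasDerivAt (fun b => E.indirectUtility p (a - b) + E.β * ∑ y ∈ E.Y, E.e y *
      E.policyValue p r ((1 + r) * b + cost p y))
      (-E.marginal p r a + E.β * ((1 + r) * E.nextMarginal p r (E.savings p r a)))
      (E.savings p r a) := by
  have hlt := savings_lt hU hp hr hr1 ha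
  have hgt := borrowLimit_lt_savings hU hp hr hr1 ha
  refine HasDerivAt.add ?_ (HasDerivAt.const_mul _ ?_)
  · exact (differentiableAt_indirectUtility hU hp (sub_pos.2 hlt)).hasDerivAt.comp_const_sub a _
  · have h : HasDerivAt (fun b => ∑ y ∈ E.Y, E.e y * E.policyValue p r ((1 + r) * b + cost p y))
        (∑ y ∈ E.Y, E.e y * (E.marginal p r ((1 + r) * E.savings p r a + cost p y) * (1 + r)))
        (E.savings p r a) := by
      refine HasDerivAt.fun_sum fun y hy => HasDerivAt.const_mul _ ?_
      refine HasDerivAt.comp (E.savings p r a) (h := fun b => (1 + r) * b + cost p y)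
        (hasDerivAt_policyValue hU hp hr hr1 (borrowLimit_lt_next hr hgt hy)) ?_
      simpa using ((hasDerivAt_id (E.savings p r a)).const_mul (1 + r)).add_const (cost p y)
    have hsum : (1 + r) * E.nextMarginal p r (E.savings p r a) = ∑ y ∈ E.Y, E.e y *
        (E.marginal p r ((1 + r) * E.savings p r a + cost p y) * (1 + r)) := by
      rw [nextMarginal, Finset.mul_sum]
      exact Finset.sum_congr rfl fun y _ => by ring
    rw [hsum]
    exact h

theorem euler_le_max (hU : E.UtilityAssumption) (hp : ∀ i, 0 < p i) (hr : 0 < r)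
    (hr1 : r < 1) (ha : E.borrowLimit p r ≤ a) (hb : b ∈ E.savingsSet p r a) :
    E.indirectUtility p (a - b) + E.β * ∑ y ∈ E.Y, E.e y *
      E.policyValue p r ((1 + r) * b + cost p y) ≤
    E.indirectUtility p (a - E.savings p r a) + E.β * ∑ y ∈ E.Y, E.e y *
      E.policyValue p r ((1 + r) * E.savings p r a + cost p y) := by
  have h := (isOptimalSavings_savings hU hp hr hr1 ha).2 b hb
  have key : ∀ b' ∈ E.savingsSet p r a, ∑ y ∈ E.Y, E.e y *
      E.policyValue p r ((1 + r) * b' + cost p y) =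
      ∑ y ∈ E.Y, E.e y * E.value p r ((1 + r) * b' + cost p y) := fun b' hb' =>
    Finset.sum_congr rfl fun y hy => by
      rw [policyValue_eq_value hU hp hr hr1
        (next_mem_wealthSet hr (E.savingsSet_subset p r a hb') hy)]
  rw [key b hb, key _ (savings_mem hU hp hr hr1 ha)]
  exact h

/-- Saving slightly less is always feasible, so the left derivative of the objective is nonnegative.
Saving more may be blocked by the cap, hence only an inequality. -/
theorem marginal_le_nextMarginal (hU : E.UtilityAssumption) (hp : ∀ i, 0 < p i) (hr : 0 < r)
    (hr1 : r < 1) (ha : E.borrowLimit p r < a) :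
    E.marginal p r a ≤ E.β * ((1 + r) * E.nextMarginal p r (E.savings p r a)) := by
  have hd := hasDerivAt_euler hU hp hr hr1 ha
  have hslope : Tendsto _ (𝓝[<] (E.savings p r a)) _ :=
    (hasDerivAt_iff_tendsto_slope.1 hd).mono_left (nhdsWithin_mono _ fun x hx => ne_of_lt hx)
  have h := ge_of_tendsto (b := 0) hslope (by
    filter_upwards [Ioo_mem_nhdsLT (borrowLimit_lt_savings hU hp hr hr1 ha)] with x hx
    have hm := savings_mem hU hp hr hr1 ha.le
    have := euler_le_max hU hp hr hr1 ha.le (b := x) ⟨hx.1.le, hx.2.le.trans hm.2⟩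
    rw [slope_comm, slope_def_field]
    exact div_nonneg (sub_nonneg.2 this) (sub_pos.2 hx.2).le)
  linarith

theorem marginal_eq_nextMarginal (hU : E.UtilityAssumption) (hp : ∀ i, 0 < p i) (hr : 0 < r)
    (hr1 : r < 1) (ha : E.borrowLimit p r < a) (hcap : E.savings p r a < E.savingsCap p r) :
    E.marginal p r a = E.β * ((1 + r) * E.nextMarginal p r (E.savings p r a)) := by
  have hd := hasDerivAt_euler hU hp hr hr1 ha
  have hmax : IsLocalMax (fun b => E.indirectUtility p (a - b) + E.β * ∑ y ∈ E.Y, E.e y *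
      E.policyValue p r ((1 + r) * b + cost p y)) (E.savings p r a) := by
    filter_upwards [Ioo_mem_nhds (borrowLimit_lt_savings hU hp hr hr1 ha)
      (lt_min (savings_lt hU hp hr hr1 ha) hcap)] with x hx
    exact euler_le_max hU hp hr hr1 ha.le ⟨hx.1.le, hx.2.le⟩
  have := hmax.hasDerivAt_eq_zero hd
  linarith

end Economy

end

/-! ### Wealth dynamics and mixing. -/

noncomputable section

namespace Economy

variable {n : ℕ} {E : Economy n} {p : Fin n → ℝ} {r a b c : ℝ}

/-- Wealth in the next period if the endowment is `y`, as a function on the whole line. -/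
def transition (E : Economy n) (p : Fin n → ℝ) (r : ℝ) (y : Fin n → ℝ) (a : ℝ) : ℝ :=
  (1 + r) * E.savings p r (E.clamp p r a) + cost p y

/-- The Markov operator of the wealth process. -/
def step (E : Economy n) (p : Fin n → ℝ) (r : ℝ) (f : ℝ → ℝ) (a : ℝ) : ℝ :=
  ∑ y ∈ E.Y, E.e y * f (E.transition p r y a)

theorem borrowLimit_le_clamp : E.borrowLimit p r ≤ E.clamp p r a := le_max_left _ _

theorem clamp_mono (E : Economy n) (p : Fin n → ℝ) (r : ℝ) : Monotone (E.clamp p r) :=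
  fun _ _ h => max_le_max le_rfl (min_le_min_right _ h)

theorem transition_mem (hU : E.UtilityAssumption) (hp : ∀ i, 0 < p i) (hr : 0 < r)
    (hr1 : r < 1) {y : Fin n → ℝ} (hy : y ∈ E.Y) (a : ℝ) :
    E.transition p r y a ∈ E.wealthSet p r :=
  next_mem_wealthSet hr (savings_mem_Icc hU hp hr hr1 borrowLimit_le_clamp) hy

theorem transition_mono (hU : E.UtilityAssumption) (hp : ∀ i, 0 < p i) (hr : 0 < r)
    (hr1 : r < 1) (y : Fin n → ℝ) : Monotone (E.transition p r y) := by
  intro a a' h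
  have := savings_monotoneOn hU hp hr hr1 (mem_Ici.2 borrowLimit_le_clamp)
    (mem_Ici.2 borrowLimit_le_clamp) (E.clamp_mono p r h)
  unfold transition
  nlinarith

theorem continuous_transition (hU : E.UtilityAssumption) (y : Fin n → ℝ) :
    Continuous fun q : PriceDomain n × ℝ => E.transition q.1.1.1 q.1.1.2 y q.2 := by
  have h1 := continuous_savings hU
  have h2 := (continuous_cost_left y).comp (f := fun q : PriceDomain n × ℝ => q.1.1.1) (by fun_prop)
  simp only [Function.comp_def] at h2
  unfold transition
  fun_prop

theorem continuous_transition_right (hU : E.UtilityAssumption) (hp : ∀ i, 0 < p i) (hr : 0 < r)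
    (hr1 : r < 1) (y : Fin n → ℝ) : Continuous (E.transition p r y) :=
  (continuous_transition hU y).comp (f := fun a => ((⟨(p, r), hp, hr, hr1⟩ : PriceDomain n), a))
    (by fun_prop)

theorem step_mono (hU : E.UtilityAssumption) (hp : ∀ i, 0 < p i) (hr : 0 < r)
    (hr1 : r < 1) {f : ℝ → ℝ} (hf : Monotone f) : Monotone (E.step p r f) := fun _ _ h =>
  Finset.sum_le_sum fun y hy =>
    mul_le_mul_of_nonneg_left (hf (transition_mono hU hp hr hr1 y h)) (E.e_pos y hy).le

theorem abs_step_le {f : ℝ → ℝ} {C : ℝ} (hf : ∀ x, |f x| ≤ C) (x : ℝ) :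
    |E.step p r f x| ≤ C :=
  E.abs_sum_le (f := fun y => f (E.transition p r y x)) fun _ _ => hf _

theorem continuous_step (hU : E.UtilityAssumption) {F : PriceDomain n → ℝ → ℝ}
    (hF : Continuous fun q : PriceDomain n × ℝ => F q.1 q.2) :
    Continuous fun q : PriceDomain n × ℝ => E.step q.1.1.1 q.1.1.2 (F q.1) q.2 :=
  continuous_finsetSum _ fun y _ => continuous_const.mul
    (hF.comp (continuous_fst.prodMk (continuous_transition hU y)))

theorem continuous_iterate_step (hU : E.UtilityAssumption) {F : PriceDomain n → ℝ → ℝ}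
    (hF : Continuous fun q : PriceDomain n × ℝ => F q.1 q.2) (N : ℕ) :
    Continuous fun q : PriceDomain n × ℝ => (E.step q.1.1.1 q.1.1.2)^[N] (F q.1) q.2 := by
  induction N with
  | zero => exact hF
  | succ N ih =>
    simp only [Function.iterate_succ_apply']
    exact continuous_step hU (F := fun z => (E.step z.1.1 z.1.2)^[N] (F z)) ih

theorem iterate_step_mono (hU : E.UtilityAssumption) (hp : ∀ i, 0 < p i) (hr : 0 < r)
    (hr1 : r < 1) {f : ℝ → ℝ} (hf : Monotone f) (N : ℕ) : Monotone ((E.step p r)^[N] f) := by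
  induction N with
  | zero => exact hf
  | succ N ih =>
    rw [Function.iterate_succ_apply']
    exact step_mono hU hp hr hr1 ih

theorem abs_iterate_step_le {f : ℝ → ℝ} {C : ℝ} (hf : ∀ x, |f x| ≤ C) (N : ℕ) (x : ℝ) :
    |(E.step p r)^[N] f x| ≤ C := by
  induction N generalizing x with
  | zero => exact hf x
  | succ N ih =>
    rw [Function.iterate_succ_apply']
    exact abs_step_le ih x

theorem step_le_of_le {f : ℝ → ℝ} {M m : ℝ} {y₀ : Fin n → ℝ} (hy₀ : y₀ ∈ E.Y)
    (hM : ∀ y ∈ E.Y, f (E.transition p r y a) ≤ M) (hm : f (E.transition p r y₀ a) ≤ m) :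
    E.step p r f a ≤ E.e y₀ * m + (1 - E.e y₀) * M := by
  classical
  have h1 : ∑ y ∈ E.Y.erase y₀, E.e y = 1 - E.e y₀ := by
    rw [← E.e_sum, ← Finset.add_sum_erase _ _ hy₀]; ring
  rw [step, ← Finset.add_sum_erase _ _ hy₀, ← h1, Finset.sum_mul]
  refine add_le_add (mul_le_mul_of_nonneg_left hm (E.e_pos _ hy₀).le) (Finset.sum_le_sum
    fun y hy => mul_le_mul_of_nonneg_left (hM y (Finset.mem_of_mem_erase hy))
      (E.e_pos y (Finset.mem_of_mem_erase hy)).le)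

theorem le_step_of_le {f : ℝ → ℝ} {M m : ℝ} {y₀ : Fin n → ℝ} (hy₀ : y₀ ∈ E.Y)
    (hM : ∀ y ∈ E.Y, M ≤ f (E.transition p r y a)) (hm : m ≤ f (E.transition p r y₀ a)) :
    E.e y₀ * m + (1 - E.e y₀) * M ≤ E.step p r f a := by
  have h := step_le_of_le (E := E) (f := fun x => -f x) (M := -M) (m := -m) (p := p) (r := r)
    (a := a) hy₀ (fun y hy => neg_le_neg (hM y hy)) (neg_le_neg hm)
  simp only [step, mul_neg, Finset.sum_neg_distrib] at h ⊢
  linarith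

theorem e_le_one (E : Economy n) {y : Fin n → ℝ} (hy : y ∈ E.Y) : E.e y ≤ 1 := by
  rw [← E.e_sum]
  exact Finset.single_le_sum (fun y hy => (E.e_pos y hy).le) hy

theorem step_const (E : Economy n) (p : Fin n → ℝ) (r C : ℝ) : E.step p r (fun _ => C) a = C := by
  simp [step, ← Finset.sum_mul, E.e_sum]

theorem iterate_step_le_top (hU : E.UtilityAssumption) (hp : ∀ i, 0 < p i) (hr : 0 < r)
    (hr1 : r < 1) {f : ℝ → ℝ} (hf : Monotone f) (N : ℕ) (ha : a ∈ E.wealthSet p r) :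
    (E.step p r)^[N] f a ≤ f (E.wealthTop p r) := by
  induction N generalizing a with
  | zero => rw [wealthSet_eq hr] at ha; exact hf ha.2
  | succ N ih =>
    rw [Function.iterate_succ_apply', ← E.step_const p r (f (E.wealthTop p r)) (a := a)]
    exact Finset.sum_le_sum fun y hy => mul_le_mul_of_nonneg_left
      (ih (transition_mem hU hp hr hr1 hy a)) (E.e_pos y hy).le

theorem bot_le_iterate_step (hU : E.UtilityAssumption) (hp : ∀ i, 0 < p i) (hr : 0 < r)
    (hr1 : r < 1) {f : ℝ → ℝ} (hf : Monotone f) (N : ℕ) (ha : a ∈ E.wealthSet p r) :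
    f (E.borrowLimit p r) ≤ (E.step p r)^[N] f a := by
  induction N generalizing a with
  | zero => rw [wealthSet_eq hr] at ha; exact hf ha.1
  | succ N ih =>
    rw [Function.iterate_succ_apply', ← E.step_const p r (f (E.borrowLimit p r)) (a := a)]
    exact Finset.sum_le_sum fun y hy => mul_le_mul_of_nonneg_left
      (ih (transition_mem hU hp hr hr1 hy a)) (E.e_pos y hy).le

/-- With probability `E.e y₀ ^ N` all draws equal `y₀` and wealth follows the deterministic path; on
the complement `f` is bounded by its value at the top. -/
theorem iterate_step_le_path (hU : E.UtilityAssumption) (hp : ∀ i, 0 < p i) (hr : 0 < r)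
    (hr1 : r < 1) {f : ℝ → ℝ} (hf : Monotone f) {y₀ : Fin n → ℝ} (hy₀ : y₀ ∈ E.Y) (N : ℕ)
    (ha : a ∈ E.wealthSet p r) :
    (E.step p r)^[N] f a ≤ E.e y₀ ^ N * f ((E.transition p r y₀)^[N] a) +
      (1 - E.e y₀ ^ N) * f (E.wealthTop p r) := by
  induction N generalizing a with
  | zero => simp
  | succ N ih =>
    rw [Function.iterate_succ_apply' (E.step p r), Function.iterate_succ_apply (E.transition p r y₀)]
    refine (step_le_of_le hy₀ (fun y hy => iterate_step_le_top hU hp hr hr1 hf N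
      (transition_mem hU hp hr hr1 hy a)) (ih (transition_mem hU hp hr hr1 hy₀ a))).trans ?_
    rw [pow_succ]
    exact le_of_eq (by ring)

theorem path_le_iterate_step (hU : E.UtilityAssumption) (hp : ∀ i, 0 < p i) (hr : 0 < r)
    (hr1 : r < 1) {f : ℝ → ℝ} (hf : Monotone f) {y₀ : Fin n → ℝ} (hy₀ : y₀ ∈ E.Y) (N : ℕ)
    (ha : a ∈ E.wealthSet p r) :
    E.e y₀ ^ N * f ((E.transition p r y₀)^[N] a) + (1 - E.e y₀ ^ N) * f (E.borrowLimit p r) ≤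
      (E.step p r)^[N] f a := by
  induction N generalizing a with
  | zero => simp
  | succ N ih =>
    rw [Function.iterate_succ_apply' (E.step p r), Function.iterate_succ_apply (E.transition p r y₀)]
    refine le_trans ?_ (le_step_of_le hy₀ (fun y hy => bot_le_iterate_step hU hp hr hr1 hf N
      (transition_mem hU hp hr hr1 hy a)) (ih (transition_mem hU hp hr hr1 hy₀ a)))
    rw [pow_succ]
    exact le_of_eq (by ring)

theorem wealthTop_mem (hp : ∀ i, 0 < p i) (hr : 0 < r) (hr1 : r < 1) :
    E.wealthTop p r ∈ E.wealthSet p r := by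
  rw [wealthSet_eq hr]
  exact ⟨(borrowLimit_lt_wealthTop hp hr hr1).le, le_rfl⟩

theorem borrowLimit_mem (hp : ∀ i, 0 < p i) (hr : 0 < r) (hr1 : r < 1) :
    E.borrowLimit p r ∈ E.wealthSet p r := by
  rw [wealthSet_eq hr]
  exact ⟨le_rfl, (borrowLimit_lt_wealthTop hp hr hr1).le⟩

theorem transition_eq (hr : 0 < r) (ha : a ∈ E.wealthSet p r) (y : Fin n → ℝ) :
    E.transition p r y a = (1 + r) * E.savings p r a + cost p y := by
  rw [transition, clamp_of_mem hr ha]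

theorem sum_marginal_lt {y₀ : Fin n → ℝ} (hy₀ : y₀ ∈ E.Y) {g : (Fin n → ℝ) → ℝ} {C : ℝ}
    (h : ∀ y ∈ E.Y, g y ≤ C) (h₀ : g y₀ < C) : ∑ y ∈ E.Y, E.e y * g y < C := by
  calc ∑ y ∈ E.Y, E.e y * g y < ∑ y ∈ E.Y, E.e y * C :=
        Finset.sum_lt_sum (fun y hy => mul_le_mul_of_nonneg_left (h y hy) (E.e_pos y hy).le)
          ⟨y₀, hy₀, mul_lt_mul_of_pos_left h₀ (E.e_pos _ hy₀)⟩
    _ = C := by rw [← Finset.sum_mul, E.e_sum, one_mul]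

/-- If the interest rate is low, then wealth falls to the borrowing limit under the worst endowments. -/
theorem fixedPoint_minEndow (hU : E.UtilityAssumption) (hp : ∀ i, 0 < p i) (hr : 0 < r)
    (hr1 : r < 1) (hβ : E.β * (1 + r) ≤ 1) {y₀ : Fin n → ℝ}
    (hmin : E.minEndow p = cost p y₀) (ha : a ∈ E.wealthSet p r)
    (hfix : E.transition p r y₀ a = a) : a = E.borrowLimit p r := by
  have ha' := ha
  rw [wealthSet_eq hr] at ha'
  by_contra hne
  have hlt : E.borrowLimit p r < a := lt_of_le_of_ne ha'.1 (Ne.symm hne)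
  obtain ⟨y₁, hy₁, hmax, hmm⟩ := E.exists_maxEndow hp
  have hanti := marginal_strictAntiOn hU hp hr hr1
  -- At a fixed point under the worst endowment, next wealth is never below `a` and exceeds it in
  -- the best state. Expected marginal utility is then strictly below its present level, against the
  -- Euler inequality.
  have hge : ∀ y ∈ E.Y, a ≤ (1 + r) * E.savings p r a + cost p y := fun y hy => by
    conv_lhs => rw [← hfix, transition_eq hr ha]
    have := minEndow_le (p := p) hy
    linarith
  have hgt : a < (1 + r) * E.savings p r a + cost p y₁ := by
    conv_lhs => rw [← hfix, transition_eq hr ha]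
    linarith
  have h1 : E.nextMarginal p r (E.savings p r a) < E.marginal p r a :=
    sum_marginal_lt hy₁ (fun y hy => hanti.antitoneOn hlt (hlt.trans_le (hge y hy)) (hge y hy))
      (hanti hlt (hlt.trans hgt) hgt)
  have h2 := marginal_le_nextMarginal hU hp hr hr1 hlt
  have h3 := marginal_pos hU hp hr hr1 hlt
  have h4 := mul_lt_mul_of_pos_left h1 (mul_pos E.β_pos (by linarith : 0 < 1 + r))
  nlinarith

/-- If the interest rate is high, then wealth rises to its upper bound under the best endowments. -/
theorem fixedPoint_maxEndow (hU : E.UtilityAssumption) (hp : ∀ i, 0 < p i) (hr : 0 < r)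
    (hr1 : r < 1) (hβ : 1 ≤ E.β * (1 + r)) {y₁ : Fin n → ℝ}
    (hmax : cost p y₁ = E.maxEndow p) (ha : a ∈ E.wealthSet p r)
    (hfix : E.transition p r y₁ a = a) : a = E.wealthTop p r := by
  have ha' := ha
  rw [wealthSet_eq hr] at ha'
  obtain ⟨y₀, hy₀, hmin⟩ := E.exists_minEndow p
  have hmm : E.minEndow p < E.maxEndow p := by
    obtain ⟨_, _, _, h⟩ := E.exists_maxEndow hp
    exact h
  rw [transition_eq hr ha] at hfix
  have hs := savings_mem_Icc hU hp hr hr1 ha'.1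
  have hlt : E.borrowLimit p r < a := by
    have h1 := borrowLimit_fixed (E := E) (p := p) hr
    have h2 := hs.1
    nlinarith
  by_contra hne
  -- At the cap the best endowment would lead exactly to the top. Below it the Euler equation holds
  -- with equality, as the reverse inequality is the one needed here.
  have hcap : E.savings p r a < E.savingsCap p r := by
    refine lt_of_le_of_ne hs.2 fun h => hne ?_
    rw [← hfix, h, hmax, wealthTop]
  have hanti := marginal_strictAntiOn hU hp hr hr1
  have hge : ∀ y ∈ E.Y, E.borrowLimit p r < (1 + r) * E.savings p r a + cost p y := fun y hy =>
    borrowLimit_lt_next hr (borrowLimit_lt_savings hU hp hr hr1 hlt) hy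
  have hle : ∀ y ∈ E.Y, (1 + r) * E.savings p r a + cost p y ≤ a := fun y hy => by
    have := le_maxEndow (p := p) hy
    linarith
  have hlt' : (1 + r) * E.savings p r a + cost p y₀ < a := by linarith
  have h1 : ∑ y ∈ E.Y, E.e y * -E.marginal p r ((1 + r) * E.savings p r a + cost p y) <
      -E.marginal p r a :=
    sum_marginal_lt hy₀ (fun y hy => neg_le_neg (hanti.antitoneOn (hge y hy) hlt (hle y hy)))
      (neg_lt_neg (hanti (hge y₀ hy₀) hlt hlt'))
  simp only [mul_neg, Finset.sum_neg_distrib, neg_lt_neg_iff] at h1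
  have h2 := marginal_eq_nextMarginal hU hp hr hr1 hlt hcap
  have h3 := marginal_pos hU hp hr hr1 hlt
  have h4 := mul_lt_mul_of_pos_left h1 (mul_pos E.β_pos (by linarith : 0 < 1 + r))
  rw [nextMarginal] at h2
  nlinarith

theorem iterate_transition_mem (hU : E.UtilityAssumption) (hp : ∀ i, 0 < p i) (hr : 0 < r)
    (hr1 : r < 1) {y : Fin n → ℝ} (hy : y ∈ E.Y) (ha : a ∈ E.wealthSet p r) (N : ℕ) :
    (E.transition p r y)^[N] a ∈ E.wealthSet p r := by
  induction N with
  | zero => exact ha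
  | succ N ih =>
    rw [Function.iterate_succ_apply']
    exact transition_mem hU hp hr hr1 hy _

theorem antitone_iterate_top (hU : E.UtilityAssumption) (hp : ∀ i, 0 < p i) (hr : 0 < r)
    (hr1 : r < 1) {y : Fin n → ℝ} (hy : y ∈ E.Y) :
    Antitone fun N => (E.transition p r y)^[N] (E.wealthTop p r) := by
  refine antitone_nat_of_succ_le fun N => ?_
  rw [Function.iterate_succ_apply]
  have h := transition_mem hU hp hr hr1 hy (E.wealthTop p r)
  rw [wealthSet_eq hr] at h
  exact (transition_mono hU hp hr hr1 y).iterate N h.2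

theorem monotone_iterate_bot (hU : E.UtilityAssumption) (hp : ∀ i, 0 < p i) (hr : 0 < r)
    (hr1 : r < 1) {y : Fin n → ℝ} (hy : y ∈ E.Y) :
    Monotone fun N => (E.transition p r y)^[N] (E.borrowLimit p r) := by
  refine monotone_nat_of_le_succ fun N => ?_
  rw [Function.iterate_succ_apply]
  have h := transition_mem hU hp hr hr1 hy (E.borrowLimit p r)
  rw [wealthSet_eq hr] at h
  exact (transition_mono hU hp hr hr1 y).iterate N h.1

/-- The mixing property: a run of the worst endowments from the top ends below a run of the best
endowments from the bottom. -/
theorem exists_crossing (hU : E.UtilityAssumption) (hp : ∀ i, 0 < p i) (hr : 0 < r)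
    (hr1 : r < 1) : ∃ y₀ ∈ E.Y, ∃ y₁ ∈ E.Y, ∃ N : ℕ,
      (E.transition p r y₀)^[N] (E.wealthTop p r) ≤
        (E.transition p r y₁)^[N] (E.borrowLimit p r) := by
  obtain ⟨y₀, hy₀, hmin⟩ := E.exists_minEndow p
  obtain ⟨y₁, hy₁, hmax, hmm⟩ := E.exists_maxEndow hp
  refine ⟨y₀, hy₀, y₁, hy₁, ?_⟩
  have hclosed : IsClosed (E.wealthSet p r) := isClosed_Icc
  have htop := wealthTop_mem (E := E) hp hr hr1
  have hbot := borrowLimit_mem (E := E) hp hr hr1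
  have hfirst0 : E.transition p r y₀ (E.wealthTop p r) < E.wealthTop p r := by
    rw [transition_eq hr htop, ← hmin]
    have := (savings_mem_Icc hU hp hr hr1 (borrowLimit_lt_wealthTop hp hr hr1).le).2
    conv_rhs => rw [wealthTop]
    nlinarith
  have hfirst1 : E.borrowLimit p r < E.transition p r y₁ (E.borrowLimit p r) := by
    rw [transition_eq hr hbot, hmax]
    have h1 := (savings_mem_Icc hU hp hr hr1 (a := E.borrowLimit p r) le_rfl).1
    have h2 := borrowLimit_fixed (E := E) (p := p) hr
    nlinarith
  have hanti := antitone_iterate_top hU hp hr hr1 hy₀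
  have hmono := monotone_iterate_bot hU hp hr hr1 hy₁
  rcases le_total (E.β * (1 + r)) 1 with hβ | hβ
  · have hlim := tendsto_atTop_ciInf hanti ⟨E.borrowLimit p r, by
      rintro _ ⟨N, rfl⟩
      have := iterate_transition_mem hU hp hr hr1 hy₀ htop N
      rw [wealthSet_eq hr] at this
      exact this.1⟩
    set x := ⨅ N, (E.transition p r y₀)^[N] (E.wealthTop p r)
    have hx : x ∈ E.wealthSet p r := hclosed.mem_of_tendsto hlim
      (Eventually.of_forall fun N => iterate_transition_mem hU hp hr hr1 hy₀ htop N)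
    have hfix := isFixedPt_of_tendsto_iterate hlim
      (continuous_transition_right hU hp hr hr1 y₀).continuousAt
    rw [fixedPoint_minEndow hU hp hr hr1 hβ hmin hx hfix] at hlim
    -- One best draw already lifts wealth strictly above the borrowing limit, and the upward path
    -- never returns; the downward path falls below that level.
    obtain ⟨N, hN, hN1⟩ := ((hlim.eventually (gt_mem_nhds hfirst1)).and
      (eventually_ge_atTop 1)).exists
    exact ⟨N, hN.le.trans (hmono hN1)⟩
  · have hlim := tendsto_atTop_ciSup hmono ⟨E.wealthTop p r, by
      rintro _ ⟨N, rfl⟩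
      have := iterate_transition_mem hU hp hr hr1 hy₁ hbot N
      rw [wealthSet_eq hr] at this
      exact this.2⟩
    set x := ⨆ N, (E.transition p r y₁)^[N] (E.borrowLimit p r)
    have hx : x ∈ E.wealthSet p r := hclosed.mem_of_tendsto hlim
      (Eventually.of_forall fun N => iterate_transition_mem hU hp hr hr1 hy₁ hbot N)
    have hfix := isFixedPt_of_tendsto_iterate hlim
      (continuous_transition_right hU hp hr hr1 y₁).continuousAt
    rw [fixedPoint_maxEndow hU hp hr hr1 hβ hmax hx hfix] at hlim
    obtain ⟨N, hN, hN1⟩ := ((hlim.eventually (lt_mem_nhds hfirst0)).and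
      (eventually_ge_atTop 1)).exists
    exact ⟨N, (hanti hN1).trans hN.le⟩

/-- The Markov operator contracts the range of monotone functions. -/
theorem exists_contraction (hU : E.UtilityAssumption) (hp : ∀ i, 0 < p i) (hr : 0 < r)
    (hr1 : r < 1) : ∃ N : ℕ, ∃ α : ℝ, 0 ≤ α ∧ α < 1 ∧ ∀ f : ℝ → ℝ, Monotone f →
      (E.step p r)^[N] f (E.wealthTop p r) - (E.step p r)^[N] f (E.borrowLimit p r) ≤
        α * (f (E.wealthTop p r) - f (E.borrowLimit p r)) := by
  obtain ⟨y₀, hy₀, y₁, hy₁, N, hN⟩ := exists_crossing hU hp hr hr1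
  have he0 : 0 < E.e y₀ ^ N := pow_pos (E.e_pos _ hy₀) N
  have he1 : 0 < E.e y₁ ^ N := pow_pos (E.e_pos _ hy₁) N
  have he0' : E.e y₀ ^ N ≤ 1 := pow_le_one₀ (E.e_pos _ hy₀).le (E.e_le_one hy₀)
  -- The smaller of the two run probabilities is mass that can be paired so that the path from the
  -- top ends below the one from the bottom; only the rest contributes to the range.
  refine ⟨N, 1 - min (E.e y₀ ^ N) (E.e y₁ ^ N),
    sub_nonneg.2 ((min_le_left _ _).trans he0'), sub_lt_self _ (lt_min he0 he1), fun f hf => ?_⟩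
  have htop := wealthTop_mem (E := E) hp hr hr1
  have hbot := borrowLimit_mem (E := E) hp hr hr1
  have h1 := iterate_step_le_path hU hp hr hr1 hf hy₀ N htop
  have h2 := path_le_iterate_step hU hp hr hr1 hf hy₁ N hbot
  have h3 := hf hN
  set x := (E.transition p r y₀)^[N] (E.wealthTop p r)
  set x' := (E.transition p r y₁)^[N] (E.borrowLimit p r)
  have hx : x ∈ E.wealthSet p r := iterate_transition_mem hU hp hr hr1 hy₀ htop N
  have hx' : x' ∈ E.wealthSet p r := iterate_transition_mem hU hp hr hr1 hy₁ hbot N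
  rw [wealthSet_eq hr] at hx hx'
  have h4 := hf hx.2
  have h5 := hf hx'.1
  have h6 := min_le_left (E.e y₀ ^ N) (E.e y₁ ^ N)
  have h7 := min_le_right (E.e y₀ ^ N) (E.e y₁ ^ N)
  set m := min (E.e y₀ ^ N) (E.e y₁ ^ N)
  have hm : 0 < m := lt_min he0 he1
  nlinarith [mul_nonneg (sub_nonneg.2 h6) (sub_nonneg.2 h4),
    mul_nonneg (sub_nonneg.2 h7) (sub_nonneg.2 h5), mul_nonneg hm.le (sub_nonneg.2 h3)]

theorem exists_iterate_range_lt (hU : E.UtilityAssumption) (hp : ∀ i, 0 < p i) (hr : 0 < r)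
    (hr1 : r < 1) {f : ℝ → ℝ} (hf : Monotone f) {ε : ℝ} (hε : 0 < ε) :
    ∃ N : ℕ, (E.step p r)^[N] f (E.wealthTop p r) - (E.step p r)^[N] f (E.borrowLimit p r) < ε := by
  obtain ⟨N, α, h0, h1, hc⟩ := exists_contraction hU hp hr hr1
  set gap := f (E.wealthTop p r) - f (E.borrowLimit p r) with hgap
  have key : ∀ j : ℕ, (E.step p r)^[N * j] f (E.wealthTop p r) -
      (E.step p r)^[N * j] f (E.borrowLimit p r) ≤ α ^ j * gap := by
    intro j
    induction j with
    | zero => simp [hgap]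
    | succ j ih =>
      have := hc _ (iterate_step_mono hU hp hr hr1 hf (N * j))
      rw [← Function.iterate_add_apply, show N + N * j = N * (j + 1) by ring] at this
      refine this.trans ?_
      rw [pow_succ', mul_assoc]
      exact mul_le_mul_of_nonneg_left ih h0
  have hlim : Tendsto (fun j : ℕ => α ^ j * gap) atTop (𝓝 0) := by
    simpa using (tendsto_pow_atTop_nhds_zero_of_lt_one h0 h1).mul_const gap
  obtain ⟨j, hj⟩ := (hlim.eventually (gt_mem_nhds hε)).exists
  exact ⟨N * j, (key j).trans_lt hj⟩

end Economy

end

/-! ### Existence and uniqueness of the invariant distribution. -/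

noncomputable section

/-- Finite measures on the line that give the same integral to all ramp functions are equal. -/
theorem MeasureTheory.Measure.ext_of_integral_ramp {μ ν : Measure ℝ} [IsProbabilityMeasure μ]
    [IsProbabilityMeasure ν]
    (h : ∀ (k : ℕ) (x : ℝ), ∫ a, max 0 (min 1 (k * (a - x))) ∂μ =
      ∫ a, max 0 (min 1 (k * (a - x))) ∂ν) : μ = ν := by
  have hlim : ∀ (ρ : Measure ℝ) [IsProbabilityMeasure ρ] (x : ℝ),
      Tendsto (fun k : ℕ => ∫ a, max 0 (min 1 (k * (a - x))) ∂ρ) atTop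
        (𝓝 (∫ a, (Ioi x).indicator 1 a ∂ρ)) := by
    intro ρ _ x
    refine tendsto_integral_of_dominated_convergence (fun _ => 1)
      (fun k => (by fun_prop : Continuous fun a : ℝ => max 0 (min 1 (k * (a - x)))).aestronglyMeasurable)
      (integrable_const _) (fun k => Eventually.of_forall fun a => ?_)
      (Eventually.of_forall fun a => ?_)
    · rw [Real.norm_eq_abs, abs_of_nonneg (le_max_left _ _)]
      exact max_le zero_le_one (min_le_left _ _)
    · by_cases ha : x < a
      · rw [indicator_of_mem (mem_Ioi.2 ha)]
        refine tendsto_const_nhds.congr' ?_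
        filter_upwards [(tendsto_natCast_atTop_atTop.atTop_mul_const (sub_pos.2 ha)).eventually_ge_atTop 1]
          with k hk
        rw [min_eq_left hk]; simp
      · rw [indicator_of_notMem (by simpa using ha)]
        refine tendsto_const_nhds.congr fun k => ?_
        rw [max_eq_left]
        exact (min_le_right _ _).trans (mul_nonpos_of_nonneg_of_nonpos (Nat.cast_nonneg k)
          (by linarith [not_lt.1 ha]))
  have hIoi : ∀ x, μ (Ioi x) = ν (Ioi x) := by
    intro x
    have h1 := tendsto_nhds_unique ((hlim μ x).congr fun k => h k x) (hlim ν x)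
    rw [integral_indicator_one measurableSet_Ioi, integral_indicator_one measurableSet_Ioi] at h1
    exact (measureReal_eq_measureReal_iff (measure_ne_top _ _) (measure_ne_top _ _)).1 h1
  refine Measure.ext_of_Iic μ ν fun x => ?_
  rw [← compl_Ioi, prob_compl_eq_one_sub measurableSet_Ioi,
    prob_compl_eq_one_sub measurableSet_Ioi, hIoi x]

namespace Economy

variable {n : ℕ} {E : Economy n} {p : Fin n → ℝ} {r a b c : ℝ}

/-- The distribution of wealth in the next period. -/
def push (E : Economy n) (p : Fin n → ℝ) (r : ℝ) (μ : Measure ℝ) : Measure ℝ :=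
  ∑ y ∈ E.Y, ENNReal.ofReal (E.e y) • μ.map (E.transition p r y)

theorem sum_ofReal_e (E : Economy n) : ∑ y ∈ E.Y, ENNReal.ofReal (E.e y) = 1 := by
  rw [← ENNReal.ofReal_sum_of_nonneg fun y hy => (E.e_pos y hy).le, E.e_sum, ENNReal.ofReal_one]

theorem push_apply (hU : E.UtilityAssumption) (hp : ∀ i, 0 < p i) (hr : 0 < r)
    (hr1 : r < 1) (μ : Measure ℝ) {D : Set ℝ} (hD : MeasurableSet D) :
    E.push p r μ D = ∑ y ∈ E.Y, ENNReal.ofReal (E.e y) * μ (E.transition p r y ⁻¹' D) := by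
  rw [push, Measure.finsetSum_apply]
  refine Finset.sum_congr rfl fun y _ => ?_
  rw [Measure.smul_apply, smul_eq_mul,
    Measure.map_apply (continuous_transition_right hU hp hr hr1 y).measurable hD]

theorem isProbabilityMeasure_push (hU : E.UtilityAssumption) (hp : ∀ i, 0 < p i) (hr : 0 < r)
    (hr1 : r < 1) (μ : Measure ℝ) [IsProbabilityMeasure μ] :
    IsProbabilityMeasure (E.push p r μ) := by
  refine ⟨?_⟩
  rw [push_apply hU hp hr hr1 μ MeasurableSet.univ]
  simp [E.sum_ofReal_e]

theorem measurableSet_wealthSet (E : Economy n) (p : Fin n → ℝ) (r : ℝ) :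
    MeasurableSet (E.wealthSet p r) := measurableSet_Icc

theorem push_compl (hU : E.UtilityAssumption) (hp : ∀ i, 0 < p i) (hr : 0 < r)
    (hr1 : r < 1) (μ : Measure ℝ) : E.push p r μ (E.wealthSet p r)ᶜ = 0 := by
  rw [push_apply hU hp hr hr1 μ (E.measurableSet_wealthSet p r).compl]
  refine Finset.sum_eq_zero fun y hy => ?_
  have : E.transition p r y ⁻¹' (E.wealthSet p r)ᶜ = ∅ := by
    ext a
    simp [transition_mem hU hp hr hr1 hy a]
  simp [this]

theorem integral_push (hU : E.UtilityAssumption) (hp : ∀ i, 0 < p i) (hr : 0 < r)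
    (hr1 : r < 1) (μ : Measure ℝ) [IsProbabilityMeasure μ] {f : ℝ → ℝ} (hf : Measurable f) {C : ℝ}
    (hC : ∀ x, |f x| ≤ C) : ∫ a, f a ∂(E.push p r μ) = ∫ a, E.step p r f a ∂μ := by
  have hm : ∀ y, Measurable (E.transition p r y) := fun y =>
    (continuous_transition_right hU hp hr hr1 y).measurable
  have hint : ∀ (ρ : Measure ℝ) [IsProbabilityMeasure ρ] (g : ℝ → ℝ), Measurable g →
      (∀ x, |g x| ≤ C) → Integrable g ρ := fun ρ _ g hg hgC =>
    Integrable.of_bound hg.aestronglyMeasurable C (Eventually.of_forall hgC)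
  rw [push, integral_finsetSum_measure]
  · simp only [step]
    rw [integral_finsetSum]
    · refine Finset.sum_congr rfl fun y hy => ?_
      rw [integral_smul_measure, ENNReal.toReal_ofReal (E.e_pos y hy).le, smul_eq_mul,
        integral_map (hm y).aemeasurable hf.aestronglyMeasurable, integral_const_mul]
    · intro y _
      exact (hint μ _ (hf.comp (hm y)) fun x => hC _).const_mul _
  · intro y _
    have : IsProbabilityMeasure (μ.map (E.transition p r y)) :=
      Measure.isProbabilityMeasure_map (hm y).aemeasurable
    exact (hint _ f hf hC).smul_measure ENNReal.ofReal_ne_top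

theorem restrict_wealthSet {μ : Measure ℝ} (h : μ (E.wealthSet p r)ᶜ = 0) :
    μ.restrict (E.wealthSet p r) = μ :=
  Measure.restrict_eq_self_of_ae_mem (by rwa [ae_iff])

theorem isInvariant_iff (hU : E.UtilityAssumption) (hp : ∀ i, 0 < p i) (hr : 0 < r)
    (hr1 : r < 1) (μ : Measure ℝ) : E.IsInvariant p r μ ↔
      IsProbabilityMeasure μ ∧ μ (E.wealthSet p r)ᶜ = 0 ∧ E.push p r μ = μ := by
  refine and_congr_right fun hprob => and_congr_right fun hcompl => ?_
  have key : ∀ D : Set ℝ, MeasurableSet D →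
      ∫⁻ a in E.wealthSet p r, ∑ y ∈ E.Y, ENNReal.ofReal (E.e y) *
        D.indicator (fun _ => 1) ((1 + r) * E.savings p r a + cost p y) ∂μ = E.push p r μ D := by
    intro D hD
    have hm : ∀ y, Measurable (E.transition p r y) := fun y =>
      (continuous_transition_right hU hp hr hr1 y).measurable
    rw [push_apply hU hp hr hr1 μ hD]
    have h1 : ∫⁻ a in E.wealthSet p r, ∑ y ∈ E.Y, ENNReal.ofReal (E.e y) *
        D.indicator (fun _ => 1) ((1 + r) * E.savings p r a + cost p y) ∂μ =
        ∫⁻ a in E.wealthSet p r, ∑ y ∈ E.Y, ENNReal.ofReal (E.e y) *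
          (E.transition p r y ⁻¹' D).indicator 1 a ∂μ := by
      refine setLIntegral_congr_fun (E.measurableSet_wealthSet p r) fun a ha => ?_
      refine Finset.sum_congr rfl fun y _ => ?_
      rw [← transition_eq hr ha]
      rfl
    rw [h1, restrict_wealthSet hcompl, lintegral_finsetSum]
    · refine Finset.sum_congr rfl fun y _ => ?_
      rw [lintegral_const_mul _ (measurable_one.indicator (hm y hD)),
        lintegral_indicator_one (hm y hD)]
    · intro y _
      exact (measurable_one.indicator (hm y hD)).const_mul _
  constructor
  · intro h
    ext D hD
    rw [← key D hD, ← h D hD]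
  · intro h D hD
    rw [key D hD, h]

theorem measurable_step (hU : E.UtilityAssumption) (hp : ∀ i, 0 < p i) (hr : 0 < r)
    (hr1 : r < 1) {f : ℝ → ℝ} (hf : Measurable f) : Measurable (E.step p r f) :=
  Finset.measurable_fun_sum _ fun y _ =>
    (hf.comp (continuous_transition_right hU hp hr hr1 y).measurable).const_mul _

theorem integral_iterate_step (hU : E.UtilityAssumption) (hp : ∀ i, 0 < p i) (hr : 0 < r)
    (hr1 : r < 1) {μ : Measure ℝ} (hμ : E.IsInvariant p r μ) {f : ℝ → ℝ} (hf : Measurable f) {C : ℝ}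
    (hC : ∀ x, |f x| ≤ C) (N : ℕ) : ∫ a, (E.step p r)^[N] f a ∂μ = ∫ a, f a ∂μ := by
  obtain ⟨hprob, hcompl, hpush⟩ := (isInvariant_iff hU hp hr hr1 μ).1 hμ
  have hmeas : ∀ N, Measurable ((E.step p r)^[N] f) := by
    intro N
    induction N with
    | zero => exact hf
    | succ N ih =>
      rw [Function.iterate_succ_apply']
      exact measurable_step hU hp hr hr1 ih
  induction N with
  | zero => rfl
  | succ N ih =>
    rw [Function.iterate_succ_apply', ← ih,
      ← integral_push hU hp hr hr1 μ (hmeas N) (abs_iterate_step_le hC N), hpush]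

/-- The mean of a monotone function under an invariant distribution lies between its conditional means
after `N` periods given extreme initial wealth. -/
theorem integral_mem_Icc (hU : E.UtilityAssumption) (hp : ∀ i, 0 < p i) (hr : 0 < r)
    (hr1 : r < 1) {μ : Measure ℝ} (hμ : E.IsInvariant p r μ) {f : ℝ → ℝ} (hf : Monotone f) {C : ℝ}
    (hC : ∀ x, |f x| ≤ C) (N : ℕ) : ∫ a, f a ∂μ ∈
      Icc ((E.step p r)^[N] f (E.borrowLimit p r)) ((E.step p r)^[N] f (E.wealthTop p r)) := by
  obtain ⟨hprob, hcompl, hpush⟩ := (isInvariant_iff hU hp hr hr1 μ).1 hμ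
  rw [← integral_iterate_step hU hp hr hr1 hμ hf.measurable hC N]
  have hm := iterate_step_mono hU hp hr hr1 hf N
  have hint : Integrable ((E.step p r)^[N] f) μ := Integrable.of_bound
    hm.measurable.aestronglyMeasurable C (Eventually.of_forall (abs_iterate_step_le hC N))
  have hae : ∀ᵐ a ∂μ, a ∈ Icc (E.borrowLimit p r) (E.wealthTop p r) := by
    rw [← wealthSet_eq hr]
    rwa [ae_iff]
  constructor
  · have := integral_mono_ae (integrable_const ((E.step p r)^[N] f (E.borrowLimit p r))) hint
      (hae.mono fun a ha => hm ha.1)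
    simpa using this
  · have := integral_mono_ae hint (integrable_const ((E.step p r)^[N] f (E.wealthTop p r)))
      (hae.mono fun a ha => hm ha.2)
    simpa using this

theorem ramp_mono (k : ℕ) (x : ℝ) : Monotone fun a : ℝ => max 0 (min 1 (k * (a - x))) :=
  fun _ _ h => max_le_max le_rfl (min_le_min_left _
    (mul_le_mul_of_nonneg_left (by linarith) (Nat.cast_nonneg k)))

theorem abs_ramp_le (k : ℕ) (x a : ℝ) : |max 0 (min 1 (k * (a - x)))| ≤ 1 := by
  rw [abs_of_nonneg (le_max_left _ _)]
  exact max_le zero_le_one (min_le_left _ _)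

/-- The means of a ramp under both measures lie in one interval, between its `N`-step means from the
extremes, whose length tends to zero. -/
theorem IsInvariant.unique (hU : E.UtilityAssumption) (hp : ∀ i, 0 < p i) (hr : 0 < r)
    (hr1 : r < 1) {μ ν : Measure ℝ} (hμ : E.IsInvariant p r μ) (hν : E.IsInvariant p r ν) :
    μ = ν := by
  have := hμ.1
  have := hν.1
  refine Measure.ext_of_integral_ramp fun k x => eq_of_forall_dist_le fun ε hε => ?_
  obtain ⟨N, hN⟩ := exists_iterate_range_lt hU hp hr hr1 (ramp_mono k x) hε
  have h1 := integral_mem_Icc hU hp hr hr1 hμ (ramp_mono k x) (abs_ramp_le k x) N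
  have h2 := integral_mem_Icc hU hp hr hr1 hν (ramp_mono k x) (abs_ramp_le k x) N
  rw [Real.dist_eq, abs_le]
  constructor <;> linarith [h1.1, h1.2, h2.1, h2.2]

/-- The distribution of wealth after `N` periods, starting from the borrowing limit. -/
def law (E : Economy n) (p : Fin n → ℝ) (r : ℝ) (N : ℕ) : Measure ℝ :=
  (E.push p r)^[N] (Measure.dirac (E.borrowLimit p r))

theorem law_succ (N : ℕ) : E.law p r (N + 1) = E.push p r (E.law p r N) :=
  Function.iterate_succ_apply' _ _ _

theorem isProbabilityMeasure_law (hU : E.UtilityAssumption) (hp : ∀ i, 0 < p i) (hr : 0 < r)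
    (hr1 : r < 1) (N : ℕ) : IsProbabilityMeasure (E.law p r N) := by
  induction N with
  | zero => exact Measure.dirac.isProbabilityMeasure
  | succ N ih =>
    rw [law_succ]
    exact isProbabilityMeasure_push hU hp hr hr1 _

theorem law_compl (hU : E.UtilityAssumption) (hp : ∀ i, 0 < p i) (hr : 0 < r)
    (hr1 : r < 1) (N : ℕ) : E.law p r N (E.wealthSet p r)ᶜ = 0 := by
  cases N with
  | zero =>
    have : E.borrowLimit p r ∉ (E.wealthSet p r)ᶜ := by simp [borrowLimit_mem hp hr hr1]
    simpa [law, Measure.dirac_apply' _ (E.measurableSet_wealthSet p r).compl] using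
      borrowLimit_mem hp hr hr1
  | succ N =>
    rw [law_succ]
    exact push_compl hU hp hr hr1 _

theorem integral_law (hU : E.UtilityAssumption) (hp : ∀ i, 0 < p i) (hr : 0 < r)
    (hr1 : r < 1) (N : ℕ) : ∀ {f : ℝ → ℝ}, Measurable f → ∀ {C : ℝ}, (∀ x, |f x| ≤ C) →
      ∫ a, f a ∂(E.law p r N) = (E.step p r)^[N] f (E.borrowLimit p r) := by
  induction N with
  | zero => intro f _ C _; simp [law]
  | succ N ih =>
    intro f hf C hC
    have := isProbabilityMeasure_law hU hp hr hr1 N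
    rw [law_succ, integral_push hU hp hr hr1 _ hf hC,
      ih (measurable_step hU hp hr hr1 hf) (abs_step_le hC), Function.iterate_succ_apply]

/-- Laws started at the borrowing limit live on one compact interval, hence are tight and have a
weak limit along an ultrafilter. For monotone functions the `N`-step means increase, so they
converge along the whole sequence, and shifting time by one period does not change the limit. -/
theorem exists_isInvariant (hU : E.UtilityAssumption) (hp : ∀ i, 0 < p i) (hr : 0 < r)
    (hr1 : r < 1) : ∃ μ, E.IsInvariant p r μ := by
  set P : ℕ → ProbabilityMeasure ℝ := fun N => ⟨E.law p r N, isProbabilityMeasure_law hU hp hr hr1 N⟩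
  have htight : IsTightMeasureSet {((μ : ProbabilityMeasure ℝ) : Measure ℝ) | μ ∈ range P} := by
    rw [isTightMeasureSet_iff_exists_isCompact_measure_compl_le]
    intro ε _
    refine ⟨E.wealthSet p r, isCompact_Icc, ?_⟩
    rintro _ ⟨_, ⟨N, rfl⟩, rfl⟩
    exact (law_compl hU hp hr hr1 N).le.trans bot_le
  obtain ⟨μ, -, hμ⟩ := (isCompact_closure_of_isTightMeasureSet htight).exists_tendsto_ultrafilter
    (f := Ultrafilter.of (atTop : Filter ℕ)) (g := P)
    (Eventually.of_forall fun N => subset_closure (mem_range_self N))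
  have hle : (Ultrafilter.of (atTop : Filter ℕ) : Filter ℕ) ≤ atTop := Ultrafilter.of_le _
  have hcompl : (μ : Measure ℝ) (E.wealthSet p r)ᶜ = 0 := by
    have h1 := ProbabilityMeasure.le_liminf_measure_open_of_tendsto hμ
      (G := (E.wealthSet p r)ᶜ) (isClosed_Icc : IsClosed (E.wealthSet p r)).isOpen_compl
    have h2 : ∀ N, (P N : Measure ℝ) (E.wealthSet p r)ᶜ = 0 := law_compl hU hp hr hr1
    simp only [h2, liminf_const] at h1
    exact le_antisymm h1 bot_le
  refine ⟨μ, (isInvariant_iff hU hp hr hr1 _).2 ⟨inferInstance, hcompl, ?_⟩⟩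
  have := isProbabilityMeasure_push hU hp hr hr1 (μ : Measure ℝ)
  refine Measure.ext_of_integral_ramp fun k x => ?_
  set f : ℝ → ℝ := fun a => max 0 (min 1 (k * (a - x))) with hf
  have hfc : Continuous f := by fun_prop
  have hfm : Monotone f := ramp_mono k x
  have hfC : ∀ a, |f a| ≤ 1 := abs_ramp_le k x
  have hsc : Continuous (E.step p r f) := continuous_finsetSum _ fun y _ =>
    continuous_const.mul (hfc.comp (continuous_transition_right hU hp hr hr1 y))
  rw [integral_push hU hp hr hr1 _ hfc.measurable hfC]
  have hlim : ∀ g : ℝ → ℝ, Continuous g → (∀ a, |g a| ≤ 1) →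
      Tendsto (fun N => (E.step p r)^[N] g (E.borrowLimit p r)) (Ultrafilter.of (atTop : Filter ℕ) : Filter ℕ)
        (𝓝 (∫ a, g a ∂(μ : Measure ℝ))) := by
    intro g hg hgC
    have h1 := ProbabilityMeasure.tendsto_iff_forall_integral_tendsto.1 hμ
      (BoundedContinuousFunction.ofNormedAddCommGroup g hg 1 hgC)
    refine h1.congr fun N => ?_
    exact integral_law hU hp hr hr1 N hg.measurable hgC
  -- One period after starting at the lowest wealth, wealth is no lower, and the iterates of a
  -- monotone function are monotone.
  have hmono : Monotone fun N => (E.step p r)^[N] f (E.borrowLimit p r) := by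
    refine monotone_nat_of_le_succ fun N => ?_
    rw [Function.iterate_succ_apply']
    rw [← E.step_const p r ((E.step p r)^[N] f (E.borrowLimit p r)) (a := E.borrowLimit p r)]
    refine Finset.sum_le_sum fun y hy => mul_le_mul_of_nonneg_left ?_ (E.e_pos y hy).le
    have h1 := transition_mem hU hp hr hr1 hy (E.borrowLimit p r)
    rw [wealthSet_eq hr] at h1
    exact iterate_step_mono hU hp hr hr1 hfm N h1.1
  have hconv := tendsto_atTop_ciSup hmono ⟨1, by
    rintro _ ⟨N, rfl⟩
    exact (abs_le.1 (abs_iterate_step_le hfC N _)).2⟩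
  have h1 := tendsto_nhds_unique (hlim f hfc hfC) (hconv.mono_left hle)
  have h2 := hlim _ hsc (abs_step_le hfC)
  simp only [← Function.iterate_succ_apply] at h2
  have h3 := tendsto_nhds_unique h2 ((hconv.comp (tendsto_add_atTop_nat 1)).mono_left hle)
  rw [h1, h3]

theorem isInvariant_invariant (hU : E.UtilityAssumption) (hp : ∀ i, 0 < p i) (hr : 0 < r)
    (hr1 : r < 1) : E.IsInvariant p r (E.invariant p r) :=
  Classical.epsilon_spec (exists_isInvariant hU hp hr hr1)

end Economy

end

/-! ### Continuity of excess demand, Walras' law and bounds. -/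

noncomputable section

namespace Economy

variable {n : ℕ} {E : Economy n} {p : Fin n → ℝ} {r a b c : ℝ}

/-- For fixed `N` the mean is squeezed between two continuous functions of prices, the `N`-step
means from the extremes, and their gap at `z₀` is as small as desired. -/
theorem continuous_integral_of_monotone (hU : E.UtilityAssumption) {G : PriceDomain n → ℝ → ℝ}
    (hG : Continuous fun q : PriceDomain n × ℝ => G q.1 q.2) (hm : ∀ z, Monotone (G z)) {C : ℝ}
    (hC : ∀ z x, |G z x| ≤ C) :
    Continuous fun z : PriceDomain n => ∫ a, G z a ∂(E.invariant z.1.1 z.1.2) := by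
  rw [continuous_iff_continuousAt]
  intro z₀
  rw [Metric.continuousAt_iff']
  intro ε hε
  obtain ⟨N, hN⟩ := exists_iterate_range_lt hU z₀.2.1 z₀.2.2.1 z₀.2.2.2 (hm z₀)
    (show 0 < ε / 2 by linarith)
  have hit := continuous_iterate_step hU hG N
  have hL := hit.comp (continuous_id.prodMk E.continuous_borrowLimit)
  have hT := hit.comp (continuous_id.prodMk E.continuous_wealthTop)
  have hmem : ∀ z : PriceDomain n, _ := fun z => integral_mem_Icc hU z.2.1 z.2.2.1 z.2.2.2
    (isInvariant_invariant hU z.2.1 z.2.2.1 z.2.2.2) (hm z) (hC z) N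
  filter_upwards [Metric.continuousAt_iff'.1 hL.continuousAt (ε / 2) (by linarith),
    Metric.continuousAt_iff'.1 hT.continuousAt (ε / 2) (by linarith)] with z hz1 hz2
  have h1 := hmem z
  have h2 := hmem z₀
  rw [Real.dist_eq, abs_lt] at *
  simp only [Function.comp, id] at hz1 hz2
  constructor <;> linarith [h1.1, h1.2, h2.1, h2.2]

/-- The relative position of wealth in the wealth set. -/
def position (E : Economy n) (p : Fin n → ℝ) (r a : ℝ) : ℝ :=
  (E.clamp p r a - E.borrowLimit p r) / (E.wealthTop p r - E.borrowLimit p r)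

theorem position_mem (hp : ∀ i, 0 < p i) (hr : 0 < r) (hr1 : r < 1) (a : ℝ) :
    E.position p r a ∈ Icc (0 : ℝ) 1 := by
  have h := clamp_mem (E := E) hp hr hr1 a
  rw [wealthSet_eq hr] at h
  have hd := sub_pos.2 (borrowLimit_lt_wealthTop (E := E) hp hr hr1)
  exact ⟨div_nonneg (sub_nonneg.2 h.1) hd.le, (div_le_one hd).2 (sub_le_sub_right h.2 _)⟩

theorem position_mono (hp : ∀ i, 0 < p i) (hr : 0 < r) (hr1 : r < 1) :
    Monotone (E.position p r) := fun _ _ h =>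
  div_le_div_of_nonneg_right (sub_le_sub_right (E.clamp_mono p r h) _)
    (sub_pos.2 (borrowLimit_lt_wealthTop (E := E) hp hr hr1)).le

theorem continuous_position (E : Economy n) :
    Continuous fun q : PriceDomain n × ℝ => E.position q.1.1.1 q.1.1.2 q.2 := by
  have h1 : Continuous fun q : PriceDomain n × ℝ => E.borrowLimit q.1.1.1 q.1.1.2 :=
    E.continuous_borrowLimit.comp continuous_fst
  have h2 : Continuous fun q : PriceDomain n × ℝ => E.wealthTop q.1.1.1 q.1.1.2 :=
    E.continuous_wealthTop.comp continuous_fst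
  exact (E.continuous_clamp.sub h1).div (h2.sub h1) fun q =>
    (sub_pos.2 (borrowLimit_lt_wealthTop (E := E) q.1.2.1 q.1.2.2.1 q.1.2.2.2)).ne'

theorem abs_position_pow_le (hp : ∀ i, 0 < p i) (hr : 0 < r) (hr1 : r < 1) (k : ℕ) (a : ℝ) :
    |E.position p r a ^ k| ≤ 1 := by
  have h := position_mem (E := E) hp hr hr1 a
  rw [abs_of_nonneg (pow_nonneg h.1 k)]
  exact pow_le_one₀ h.1 h.2

theorem continuous_position_right (hp : ∀ i, 0 < p i) (hr : 0 < r) (hr1 : r < 1) :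
    Continuous (E.position p r) :=
  E.continuous_position.comp (f := fun a => ((⟨(p, r), hp, hr, hr1⟩ : PriceDomain n), a))
    (by fun_prop)

/-- Relative position takes values in `[0, 1]` and increases with wealth, so its powers are monotone
and bounded and the monotone case applies to each. -/
theorem continuous_integral_polynomial (hU : E.UtilityAssumption) (P : Polynomial ℝ) :
    Continuous fun z : PriceDomain n =>
      ∫ a, P.eval (E.position z.1.1 z.1.2 a) ∂(E.invariant z.1.1 z.1.2) := by
  have h : ∀ z : PriceDomain n, ∫ a, P.eval (E.position z.1.1 z.1.2 a) ∂(E.invariant z.1.1 z.1.2) =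
      ∑ k ∈ Finset.range (P.natDegree + 1), P.coeff k *
        ∫ a, E.position z.1.1 z.1.2 a ^ k ∂(E.invariant z.1.1 z.1.2) := by
    intro z
    have := (isInvariant_invariant hU z.2.1 z.2.2.1 z.2.2.2).1
    simp_rw [Polynomial.eval_eq_sum_range, ← integral_const_mul]
    refine integral_finsetSum _ fun k _ => Integrable.const_mul ?_ _
    exact Integrable.of_bound ((continuous_position_right z.2.1 z.2.2.1 z.2.2.2).pow
      k).aestronglyMeasurable 1 (Eventually.of_forall (abs_position_pow_le z.2.1 z.2.2.1 z.2.2.2 k))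
  simp_rw [h]
  refine continuous_finsetSum _ fun k _ => continuous_const.mul
    (continuous_integral_of_monotone hU (G := fun z a => E.position z.1.1 z.1.2 a ^ k)
      (E.continuous_position.pow k) (fun z a a' h => ?_)
      fun z => abs_position_pow_le z.2.1 z.2.2.1 z.2.2.2 k)
  exact pow_le_pow_left₀ (position_mem z.2.1 z.2.2.1 z.2.2.2 a).1
    (position_mono z.2.1 z.2.2.1 z.2.2.2 h) k

theorem clamp_eq_position (hp : ∀ i, 0 < p i) (hr : 0 < r) (hr1 : r < 1) (a : ℝ) :
    E.clamp p r a = E.clamp p r (E.borrowLimit p r +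
      E.position p r a * (E.wealthTop p r - E.borrowLimit p r)) := by
  have hd := sub_pos.2 (borrowLimit_lt_wealthTop (E := E) hp hr hr1)
  rw [position, div_mul_cancel₀ _ hd.ne', add_sub_cancel, clamp_of_mem hr (clamp_mem hp hr hr1 a)]

/-- Means under the invariant distribution depend continuously on prices and the interest rate. -/
theorem continuous_integral_invariant (hU : E.UtilityAssumption) {F : PriceDomain n → ℝ → ℝ}
    (hF : Continuous fun q : PriceDomain n × ℝ => F q.1 (E.clamp q.1.1.1 q.1.1.2 q.2)) :
    Continuous fun z : PriceDomain n =>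
      ∫ a, F z (E.clamp z.1.1 z.1.2 a) ∂(E.invariant z.1.1 z.1.2) := by
  set H : PriceDomain n → ℝ → ℝ := fun z t => F z (E.clamp z.1.1 z.1.2 (E.borrowLimit z.1.1 z.1.2 +
    t * (E.wealthTop z.1.1 z.1.2 - E.borrowLimit z.1.1 z.1.2))) with hHdef
  have hH : Continuous fun q : PriceDomain n × ℝ => H q.1 q.2 := by
    have h1 : Continuous fun q : PriceDomain n × ℝ => E.borrowLimit q.1.1.1 q.1.1.2 :=
      E.continuous_borrowLimit.comp continuous_fst
    have h2 : Continuous fun q : PriceDomain n × ℝ => E.wealthTop q.1.1.1 q.1.1.2 :=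
      E.continuous_wealthTop.comp continuous_fst
    exact hF.comp (continuous_fst.prodMk (h1.add (continuous_snd.mul (h2.sub h1))))
  have hFH : ∀ z : PriceDomain n, ∀ a, F z (E.clamp z.1.1 z.1.2 a) =
      H z (E.position z.1.1 z.1.2 a) := fun z a => by
    rw [clamp_eq_position z.2.1 z.2.2.1 z.2.2.2 a]
  simp_rw [hFH]
  -- Currying turns joint continuity into continuity for the uniform norm on the fixed interval of
  -- relative positions.
  set h : C(PriceDomain n, C(unitInterval, ℝ)) := ContinuousMap.curry
    ⟨fun q : PriceDomain n × unitInterval => H q.1 q.2,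
      hH.comp (continuous_fst.prodMk (continuous_subtype_val.comp continuous_snd))⟩ with hh
  have hhapp : ∀ z (t : unitInterval), h z t = H z t := fun z t => rfl
  rw [continuous_iff_continuousAt]
  intro z₀
  rw [Metric.continuousAt_iff']
  intro ε hε
  have hε5 : 0 < ε / 5 := by linarith
  -- One polynomial approximates the integrand at `z₀` and, up to another `ε / 5`, at nearby `z`.
  -- The two replacements cost at most `2 * (ε / 5)` each, the change of the polynomial's mean less
  -- than `ε / 5`.
  obtain ⟨P, hP⟩ := exists_polynomial_near_of_continuousOn 0 1 (H z₀)
    ((hH.comp (f := fun t : ℝ => (z₀, t)) (by fun_prop)).continuousOn) (ε / 5) hε5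
  have hint1 : ∀ z : PriceDomain n, Integrable (fun a => H z (E.position z.1.1 z.1.2 a))
      (E.invariant z.1.1 z.1.2) := fun z => by
    have := (isInvariant_invariant hU z.2.1 z.2.2.1 z.2.2.2).1
    refine Integrable.of_bound ((hH.comp (continuous_const.prodMk
      (continuous_position_right z.2.1 z.2.2.1 z.2.2.2))).aestronglyMeasurable (f := fun a =>
        H z (E.position z.1.1 z.1.2 a))) ‖h z‖ (Eventually.of_forall fun a => ?_)
    exact (h z).norm_coe_le_norm ⟨_, position_mem z.2.1 z.2.2.1 z.2.2.2 a⟩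
  have hint2 : ∀ z : PriceDomain n, Integrable (fun a => P.eval (E.position z.1.1 z.1.2 a))
      (E.invariant z.1.1 z.1.2) := fun z => by
    have := (isInvariant_invariant hU z.2.1 z.2.2.1 z.2.2.2).1
    obtain ⟨C, hC⟩ := isCompact_Icc.exists_bound_of_continuousOn
      (P.continuous.continuousOn (s := Icc (0 : ℝ) 1))
    exact Integrable.of_bound ((P.continuous.comp
      (continuous_position_right z.2.1 z.2.2.1 z.2.2.2)).aestronglyMeasurable) C
      (Eventually.of_forall fun a => hC _ (position_mem z.2.1 z.2.2.1 z.2.2.2 a))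
  have hclose : ∀ z : PriceDomain n, dist (h z) (h z₀) < ε / 5 →
      |∫ a, H z (E.position z.1.1 z.1.2 a) ∂(E.invariant z.1.1 z.1.2) -
        ∫ a, P.eval (E.position z.1.1 z.1.2 a) ∂(E.invariant z.1.1 z.1.2)| ≤ 2 * (ε / 5) := by
    intro z hz
    have := (isInvariant_invariant hU z.2.1 z.2.2.1 z.2.2.2).1
    rw [← integral_sub (hint1 z) (hint2 z)]
    have hnorm := norm_integral_le_of_norm_le_const (μ := E.invariant z.1.1 z.1.2)
      (f := fun a => H z (E.position z.1.1 z.1.2 a) - P.eval (E.position z.1.1 z.1.2 a))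
      (C := 2 * (ε / 5)) (Eventually.of_forall fun a => ?_)
    · rwa [probReal_univ, mul_one] at hnorm
    have hm := position_mem (E := E) z.2.1 z.2.2.1 z.2.2.2 a
    have h1 := (ContinuousMap.dist_apply_le_dist (f := h z) (g := h z₀) ⟨_, hm⟩).trans_lt hz
    have h2 := hP _ hm
    rw [hhapp, hhapp, Real.dist_eq, abs_lt] at h1
    rw [abs_lt] at h2
    rw [Real.norm_eq_abs, abs_le]
    constructor <;> linarith
  filter_upwards [Metric.continuousAt_iff'.1 h.continuous.continuousAt (ε / 5) hε5,
    Metric.continuousAt_iff'.1 (continuous_integral_polynomial hU P).continuousAt (ε / 5) hε5]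
    with z hz1 hz2
  have h1 := hclose z hz1
  have h2 := hclose z₀ (by rw [dist_self]; exact hε5)
  rw [Real.dist_eq, abs_lt] at *
  rw [abs_le] at h1 h2
  constructor <;> linarith

theorem setIntegral_eq (hU : E.UtilityAssumption) (hp : ∀ i, 0 < p i) (hr : 0 < r)
    (hr1 : r < 1) (f : ℝ → ℝ) : ∫ a in E.wealthSet p r, f a ∂(E.invariant p r) =
      ∫ a, f (E.clamp p r a) ∂(E.invariant p r) := by
  have h := isInvariant_invariant hU hp hr hr1
  have h1 : ∫ a in E.wealthSet p r, f a ∂(E.invariant p r) =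
      ∫ a in E.wealthSet p r, f (E.clamp p r a) ∂(E.invariant p r) :=
    setIntegral_congr_fun (E.measurableSet_wealthSet p r) fun a ha => by
      rw [clamp_of_mem hr ha]
  rw [h1, restrict_wealthSet h.2.1]

theorem integrableOn_wealthSet (hU : E.UtilityAssumption) (hp : ∀ i, 0 < p i) (hr : 0 < r)
    (hr1 : r < 1) {f : ℝ → ℝ} (hf : ContinuousOn f (E.wealthSet p r)) :
    IntegrableOn f (E.wealthSet p r) (E.invariant p r) := by
  have := (isInvariant_invariant hU hp hr hr1).1
  exact hf.integrableOn_compact isCompact_Icc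

theorem continuousOn_consumption (hU : E.UtilityAssumption) (hp : ∀ i, 0 < p i) (hr : 0 < r)
    (hr1 : r < 1) : ContinuousOn (fun a => a - E.savings p r a) (E.wealthSet p r) :=
  continuousOn_id.sub (continuousOn_savings hU hp hr hr1)

theorem consumption_nonneg (hU : E.UtilityAssumption) (hp : ∀ i, 0 < p i) (hr : 0 < r)
    (hr1 : r < 1) (ha : a ∈ E.wealthSet p r) : 0 ≤ a - E.savings p r a := by
  rw [wealthSet_eq hr] at ha
  exact sub_nonneg.2 (savings_le hU hp hr hr1 ha.1)

theorem continuousOn_demand_consumption (hU : E.UtilityAssumption) (hp : ∀ i, 0 < p i) (hr : 0 < r)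
    (hr1 : r < 1) (i : Fin n) :
    ContinuousOn (fun a => E.demand p (a - E.savings p r a) i) (E.wealthSet p r) :=
  ((continuous_apply i).comp_continuousOn (continuousOn_demand_right hU hp)).comp
    (continuousOn_consumption hU hp hr hr1) fun _ ha => consumption_nonneg hU hp hr hr1 ha

theorem wellDefinedAt (hU : E.UtilityAssumption) (hp : ∀ i, 0 < p i) (hr : 0 < r)
    (hr1 : r < 1) : E.WellDefinedAt p r where
  demand_unique _ hc := existsUnique_isDemand hU hp hc
  savings_unique a ha := by
    rw [wealthSet_eq hr] at ha
    exact existsUnique_isOptimalSavings hU hp hr hr1 ha.1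
  invariant_unique := ⟨_, isInvariant_invariant hU hp hr hr1, fun _ hμ =>
    hμ.unique hU hp hr hr1 (isInvariant_invariant hU hp hr hr1)⟩
  integrable_demand i := integrableOn_wealthSet hU hp hr hr1
    (continuousOn_demand_consumption hU hp hr hr1 i)
  integrable_savings := integrableOn_wealthSet hU hp hr hr1 (continuousOn_savings hU hp hr hr1)

theorem continuous_excessGood (hU : E.UtilityAssumption) (i : Fin n) :
    Continuous fun z : PriceDomain n => E.excessGood z.1.1 z.1.2 i := by
  unfold excessGood
  refine Continuous.sub ?_ continuous_const
  refine (continuous_integral_invariant hU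
    (F := fun z a => E.demand z.1.1 (a - E.savings z.1.1 z.1.2 a) i) ?_).congr fun z =>
      (setIntegral_eq hU z.2.1 z.2.2.1 z.2.2.2
        fun a => E.demand z.1.1 (a - E.savings z.1.1 z.1.2 a) i).symm
  refine (continuous_apply i).comp ((continuousOn_demand hU).comp_continuous
    (f := fun q : PriceDomain n × ℝ => (q.1.1.1, E.clamp q.1.1.1 q.1.1.2 q.2 -
      E.savings q.1.1.1 q.1.1.2 (E.clamp q.1.1.1 q.1.1.2 q.2)))
    (Continuous.prodMk (by fun_prop) (E.continuous_clamp.sub (continuous_savings hU))) fun q => ?_)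
  exact ⟨q.1.2.1, consumption_nonneg hU q.1.2.1 q.1.2.2.1 q.1.2.2.2
    (clamp_mem q.1.2.1 q.1.2.2.1 q.1.2.2.2 _)⟩

theorem continuous_excessSavings (hU : E.UtilityAssumption) :
    Continuous fun z : PriceDomain n => E.excessSavings z.1.1 z.1.2 := by
  unfold excessSavings
  exact ((continuous_integral_invariant hU (F := fun z a => E.savings z.1.1 z.1.2 a)
    (continuous_savings hU)).congr fun z =>
      (setIntegral_eq hU z.2.1 z.2.2.1 z.2.2.2 _).symm).neg

/-- The mean value of the endowment. -/
def meanEndow (E : Economy n) (p : Fin n → ℝ) : ℝ := ∑ y ∈ E.Y, E.e y * cost p y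

/-- Mean consumption expenditure is mean endowment income plus mean interest income. -/
theorem integral_consumption (hU : E.UtilityAssumption) (hp : ∀ i, 0 < p i) (hr : 0 < r)
    (hr1 : r < 1) : ∫ a in E.wealthSet p r, (a - E.savings p r a) ∂(E.invariant p r) =
      E.meanEndow p + r * ∫ a in E.wealthSet p r, E.savings p r a ∂(E.invariant p r) := by
  have hinv := isInvariant_invariant hU hp hr hr1
  obtain ⟨hprob, hcompl, hpush⟩ := (isInvariant_iff hU hp hr hr1 _).1 hinv
  have hg := integrableOn_wealthSet hU hp hr hr1 (continuousOn_savings hU hp hr hr1)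
  have hid := integrableOn_wealthSet hU hp hr hr1 (f := fun a => a) continuousOn_id
  rw [integral_sub hid hg, setIntegral_eq hU hp hr hr1 fun a => a]
  have hcl : Continuous (E.clamp p r) := E.continuous_clamp.comp
    (f := fun a => ((⟨(p, r), hp, hr, hr1⟩ : PriceDomain n), a)) (by fun_prop)
  have hbound : ∀ x, |E.clamp p r x| ≤ max |E.borrowLimit p r| |E.wealthTop p r| := fun x => by
    have := clamp_mem (E := E) hp hr hr1 x
    rw [wealthSet_eq hr] at this
    exact abs_le_max_abs_abs this.1 this.2
  -- Invariance is applied to the clamp, a bounded function that coincides with wealth on the wealth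
  -- set.
  have h1 := integral_push hU hp hr hr1 (E.invariant p r) hcl.measurable hbound
  rw [hpush] at h1
  have h2 : ∀ a, E.step p r (E.clamp p r) a =
      (1 + r) * E.savings p r (E.clamp p r a) + E.meanEndow p := by
    intro a
    have : E.step p r (E.clamp p r) a =
        ∑ y ∈ E.Y, E.e y * ((1 + r) * E.savings p r (E.clamp p r a) + cost p y) :=
      Finset.sum_congr rfl fun y hy => by
        rw [clamp_of_mem hr (transition_mem hU hp hr hr1 hy a), transition]
    rw [this, meanEndow]
    simp only [mul_add, Finset.sum_add_distrib, ← Finset.sum_mul, E.e_sum, one_mul]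
  have hg' : Integrable (fun a => E.savings p r (E.clamp p r a)) (E.invariant p r) := by
    have h3 : IntegrableOn (fun a => E.savings p r (E.clamp p r a)) (E.wealthSet p r)
        (E.invariant p r) :=
      hg.congr_fun (fun a ha => by rw [clamp_of_mem hr ha])
        (E.measurableSet_wealthSet p r)
    rwa [IntegrableOn, restrict_wealthSet hcompl] at h3
  simp_rw [h2] at h1
  rw [integral_add (hg'.const_mul _) (integrable_const _), integral_const_mul,
    ← setIntegral_eq hU hp hr hr1] at h1
  rw [h1]
  simp only [integral_const, probReal_univ, smul_eq_mul, one_mul]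
  ring

theorem sum_mul_integral_demand (hU : E.UtilityAssumption) (hp : ∀ i, 0 < p i) (hr : 0 < r)
    (hr1 : r < 1) : ∑ i, p i * ∫ a in E.wealthSet p r, E.demand p (a - E.savings p r a) i
        ∂(E.invariant p r) =
      ∫ a in E.wealthSet p r, (a - E.savings p r a) ∂(E.invariant p r) := by
  simp_rw [← integral_const_mul]
  rw [← integral_finsetSum]
  · refine setIntegral_congr_fun (E.measurableSet_wealthSet p r) fun a ha => ?_
    exact cost_demand hU hp (consumption_nonneg hU hp hr hr1 ha)
  · intro i _
    exact (integrableOn_wealthSet hU hp hr hr1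
      (continuousOn_demand_consumption hU hp hr hr1 i)).const_mul _

/-- Walras' law. -/
theorem walras (hU : E.UtilityAssumption) (hp : ∀ i, 0 < p i) (hr : 0 < r) (hr1 : r < 1) :
    ∑ i, p i * E.excessGood p r i + r * E.excessSavings p r = 0 := by
  have h1 := sum_mul_integral_demand hU hp hr hr1
  rw [integral_consumption hU hp hr hr1] at h1
  have h2 : ∑ i, p i * ∑ y ∈ E.Y, E.e y * y i = E.meanEndow p := by
    simp_rw [Finset.mul_sum, meanEndow, cost]
    rw [Finset.sum_comm]
    refine Finset.sum_congr rfl fun y _ => ?_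
    rw [Finset.mul_sum]
    exact Finset.sum_congr rfl fun i _ => by ring
  simp only [excessGood, excessSavings, mul_sub, Finset.sum_sub_distrib, h1, h2]
  ring

/-- The mean total endowment. -/
def totalEndow (E : Economy n) : ℝ := ∑ y ∈ E.Y, E.e y * ∑ i, y i

theorem totalEndow_nonneg (E : Economy n) : 0 ≤ E.totalEndow :=
  Finset.sum_nonneg fun y hy => mul_nonneg (E.e_pos y hy).le
    (Finset.sum_nonneg fun i _ => (E.Y_pos y hy i).le)

theorem meanEndow_good_le (E : Economy n) (i : Fin n) :
    ∑ y ∈ E.Y, E.e y * y i ≤ E.totalEndow :=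
  Finset.sum_le_sum fun y hy => mul_le_mul_of_nonneg_left
    (Finset.single_le_sum (f := y) (fun i _ => (E.Y_pos y hy i).le) (Finset.mem_univ i))
    (E.e_pos y hy).le

theorem meanEndow_le (E : Economy n) (hp1 : ∀ i, p i ≤ 1) : E.meanEndow p ≤ E.totalEndow :=
  Finset.sum_le_sum fun y hy => mul_le_mul_of_nonneg_left
    (Finset.sum_le_sum fun i _ => mul_le_of_le_one_left (E.Y_pos y hy i).le (hp1 i))
    (E.e_pos y hy).le

theorem minEndow_le_meanEndow (E : Economy n) (p : Fin n → ℝ) : E.minEndow p ≤ E.meanEndow p := by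
  calc E.minEndow p = ∑ y ∈ E.Y, E.e y * E.minEndow p := by rw [← Finset.sum_mul, E.e_sum, one_mul]
    _ ≤ E.meanEndow p := Finset.sum_le_sum fun y hy =>
        mul_le_mul_of_nonneg_left (minEndow_le hy) (E.e_pos y hy).le

theorem savingsCap_of_sum (h : ∑ i, p i + r = 1) (hr1 : r < 1) :
    E.savingsCap p r = E.bbar / (1 - r) := by
  have : (1 - r) ≠ 0 := (sub_pos.2 hr1).ne'
  rw [savingsCap_eq, show ∑ i, p i = 1 - r by linarith]
  field_simp

theorem integral_savings_le (hU : E.UtilityAssumption) (hp : ∀ i, 0 < p i) (hr : 0 < r)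
    (hr1 : r < 1) :
    ∫ a in E.wealthSet p r, E.savings p r a ∂(E.invariant p r) ≤ E.savingsCap p r := by
  have hinv := isInvariant_invariant hU hp hr hr1
  have := hinv.1
  have h := setIntegral_mono_on (integrableOn_wealthSet hU hp hr hr1
    (continuousOn_savings hU hp hr hr1)) (integrableOn_const (C := E.savingsCap p r)
      (measure_ne_top (E.invariant p r) _)) (E.measurableSet_wealthSet p r) fun a ha => by
    rw [wealthSet_eq hr] at ha
    exact (savings_mem_Icc hU hp hr hr1 ha.1).2
  rw [restrict_wealthSet hinv.2.1] at h ⊢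
  simpa using h

theorem le_integral_savings (hU : E.UtilityAssumption) (hp : ∀ i, 0 < p i) (hr : 0 < r)
    (hr1 : r < 1) :
    E.borrowLimit p r ≤ ∫ a in E.wealthSet p r, E.savings p r a ∂(E.invariant p r) := by
  have hinv := isInvariant_invariant hU hp hr hr1
  have := hinv.1
  have h := setIntegral_mono_on (integrableOn_const (C := E.borrowLimit p r)
      (measure_ne_top (E.invariant p r) _)) (integrableOn_wealthSet hU hp hr hr1
    (continuousOn_savings hU hp hr hr1)) (E.measurableSet_wealthSet p r) fun a ha => by
    rw [wealthSet_eq hr] at ha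
    exact (savings_mem_Icc hU hp hr hr1 ha.1).1
  rw [restrict_wealthSet hinv.2.1] at h ⊢
  simpa using h

theorem integral_demand_nonneg (hU : E.UtilityAssumption) (hp : ∀ i, 0 < p i) (hr : 0 < r)
    (hr1 : r < 1) (i : Fin n) :
    0 ≤ ∫ a in E.wealthSet p r, E.demand p (a - E.savings p r a) i ∂(E.invariant p r) :=
  setIntegral_nonneg (E.measurableSet_wealthSet p r) fun _ ha =>
    demand_nonneg hU hp (consumption_nonneg hU hp hr hr1 ha) i

theorem neg_totalEndow_le_excessGood (hU : E.UtilityAssumption) (hp : ∀ i, 0 < p i) (hr : 0 < r)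
    (hr1 : r < 1) (i : Fin n) : -E.totalEndow ≤ E.excessGood p r i := by
  have h1 := integral_demand_nonneg hU hp hr hr1 i
  have h2 := E.meanEndow_good_le i
  unfold excessGood
  linarith

theorem price_le_one (hp : ∀ i, 0 < p i) (h : ∑ i, p i + r = 1) (i : Fin n) :
    p i + r ≤ 1 := by
  have := Finset.single_le_sum (f := p) (fun i _ => (hp i).le) (Finset.mem_univ i)
  linarith

/-- Spending on good `k` is at most mean expenditure, that is, endowment income plus interest on
savings. Savings are at most `bbar / (1 - r)`, and `1 - r ≥ p k ≥ η`. -/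
theorem excessGood_le (hU : E.UtilityAssumption) (hp : ∀ i, 0 < p i) (hr : 0 < r)
    (hr1 : r < 1) (h : ∑ i, p i + r = 1) {η : ℝ} (hη : 0 < η) {k : Fin n} (hk : η ≤ p k) :
    E.excessGood p r k ≤ (E.totalEndow + E.bbar / η) / η := by
  have h1 := sum_mul_integral_demand hU hp hr hr1
  rw [integral_consumption hU hp hr hr1] at h1
  have h2 := Finset.single_le_sum (f := fun i => p i * ∫ a in E.wealthSet p r,
    E.demand p (a - E.savings p r a) i ∂(E.invariant p r)) (fun i _ => mul_nonneg (hp i).le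
      (integral_demand_nonneg hU hp hr hr1 i)) (Finset.mem_univ k)
  simp only [h1] at h2
  have h3 := E.meanEndow_le (p := p) fun i => by linarith [price_le_one hp h i]
  have h4 := integral_savings_le hU hp hr hr1
  rw [savingsCap_of_sum h hr1] at h4
  have h5 : E.bbar / (1 - r) ≤ E.bbar / η :=
    div_le_div_of_nonneg_left E.bbar_pos.le hη (by linarith [price_le_one hp h k])
  have h6 : 0 < E.bbar / η := div_pos E.bbar_pos hη
  have h7 := integral_demand_nonneg hU hp hr hr1 k
  have h8 : 0 ≤ ∑ y ∈ E.Y, E.e y * y k := Finset.sum_nonneg fun y hy =>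
    mul_nonneg (E.e_pos y hy).le (E.Y_pos y hy k).le
  set I := ∫ a in E.wealthSet p r, E.demand p (a - E.savings p r a) k ∂(E.invariant p r)
  set J := ∫ a in E.wealthSet p r, E.savings p r a ∂(E.invariant p r)
  have h9 : I ≤ (E.totalEndow + E.bbar / η) / η := by
    rw [le_div_iff₀ hη]
    have h10 : r * J ≤ E.bbar / η := by
      rcases le_or_gt J 0 with hJ | hJ
      · nlinarith
      · nlinarith
    nlinarith
  change I - _ ≤ _
  linarith

end Economy

/-- The reciprocals converge and so are bounded over all indices, not only eventually. -/
theorem exists_pos_lower_bound {u : ℕ → ℝ} {l : ℝ} (hu : ∀ q, 0 < u q)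
    (hlim : Tendsto u atTop (𝓝 l)) (hl : 0 < l) : ∃ η, 0 < η ∧ ∀ q, η ≤ u q := by
  obtain ⟨M, hM⟩ := (hlim.inv₀ hl.ne').bddAbove_range
  have hM' : ∀ q, (u q)⁻¹ ≤ M := fun q => hM ⟨q, rfl⟩
  have hMpos : 0 < M := (inv_pos.2 (hu 0)).trans_le (hM' 0)
  exact ⟨M⁻¹, inv_pos.2 hMpos, fun q => inv_le_of_inv_le₀ (hu q) (hM' q)⟩

namespace Economy

variable {n : ℕ} {E : Economy n} {p : Fin n → ℝ} {r : ℝ}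

theorem interest_lt_one (E : Economy n) {z : (Fin n → ℝ) × ℝ} (hz : z ∈ openPriceSimplex n) :
    z.2 < 1 := by
  have h1 := E.sum_pos hz.2.1
  linarith [hz.1.2.2]

theorem continuousOn_excessDemand (hU : E.UtilityAssumption) :
    ContinuousOn E.excessDemand (openPriceSimplex n) := by
  rw [continuousOn_iff_continuous_domRestrict]
  have hι : Continuous fun z : openPriceSimplex n =>
      (⟨z.1, z.2.2.1, z.2.2.2, E.interest_lt_one z.2⟩ : PriceDomain n) := by fun_prop
  have h1 : Continuous fun z : openPriceSimplex n => E.excessGood z.1.1 z.1.2 := by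
    refine continuous_pi fun i => ?_
    have h := (continuous_excessGood hU i).comp hι
    simp only [Function.comp_def] at h
    exact h
  have h2 : Continuous fun z : openPriceSimplex n => E.excessSavings z.1.1 z.1.2 := by
    have h := (continuous_excessSavings hU).comp hι
    simp only [Function.comp_def] at h
    exact h
  exact h1.prodMk h2

theorem exists_bound_excessGood (hU : E.UtilityAssumption) {u : ℕ → (Fin n → ℝ) × ℝ}
    {z : (Fin n → ℝ) × ℝ} (hu : ∀ q, u q ∈ openPriceSimplex n) (hlim : Tendsto u atTop (𝓝 z))
    {k : Fin n} (hk : 0 < z.1 k) : ∃ M : ℝ, ∀ q, |(E.excessDemand (u q)).1 k| ≤ M := by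
  obtain ⟨η, hη, hle⟩ := exists_pos_lower_bound (u := fun q => (u q).1 k)
    (fun q => (hu q).2.1 k) (((continuous_apply k).comp continuous_fst).tendsto z |>.comp hlim) hk
  refine ⟨E.totalEndow + (E.totalEndow + E.bbar / η) / η, fun q => ?_⟩
  have h0 := E.totalEndow_nonneg
  have h1 := neg_totalEndow_le_excessGood hU (hu q).2.1 (hu q).2.2 (E.interest_lt_one (hu q)) k
  have h2 := excessGood_le hU (hu q).2.1 (hu q).2.2 (E.interest_lt_one (hu q)) (hu q).1.2.2 hη
    (hle q)
  have h3 : 0 ≤ (E.totalEndow + E.bbar / η) / η :=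
    div_nonneg (add_nonneg h0 (div_pos E.bbar_pos hη).le) hη.le
  rw [abs_le]
  constructor
  · change _ ≤ E.excessGood _ _ k
    linarith
  · change E.excessGood _ _ k ≤ _
    linarith

theorem exists_bound_excessSavings (hU : E.UtilityAssumption) {u : ℕ → (Fin n → ℝ) × ℝ}
    {z : (Fin n → ℝ) × ℝ} (hu : ∀ q, u q ∈ openPriceSimplex n) (hlim : Tendsto u atTop (𝓝 z))
    (h0 : 0 < z.2) (h1 : z.2 < 1) : ∃ M : ℝ, ∀ q, |(E.excessDemand (u q)).2| ≤ M := by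
  have hlim2 : Tendsto (fun q => (u q).2) atTop (𝓝 z.2) := (continuous_snd.tendsto z).comp hlim
  obtain ⟨η, hη, hle⟩ := exists_pos_lower_bound (fun q => (hu q).2.2) hlim2 h0
  obtain ⟨η', hη', hle'⟩ := exists_pos_lower_bound
    (fun q => sub_pos.2 (E.interest_lt_one (hu q))) (hlim2.const_sub 1) (sub_pos.2 h1)
  refine ⟨E.totalEndow / η + E.bbar / η', fun q => ?_⟩
  have hr1 := E.interest_lt_one (hu q)
  have h2 := integral_savings_le hU (hu q).2.1 (hu q).2.2 hr1
  have h3 := le_integral_savings hU (hu q).2.1 (hu q).2.2 hr1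
  rw [savingsCap_of_sum (hu q).1.2.2 hr1] at h2
  have h4 : E.bbar / (1 - (u q).2) ≤ E.bbar / η' :=
    div_le_div_of_nonneg_left E.bbar_pos.le hη' (hle' q)
  have h5 : -E.borrowLimit (u q).1 (u q).2 ≤ E.totalEndow / η := by
    rw [borrowLimit, neg_neg]
    refine div_le_div₀ E.totalEndow_nonneg ?_ hη (hle q)
    exact (E.minEndow_le_meanEndow _).trans (E.meanEndow_le fun i => by
      linarith [price_le_one (hu q).2.1 (hu q).1.2.2 i, (hu q).2.2])
  have h6 : 0 < E.bbar / η' := div_pos E.bbar_pos hη'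
  have h7 : 0 ≤ E.totalEndow / η := div_nonneg E.totalEndow_nonneg hη.le
  rw [abs_le]
  constructor
  · change _ ≤ -_
    linarith
  · change -_ ≤ _
    linarith

theorem exists_lower_bound_excessSavings (hU : E.UtilityAssumption) {δ : ℝ} (hδ1 : δ < 1) :
    ∃ ξ : ℝ, 0 < ξ ∧ ∀ z ∈ openPriceSimplex n, z.2 ≤ δ → -ξ ≤ (E.excessDemand z).2 := by
  refine ⟨E.bbar / (1 - δ), div_pos E.bbar_pos (sub_pos.2 hδ1), fun z hz hzδ => ?_⟩
  have hr1 := E.interest_lt_one hz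
  have h2 := integral_savings_le hU hz.2.1 hz.2.2 hr1
  rw [savingsCap_of_sum hz.1.2.2 hr1] at h2
  exact neg_le_neg (h2.trans (div_le_div_of_nonneg_left E.bbar_pos.le (sub_pos.2 hδ1)
    (by linarith)))

end Economy

end

/-! ### Divergence of excess demand at the boundary. -/

noncomputable section

namespace Economy

variable {n : ℕ} {E : Economy n} {p : Fin n → ℝ} {r a b c : ℝ}

/-- If the interest rate is low, then wealth does not grow under the worst endowments. -/
theorem next_minEndow_le (hU : E.UtilityAssumption) (hp : ∀ i, 0 < p i) (hr : 0 < r)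
    (hr1 : r < 1) (hβ : E.β * (1 + r) ≤ 1) (ha : a ∈ E.wealthSet p r) :
    (1 + r) * E.savings p r a + E.minEndow p ≤ a := by
  by_contra! hlt
  obtain ⟨y₀, hy₀, hmin⟩ := E.exists_minEndow p
  have htop := wealthTop_mem (E := E) hp hr hr1
  have ha' := ha
  rw [wealthSet_eq hr] at ha'
  rw [hmin, ← transition_eq hr ha] at hlt
  have htop' := transition_mem hU hp hr hr1 hy₀ (E.wealthTop p r)
  rw [wealthSet_eq hr] at htop'
  -- If wealth grew at `a`, there would be a fixed point between `a` and the top. It has to be the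
  -- borrowing limit, hence `a` itself, where growth was strict.
  have hc : ContinuousOn (fun x => E.transition p r y₀ x - x) (Icc a (E.wealthTop p r)) :=
    ((continuous_transition_right hU hp hr hr1 y₀).sub continuous_id).continuousOn
  obtain ⟨x, hx, hx0⟩ := intermediate_value_Icc' ha'.2 hc
    ⟨sub_nonpos.2 htop'.2, sub_nonneg.2 hlt.le⟩
  have hxA : x ∈ E.wealthSet p r := by
    rw [wealthSet_eq hr]
    exact ⟨ha'.1.trans hx.1, hx.2⟩
  have hfix := fixedPoint_minEndow hU hp hr hr1 hβ hmin hxA (sub_eq_zero.1 hx0)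
  have hxa : x = a := le_antisymm (hfix.le.trans ha'.1) hx.1
  rw [hxa] at hx0
  simp only at hx0
  linarith

/-- A lower bound on consumption when the interest rate is low. -/
theorem le_consumption (hU : E.UtilityAssumption) (hp : ∀ i, 0 < p i) (hr : 0 < r)
    (hr1 : r < 1) (hβ : E.β * (1 + r) ≤ 1) (ha : a ∈ E.wealthSet p r) {m : ℝ}
    (hm : m ≤ E.minEndow p) (hma : -(m / 2) ≤ r * a) : m / 4 ≤ a - E.savings p r a := by
  have h := next_minEndow_le hU hp hr hr1 hβ ha
  have hc := consumption_nonneg hU hp hr hr1 ha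
  -- With consumption `c = a - g(a)` the first bound reads `(1 + r) c ≥ r a + minEndow ≥ m / 2`, and
  -- `1 + r < 2`.
  nlinarith

/-- A linear form of Markov's inequality: a minorant affine in savings and consumption is integrated
using only their means, so no measures of events have to be estimated. -/
theorem affine_le_integral (hU : E.UtilityAssumption) (hp : ∀ i, 0 < p i) (hr : 0 < r)
    (hr1 : r < 1) {h : ℝ → ℝ} (hh : ContinuousOn h (E.wealthSet p r)) {C₀ C₁ C₂ : ℝ}
    (hle : ∀ a ∈ E.wealthSet p r,
      C₀ + C₁ * E.savings p r a + C₂ * (a - E.savings p r a) ≤ h a) :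
    C₀ + C₁ * ∫ a in E.wealthSet p r, E.savings p r a ∂(E.invariant p r) +
      C₂ * ∫ a in E.wealthSet p r, (a - E.savings p r a) ∂(E.invariant p r) ≤
      ∫ a in E.wealthSet p r, h a ∂(E.invariant p r) := by
  have hinv := isInvariant_invariant hU hp hr hr1
  have := hinv.1
  have h0 : IntegrableOn (fun _ : ℝ => C₀) (E.wealthSet p r) (E.invariant p r) :=
    integrableOn_wealthSet hU hp hr hr1 continuousOn_const
  have h1 := (integrableOn_wealthSet hU hp hr hr1 (continuousOn_savings hU hp hr hr1)).const_mul C₁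
  have h2 := (integrableOn_wealthSet hU hp hr hr1
    (continuousOn_consumption hU hp hr hr1)).const_mul C₂
  have h3 := setIntegral_mono_on ((h0.add h1).add h2) (integrableOn_wealthSet hU hp hr hr1 hh)
    (E.measurableSet_wealthSet p r) hle
  refine le_trans (le_of_eq ?_) h3
  have h4 : ∫ _ in E.wealthSet p r, C₀ ∂(E.invariant p r) = C₀ := by
    rw [restrict_wealthSet hinv.2.1]; simp
  have h01 : IntegrableOn (fun a => C₀ + C₁ * E.savings p r a) (E.wealthSet p r)
    (E.invariant p r) := h0.add h1
  have h5 : ∫ a in E.wealthSet p r, (C₀ + C₁ * E.savings p r a + C₂ * (a - E.savings p r a))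
      ∂(E.invariant p r) = C₀ + C₁ * ∫ a in E.wealthSet p r, E.savings p r a ∂(E.invariant p r) +
        C₂ * ∫ a in E.wealthSet p r, (a - E.savings p r a) ∂(E.invariant p r) := by
    rw [integral_add h01 h2, integral_add h0 h1, integral_const_mul, integral_const_mul, h4]
  exact h5.symm

theorem integral_consumption_le (hU : E.UtilityAssumption) (hp : ∀ i, 0 < p i) (hr : 0 < r)
    (hr1 : r < 1) (hsum : ∑ i, p i + r = 1) {M : ℝ}
    (hM : |∫ a in E.wealthSet p r, E.savings p r a ∂(E.invariant p r)| ≤ M) :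
    ∫ a in E.wealthSet p r, (a - E.savings p r a) ∂(E.invariant p r) ≤ E.totalEndow + M := by
  rw [integral_consumption hU hp hr hr1]
  have h1 := E.meanEndow_le (p := p) fun i => by linarith [price_le_one hp hsum i]
  have h2 := (le_abs_self _).trans hM
  have h3 := (abs_nonneg _).trans hM
  nlinarith

theorem sum_integral_demand_le (hU : E.UtilityAssumption) (hp : ∀ i, 0 < p i) (hr : 0 < r)
    (hr1 : r < 1) {M : ℝ} (hM : l1Norm (E.excessDemand (p, r)) ≤ M) :
    ∫ a in E.wealthSet p r, ∑ i, E.demand p (a - E.savings p r a) i ∂(E.invariant p r) ≤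
      M + E.totalEndow := by
  rw [integral_finsetSum _ fun i _ => integrableOn_wealthSet hU hp hr hr1
    (continuousOn_demand_consumption hU hp hr hr1 i)]
  have h1 : ∑ i, ∫ a in E.wealthSet p r, E.demand p (a - E.savings p r a) i ∂(E.invariant p r) =
      ∑ i, E.excessGood p r i + E.totalEndow := by
    have h2 : E.totalEndow = ∑ i, ∑ y ∈ E.Y, E.e y * y i := by
      simp_rw [totalEndow, Finset.mul_sum]
      exact Finset.sum_comm
    rw [h2, ← Finset.sum_add_distrib]
    exact Finset.sum_congr rfl fun i _ => by rw [excessGood]; ring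
  rw [h1]
  have h3 : ∑ i, E.excessGood p r i ≤ ∑ i, |E.excessGood p r i| :=
    Finset.sum_le_sum fun i _ => le_abs_self _
  have h4 : ∑ i, |E.excessGood p r i| + |E.excessSavings p r| ≤ M := hM
  linarith [abs_nonneg (E.excessSavings p r)]

theorem abs_integral_savings_le {M : ℝ} (hM : l1Norm (E.excessDemand (p, r)) ≤ M) :
    |∫ a in E.wealthSet p r, E.savings p r a ∂(E.invariant p r)| ≤ M := by
  have h4 : ∑ i, |E.excessGood p r i| + |E.excessSavings p r| ≤ M := hM
  rw [excessSavings, abs_neg] at h4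
  linarith [Finset.sum_nonneg fun i (_ : i ∈ Finset.univ) => abs_nonneg (E.excessGood p r i)]

theorem continuousOn_sum_demand (hU : E.UtilityAssumption) (hp : ∀ i, 0 < p i) (hr : 0 < r)
    (hr1 : r < 1) :
    ContinuousOn (fun a => ∑ i, E.demand p (a - E.savings p r a) i) (E.wealthSet p r) :=
  continuousOn_finsetSum _ fun i _ => continuousOn_demand_consumption hU hp hr hr1 i

theorem sum_demand_nonneg (hU : E.UtilityAssumption) (hp : ∀ i, 0 < p i) (hr : 0 < r)
    (hr1 : r < 1) (ha : a ∈ E.wealthSet p r) : 0 ≤ ∑ i, E.demand p (a - E.savings p r a) i :=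
  Finset.sum_nonneg fun i _ => demand_nonneg hU hp (consumption_nonneg hU hp hr hr1 ha) i

theorem minEndow_pos_of_nonneg (hp : ∀ i, 0 ≤ p i) {k : Fin n} (hk : 0 < p k) :
    0 < E.minEndow p := by
  obtain ⟨y, hy, h⟩ := E.exists_minEndow p
  rw [h]
  exact Finset.sum_pos' (fun i _ => mul_nonneg (hp i) (E.Y_pos y hy i).le)
    ⟨k, Finset.mem_univ k, mul_pos hk (E.Y_pos y hy k)⟩

theorem minEndow_lt_meanEndow (hp : ∀ i, 0 ≤ p i) {k : Fin n} (hk : 0 < p k) :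
    E.minEndow p < E.meanEndow p := by
  obtain ⟨y', hy', h⟩ := E.Y_top
  obtain ⟨y, hy, hne⟩ := E.Y_nontrivial.exists_ne y'
  have hlt : E.minEndow p < cost p y' := (minEndow_le hy).trans_lt
    (Finset.sum_lt_sum (fun i _ => mul_le_mul_of_nonneg_left (h y hy hne i).le (hp i))
      ⟨k, Finset.mem_univ k, mul_lt_mul_of_pos_left (h y hy hne k) hk⟩)
  calc E.minEndow p = ∑ y ∈ E.Y, E.e y * E.minEndow p := by rw [← Finset.sum_mul, E.e_sum, one_mul]
    _ < E.meanEndow p := Finset.sum_lt_sum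
        (fun y hy => mul_le_mul_of_nonneg_left (minEndow_le hy) (E.e_pos y hy).le)
        ⟨y', hy', mul_lt_mul_of_pos_left hlt (E.e_pos y' hy')⟩

theorem continuous_meanEndow (E : Economy n) : Continuous E.meanEndow :=
  continuous_finsetSum _ fun y _ => continuous_const.mul (continuous_cost_left y)

/-- If some good becomes free while the interest rate stays positive, then excess
demand is unbounded. -/
theorem false_of_bounded_of_pos (hU : E.UtilityAssumption) {v : ℕ → (Fin n → ℝ) × ℝ}
    {z : (Fin n → ℝ) × ℝ} (hv : ∀ q, v q ∈ openPriceSimplex n) (hlim : Tendsto v atTop (𝓝 z))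
    (hz : z ∈ closedPriceSimplex n) {k i : Fin n} (hk : 0 < z.1 k) (hi : z.1 i = 0)
    (hr : 0 < z.2) {M : ℝ} (hM : ∀ q, l1Norm (E.excessDemand (v q)) ≤ M) : False := by
  have hlim1 : Tendsto (fun q => (v q).1) atTop (𝓝 z.1) := (continuous_fst.tendsto z).comp hlim
  have hlim2 : Tendsto (fun q => (v q).2) atTop (𝓝 z.2) := (continuous_snd.tendsto z).comp hlim
  have hz1 : z.2 < 1 := by
    have h1 := Finset.single_le_sum (f := z.1) (fun i _ => hz.1 i) (Finset.mem_univ k)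
    linarith [hz.2.2]
  -- Mean expenditure will be at least `2 * d`, so expenditure above `d` contributes at least `d` to
  -- the mean.
  set d := (E.meanEndow z.1 - E.minEndow z.1) / 3 with hd
  have hdpos : 0 < d := by
    have := minEndow_lt_meanEndow (E := E) hz.1 hk
    linarith
  have hgap : ∀ᶠ q in atTop, 2 * d < E.meanEndow (v q).1 - E.minEndow (v q).1 :=
    (((E.continuous_meanEndow.tendsto _).comp hlim1).sub
      ((E.continuous_minEndow.tendsto _).comp hlim1)).eventually (lt_mem_nhds (by linarith))
  have hrange : Tendsto (fun q => (1 + (v q).2) * (E.bbar / (1 - (v q).2)) + E.maxEndow (v q).1 +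
      E.minEndow (v q).1 / (v q).2) atTop (𝓝 ((1 + z.2) * (E.bbar / (1 - z.2)) + E.maxEndow z.1 +
      E.minEndow z.1 / z.2)) := by
    refine Tendsto.add (Tendsto.add ((hlim2.const_add 1).mul
      (tendsto_const_nhds.div (hlim2.const_sub 1) (sub_pos.2 hz1).ne')) ?_) (Tendsto.div ?_ hlim2 hr.ne')
    · exact (E.continuous_maxEndow.tendsto _).comp hlim1
    · exact (E.continuous_minEndow.tendsto _).comp hlim1
  obtain ⟨L, hL0, hL⟩ : ∃ L : ℝ, 0 < L ∧ ∀ᶠ q in atTop, (1 + (v q).2) * (E.bbar / (1 - (v q).2)) +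
      E.maxEndow (v q).1 + E.minEndow (v q).1 / (v q).2 < L := by
    refine ⟨max 1 ((1 + z.2) * (E.bbar / (1 - z.2)) + E.maxEndow z.1 + E.minEndow z.1 / z.2 + 1),
      by positivity, hrange.eventually (gt_mem_nhds (lt_of_lt_of_le (lt_add_one _) (le_max_right _ _)))⟩
  -- `L` exceeds the length of the wealth set, hence all expenditure; `M'` is chosen so that `M' * d
  -- / L` exceeds the permitted total demand.
  set M' := max 0 ((M + E.totalEndow + 1) * L / d) with hM'
  have hM'0 : 0 ≤ M' := le_max_left _ _
  obtain ⟨q, hq1, hq2, hq3⟩ := (hgap.and (hL.and (tendsto_demand_boundary hU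
    (fun q => (hv q).2.1) hlim1 hi (L := L) hdpos M'))).exists
  have hvq := hv q
  have hMq := hM q
  generalize hvp : v q = w at *
  obtain ⟨p, r⟩ := w
  have hp := hvq.2.1
  have hr' := hvq.2.2
  have hr1 := E.interest_lt_one hvq
  simp only at hq1 hq2 hq3 hp hr' hr1
  rw [← savingsCap_of_sum hvq.1.2.2 hr1] at hq2
  -- The minorant is `M' * (c - d) / L` with `c` the consumption: nonpositive for `c ≤ d`, and at
  -- most `M'` on `[d, L]`, where demand exceeds `M'`.
  have hpt : ∀ a ∈ E.wealthSet p r, -(M' * d / L) + 0 * E.savings p r a +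
      M' / L * (a - E.savings p r a) ≤ ∑ i, E.demand p (a - E.savings p r a) i := by
    intro a ha
    have h0 := sum_demand_nonneg hU hp hr' hr1 ha
    have ha' := ha
    rw [wealthSet_eq hr'] at ha'
    have hcL : a - E.savings p r a ≤ L := by
      have h1 := (savings_mem_Icc hU hp hr' hr1 ha'.1).1
      have h2 := ha'.2
      rw [wealthTop] at h2
      rw [borrowLimit] at h1
      linarith
    have hrw : -(M' * d / L) + 0 * E.savings p r a + M' / L * (a - E.savings p r a) =
        M' * ((a - E.savings p r a - d) / L) := by ring
    rw [hrw]
    rcases le_total d (a - E.savings p r a) with h | h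
    · have h3 := hq3 _ ⟨h, hcL⟩
      have h4 : (a - E.savings p r a - d) / L ≤ 1 := by
        rw [div_le_one hL0]; linarith
      nlinarith
    · have h4 : (a - E.savings p r a - d) / L ≤ 0 :=
        div_nonpos_of_nonpos_of_nonneg (by linarith) hL0.le
      nlinarith
  have h5 := affine_le_integral hU hp hr' hr1 (continuousOn_sum_demand hU hp hr' hr1) hpt
  have h6 := sum_integral_demand_le hU hp hr' hr1 hMq
  -- Mean interest payments never exceed the smallest endowment income, so mean expenditure is at
  -- least the mean endowment minus the smallest.
  have h7 : 2 * d ≤ ∫ a in E.wealthSet p r, (a - E.savings p r a) ∂(E.invariant p r) := by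
    rw [integral_consumption hU hp hr' hr1]
    have h8 := le_integral_savings hU hp hr' hr1
    have h9 : r * E.borrowLimit p r = -E.minEndow p := by
      rw [borrowLimit]; field_simp
    nlinarith
  have h8 : M' / L * (2 * d) ≤ M' / L *
      ∫ a in E.wealthSet p r, (a - E.savings p r a) ∂(E.invariant p r) :=
    mul_le_mul_of_nonneg_left h7 (div_nonneg hM'0 hL0.le)
  have h9 : M + E.totalEndow + 1 ≤ M' * d / L := by
    rw [le_div_iff₀ hL0]
    have := le_max_right 0 ((M + E.totalEndow + 1) * L / d)
    rw [← hM', div_le_iff₀ hdpos] at this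
    exact this
  have h10 : M' / L * (2 * d) = 2 * (M' * d / L) := by ring
  linarith

/-- Facts that hold eventually when the interest rate tends to zero and excess demand is bounded. -/
theorem eventually_low_interest {v : ℕ → (Fin n → ℝ) × ℝ} {z : (Fin n → ℝ) × ℝ}
    (hv : ∀ q, v q ∈ openPriceSimplex n) (hlim : Tendsto v atTop (𝓝 z))
    (hz : z ∈ closedPriceSimplex n) {k : Fin n} (hk : 0 < z.1 k) (hr : z.2 = 0) {β' : ℝ}
    (hβ' : E.β < β') (C : ℝ) :
    ∀ᶠ q in atTop, E.β * (1 + (v q).2) ≤ β' ∧ E.minEndow z.1 / 2 ≤ E.minEndow (v q).1 ∧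
      E.savingsCap (v q).1 (v q).2 ≤ 2 * E.bbar ∧ (v q).2 * C ≤ E.minEndow z.1 / 4 := by
  have hlim1 : Tendsto (fun q => (v q).1) atTop (𝓝 z.1) := (continuous_fst.tendsto z).comp hlim
  have hlim2 : Tendsto (fun q => (v q).2) atTop (𝓝 0) := hr ▸ (continuous_snd.tendsto z).comp hlim
  have hm := minEndow_pos_of_nonneg (E := E) hz.1 hk
  have h1 : Tendsto (fun q => E.β * (1 + (v q).2)) atTop (𝓝 (E.β * (1 + 0))) :=
    (hlim2.const_add 1).const_mul _
  have h2 : Tendsto (fun q => E.minEndow (v q).1) atTop (𝓝 (E.minEndow z.1)) :=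
    (E.continuous_minEndow.tendsto _).comp hlim1
  have h3 : Tendsto (fun q => E.bbar / (1 - (v q).2)) atTop (𝓝 (E.bbar / (1 - 0))) :=
    tendsto_const_nhds.div (hlim2.const_sub 1) (by norm_num)
  have h4 : Tendsto (fun q => (v q).2 * C) atTop (𝓝 (0 * C)) := hlim2.mul_const C
  filter_upwards [h1.eventually (gt_mem_nhds (by simpa using hβ')),
    h2.eventually (lt_mem_nhds (half_lt_self hm)),
    h3.eventually (gt_mem_nhds (show E.bbar / (1 - 0) < 2 * E.bbar by linarith [E.bbar_pos])),
    h4.eventually (gt_mem_nhds (show 0 * C < E.minEndow z.1 / 4 by linarith))] with q h1 h2 h3 h4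
  refine ⟨h1.le, h2.le, ?_, h4.le⟩
  rw [savingsCap_of_sum (hv q).1.2.2 (E.interest_lt_one (hv q))]
  exact h3.le

/-- If some good becomes free and the interest rate tends to zero, then excess
demand is unbounded. -/
theorem false_of_bounded_of_free (hU : E.UtilityAssumption) {v : ℕ → (Fin n → ℝ) × ℝ}
    {z : (Fin n → ℝ) × ℝ} (hv : ∀ q, v q ∈ openPriceSimplex n) (hlim : Tendsto v atTop (𝓝 z))
    (hz : z ∈ closedPriceSimplex n) {k i : Fin n} (hk : 0 < z.1 k) (hi : z.1 i = 0)
    (hr : z.2 = 0) {M : ℝ} (hM : ∀ q, l1Norm (E.excessDemand (v q)) ≤ M) : False := by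
  have hlim1 : Tendsto (fun q => (v q).1) atTop (𝓝 z.1) := (continuous_fst.tendsto z).comp hlim
  have hm := minEndow_pos_of_nonneg (E := E) hz.1 hk
  have hM0 : 0 ≤ M := by
    refine le_trans ?_ (hM 0)
    exact add_nonneg (Finset.sum_nonneg fun i _ => abs_nonneg _) (abs_nonneg _)
  have hW := E.totalEndow_nonneg
  have hb := E.bbar_pos
  set m := E.minEndow z.1 / 2 with hmdef
  -- `L` and `κ` make each of the two penalties, for excessive consumption and for debt beyond `κ`,
  -- at most `1 / 4` on average; the remaining half of `M'` exceeds `M + E.totalEndow`.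
  set L := 4 * (E.totalEndow + M) + m with hL
  set κ := 4 * (2 * E.bbar + M) with hκ
  have hκ0 : 0 < κ := by positivity
  set M' := 2 * (M + E.totalEndow) + 1 with hM'
  obtain ⟨q, ⟨hq1, hq2, hq3, hq4⟩, hq5⟩ := ((eventually_low_interest hv hlim hz hk hr E.β_lt κ).and
    (tendsto_demand_boundary hU (fun q => (hv q).2.1) hlim1 hi (δ := m / 4) (L := L)
      (by linarith) M')).exists
  have hvq := hv q
  have hMq := hM q
  generalize hvp : v q = w at *
  obtain ⟨p, r⟩ := w
  have hp := hvq.2.1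
  have hr' := hvq.2.2
  have hr1 := E.interest_lt_one hvq
  simp only at hq1 hq2 hq3 hq4 hq5 hp hr' hr1
  set B := E.savingsCap p r with hB
  have hB0 : 0 < B := savingsCap_pos hp hr1
  have hL0 : 0 < L := by positivity
  -- A penalty reaches `1` if debt exceeds `κ` or consumption exceeds `L`, making the minorant
  -- nonpositive. Otherwise consumption lies in `[m / 4, L]`, where demand exceeds `M'`.
  have hpt : ∀ a ∈ E.wealthSet p r, (M' - M' * B / (B + κ)) + M' / (B + κ) * E.savings p r a +
      -(M' / L) * (a - E.savings p r a) ≤ ∑ i, E.demand p (a - E.savings p r a) i := by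
    intro a ha
    have h0 := sum_demand_nonneg hU hp hr' hr1 ha
    have ha' := ha
    rw [wealthSet_eq hr'] at ha'
    have hg := (savings_mem_Icc hU hp hr' hr1 ha'.1).2
    have hc := consumption_nonneg hU hp hr' hr1 ha
    have hrw : (M' - M' * B / (B + κ)) + M' / (B + κ) * E.savings p r a +
        -(M' / L) * (a - E.savings p r a) =
        M' * (1 - (B - E.savings p r a) / (B + κ) - (a - E.savings p r a) / L) := by ring
    rw [hrw]
    have hc' : 0 ≤ (a - E.savings p r a) / L := div_nonneg hc hL0.le
    have hg' : 0 ≤ (B - E.savings p r a) / (B + κ) :=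
      div_nonneg (by linarith) (by linarith)
    have hM'0 : 0 < M' := by positivity
    by_cases hak : a < -κ
    · have h1 : 1 ≤ (B - E.savings p r a) / (B + κ) := by
        rw [le_div_iff₀ (by linarith)]
        linarith
      nlinarith
    · have h1 := le_consumption hU hp hr' hr1 (hq1.trans le_rfl) ha hq2 (by nlinarith)
      by_cases hcL : a - E.savings p r a ≤ L
      · have h2 := hq5 _ ⟨h1, hcL⟩
        nlinarith
      · have h3 : 1 ≤ (a - E.savings p r a) / L := by
          rw [le_div_iff₀ hL0]
          linarith
        nlinarith
  have h5 := affine_le_integral hU hp hr' hr1 (continuousOn_sum_demand hU hp hr' hr1) hpt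
  have h6 := sum_integral_demand_le hU hp hr' hr1 hMq
  have h7 := integral_consumption_le hU hp hr' hr1 hvq.1.2.2 (abs_integral_savings_le hMq)
  have h8 := (abs_le.1 (abs_integral_savings_le hMq)).1
  set G := ∫ a in E.wealthSet p r, E.savings p r a ∂(E.invariant p r)
  set K := ∫ a in E.wealthSet p r, (a - E.savings p r a) ∂(E.invariant p r)
  have h9 : (B - G) / (B + κ) ≤ 1 / 4 := by
    rw [div_le_iff₀ (by linarith)]
    linarith
  have h10 : K / L ≤ 1 / 4 := by
    rw [div_le_iff₀ hL0]
    linarith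
  have h11 : (M' - M' * B / (B + κ)) + M' / (B + κ) * G + -(M' / L) * K =
      M' * (1 - (B - G) / (B + κ) - K / L) := by ring
  rw [h11] at h5
  have hM'0 : 0 < M' := by positivity
  nlinarith

/-- As long as little is consumed, marginal utility falls at a geometric rate when wealth increases. -/
theorem marginal_le_pow (hU : E.UtilityAssumption) (hp : ∀ i, 0 < p i) (hr : 0 < r)
    (hr1 : r < 1) {β' L : ℝ} (hβ' : E.β * (1 + r) ≤ β')
    (ha : a ∈ E.wealthSet p r) (hL : a - E.savings p r a ≤ L) (T : ℕ)
    (hT : E.borrowLimit p r < a - T * (2 * L)) :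
    E.marginal p r a ≤ β' ^ T * E.marginal p r (a - T * (2 * L)) := by
  have hL0 : 0 ≤ L := (consumption_nonneg hU hp hr hr1 ha).trans hL
  induction T with
  | zero => simp
  | succ T ih =>
    push_cast at hT ⊢
    have ha' := ha
    rw [wealthSet_eq hr] at ha'
    have hlt : E.borrowLimit p r < a - T * (2 * L) := by linarith
    have hle : a - T * (2 * L) ≤ a := by
      have : 0 ≤ T * (2 * L) := by positivity
      linarith
    refine (ih hlt).trans ?_
    set x := a - T * (2 * L) with hx
    have hx' : a - (T + 1) * (2 * L) = x - 2 * L := by rw [hx]; ring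
    rw [hx'] at hT ⊢
    have h1 := marginal_le_nextMarginal hU hp hr hr1 hlt
    have hcx : x - E.savings p r x ≤ L :=
      (consumption_monotoneOn hU hp hr hr1 (mem_Ici.2 hlt.le) (mem_Ici.2 ha'.1) hle).trans hL
    -- Endowment income covers the interest even on maximal debt, so next wealth is at least
    -- savings, which are at least `x - L`.
    have hnext : ∀ y ∈ E.Y, x - 2 * L ≤ (1 + r) * E.savings p r x + cost p y := by
      intro y hy
      have h2 := minEndow_le (p := p) hy
      have h3 := borrowLimit_fixed (E := E) (p := p) hr
      nlinarith
    have h4 : E.nextMarginal p r (E.savings p r x) ≤ E.marginal p r (x - 2 * L) := by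
      calc E.nextMarginal p r (E.savings p r x) ≤ ∑ y ∈ E.Y, E.e y * E.marginal p r (x - 2 * L) :=
            Finset.sum_le_sum fun y hy => mul_le_mul_of_nonneg_left
              ((marginal_strictAntiOn hU hp hr hr1).antitoneOn hT (hT.trans_le (hnext y hy))
                (hnext y hy)) (E.e_pos y hy).le
        _ = E.marginal p r (x - 2 * L) := by rw [← Finset.sum_mul, E.e_sum, one_mul]
    have h5 := marginal_pos hU hp hr hr1 hT
    have hβ0 : 0 ≤ E.β * (1 + r) := mul_nonneg E.β_pos.le (by linarith)
    have h6 : E.marginal p r x ≤ β' * E.marginal p r (x - 2 * L) := by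
      calc E.marginal p r x ≤ E.β * (1 + r) * E.nextMarginal p r (E.savings p r x) := by
            rw [mul_assoc]; exact h1
        _ ≤ E.β * (1 + r) * E.marginal p r (x - 2 * L) := mul_le_mul_of_nonneg_left h4 hβ0
        _ ≤ β' * E.marginal p r (x - 2 * L) := mul_le_mul_of_nonneg_right hβ' h5.le
    rw [pow_succ, mul_assoc]
    exact mul_le_mul_of_nonneg_left h6 (pow_nonneg (hβ0.trans hβ') T)

theorem deriv_indirectUtility_anti (hU : E.UtilityAssumption) (hp : ∀ i, 0 < p i) {c c' : ℝ}
    (hc : 0 < c) (h : c ≤ c') :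
    deriv (E.indirectUtility p) c' ≤ deriv (E.indirectUtility p) c :=
  (((indirectUtility_strictConcaveOn hU hp).subset Ioi_subset_Ici_self
    (convex_Ioi 0)).concaveOn.antitoneOn_deriv fun _ hx =>
      differentiableAt_indirectUtility hU hp hx) (mem_Ioi.2 hc) (mem_Ioi.2 (hc.trans_le h)) h

/-- If excess demand is bounded, then some wealth level of moderate debt goes with moderate
consumption. -/
theorem exists_moderate_wealth (hU : E.UtilityAssumption) (hp : ∀ i, 0 < p i) (hr : 0 < r)
    (hr1 : r < 1) (hsum : ∑ i, p i + r = 1) {κ L M : ℝ} (hκ : 0 < κ) (hL : 0 < L)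
    (hκB : 4 * (E.savingsCap p r + M) ≤ κ) (hLM : 4 * (E.totalEndow + M) < 3 * L)
    (hM : l1Norm (E.excessDemand (p, r)) ≤ M) :
    ∃ a ∈ E.wealthSet p r, -κ ≤ a ∧ a - E.savings p r a ≤ L := by
  have hB0 : 0 < E.savingsCap p r := savingsCap_pos hp hr1
  set B := E.savingsCap p r with hB
  have hBκ : 0 < B + κ := by linarith
  by_contra! hcon
  -- If consumption exceeded `L` wherever debt is at most `κ`, it would dominate `L` times one minus
  -- the debt penalty, whose mean is at least `3 * L / 4`, more than mean expenditure allows.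
  have hpt : ∀ a ∈ E.wealthSet p r, (L - L * B / (B + κ)) + L / (B + κ) * E.savings p r a +
      0 * (a - E.savings p r a) ≤ a - E.savings p r a := by
    intro a ha
    have ha' := ha
    rw [wealthSet_eq hr] at ha'
    have hg := (savings_mem_Icc hU hp hr hr1 ha'.1).2
    have hc := consumption_nonneg hU hp hr hr1 ha
    have hrw : (L - L * B / (B + κ)) + L / (B + κ) * E.savings p r a +
        0 * (a - E.savings p r a) = L * (1 - (B - E.savings p r a) / (B + κ)) := by ring
    rw [hrw]
    by_cases hak : a < -κ
    · have h1 : 1 ≤ (B - E.savings p r a) / (B + κ) := by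
        rw [le_div_iff₀ hBκ]
        linarith
      exact (mul_nonpos_of_nonneg_of_nonpos hL.le (by linarith)).trans hc
    · have hg' : 0 ≤ (B - E.savings p r a) / (B + κ) := div_nonneg (by linarith) hBκ.le
      exact (mul_le_of_le_one_right hL.le (by linarith)).trans (hcon a ha (by linarith)).le
  have h5 := affine_le_integral hU hp hr hr1 (continuousOn_consumption hU hp hr hr1) hpt
  have h7 := integral_consumption_le hU hp hr hr1 hsum (abs_integral_savings_le hM)
  have h8 := (abs_le.1 (abs_integral_savings_le hM)).1
  set G := ∫ a in E.wealthSet p r, E.savings p r a ∂(E.invariant p r)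
  set K := ∫ a in E.wealthSet p r, (a - E.savings p r a) ∂(E.invariant p r)
  have h9 : (B - G) / (B + κ) ≤ 1 / 4 := by
    rw [div_le_iff₀ hBκ]
    linarith
  have h11 : (L - L * B / (B + κ)) + L / (B + κ) * G + 0 * K =
      L * (1 - (B - G) / (B + κ)) := by ring
  rw [h11] at h5
  have h12 := mul_le_mul_of_nonneg_left (show 3 / 4 ≤ 1 - (B - G) / (B + κ) by linarith) hL.le
  linarith

/-- If the interest rate tends to zero while all prices stay positive, then excess
demand is unbounded. -/
theorem false_of_bounded_of_interior (hU : E.UtilityAssumption) {v : ℕ → (Fin n → ℝ) × ℝ}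
    {z : (Fin n → ℝ) × ℝ} (hv : ∀ q, v q ∈ openPriceSimplex n) (hlim : Tendsto v atTop (𝓝 z))
    (hz : z ∈ closedPriceSimplex n) (hpos : ∀ i, 0 < z.1 i)
    (hr : z.2 = 0) {M : ℝ} (hM : ∀ q, l1Norm (E.excessDemand (v q)) ≤ M) : False := by
  have hlim1 : Tendsto (fun q => (v q).1) atTop (𝓝 z.1) := (continuous_fst.tendsto z).comp hlim
  have hk := hpos ⟨0, E.dim_pos⟩
  have hm := minEndow_pos_of_nonneg (E := E) hz.1 hk
  have hM0 : 0 ≤ M := by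
    refine le_trans ?_ (hM 0)
    exact add_nonneg (Finset.sum_nonneg fun i _ => abs_nonneg _) (abs_nonneg _)
  have hW := E.totalEndow_nonneg
  have hb := E.bbar_pos
  set m := E.minEndow z.1 / 2 with hmdef
  have hm0 : 0 < m := by linarith
  set L := 2 * (E.totalEndow + M) + 1 with hL
  have hL0 : 0 < L := by positivity
  set κ := 4 * (2 * E.bbar + M) with hκ
  have hκ0 : 0 < κ := by positivity
  obtain ⟨β', hβ', hβ1⟩ := exists_between E.β_lt
  have hu : ∀ c : ℝ, 0 ≤ c → Tendsto (fun q => E.indirectUtility (v q).1 c) atTop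
      (𝓝 (E.indirectUtility z.1 c)) := fun c hc =>
    (continuousOn_indirectUtility hU (z.1, c) ⟨hpos, hc⟩).tendsto.comp
      (tendsto_nhdsWithin_iff.2 ⟨hlim1.prodMk_nhds tendsto_const_nhds,
        Eventually.of_forall fun q => ⟨(hv q).2.1, hc⟩⟩)
  -- Bounds uniform near the limit prices: `C₁` exceeds marginal utility at consumption `m / 4`, and
  -- `C₂` is below marginal utility at `L`. Both come from secants, so convergence of indirect
  -- utility suffices and no convergence of derivatives is needed.
  set C₁ := (E.indirectUtility z.1 (m / 4) - E.indirectUtility z.1 0) / (m / 4) + 1 with hC₁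
  set C₂ := (E.indirectUtility z.1 (L + 1) - E.indirectUtility z.1 L) / 2 with hC₂
  have hmonoz := indirectUtility_strictMonoOn hU hpos
  have hC₂0 : 0 < C₂ := half_pos (sub_pos.2 (hmonoz (mem_Ici.2 hL0.le)
    (mem_Ici.2 (by linarith)) (lt_add_one L)))
  have hC₁0 : 0 < C₁ := by
    have : E.indirectUtility z.1 0 < E.indirectUtility z.1 (m / 4) :=
      hmonoz (mem_Ici.2 le_rfl) (mem_Ici.2 (by linarith)) (by linarith)
    have := div_pos (sub_pos.2 this) (show 0 < m / 4 by linarith)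
    linarith
  obtain ⟨T, hT⟩ : ∃ T : ℕ, β' ^ T * C₁ < C₂ := by
    have : Tendsto (fun T : ℕ => β' ^ T * C₁) atTop (𝓝 0) := by
      simpa using (tendsto_pow_atTop_nhds_zero_of_lt_one (E.β_pos.trans hβ').le hβ1).mul_const C₁
    exact (this.eventually (gt_mem_nhds hC₂0)).exists
  have hev1 : ∀ᶠ q in atTop, (E.indirectUtility (v q).1 (m / 4) - E.indirectUtility (v q).1 0) /
      (m / 4) < C₁ :=
    (((hu (m / 4) (by linarith)).sub (hu 0 le_rfl)).div_const (m / 4)).eventually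
      (gt_mem_nhds (lt_add_one _))
  have hev2 : ∀ᶠ q in atTop, C₂ < E.indirectUtility (v q).1 (L + 1) - E.indirectUtility (v q).1 L :=
    ((hu (L + 1) (by linarith)).sub (hu L hL0.le)).eventually (lt_mem_nhds (by linarith))
  obtain ⟨q, ⟨hq1, hq2, hq3, hq4⟩, hq5, hq6⟩ :=
    ((eventually_low_interest hv hlim hz hk hr hβ' (κ + T * (2 * L))).and (hev1.and hev2)).exists
  have hvq := hv q
  have hMq := hM q
  generalize hvp : v q = w at *
  obtain ⟨p, r⟩ := w
  have hp := hvq.2.1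
  have hr' := hvq.2.2
  have hr1 := E.interest_lt_one hvq
  simp only at hq1 hq2 hq3 hq4 hq5 hq6 hp hr' hr1
  set B := E.savingsCap p r with hB
  have hB0 : 0 < B := savingsCap_pos hp hr1
  have hTL : 0 ≤ T * (2 * L) := by positivity
  obtain ⟨a, ha, haκ, hcL⟩ := exists_moderate_wealth hU hp hr' hr1 hvq.1.2.2 hκ0 hL0
    (by linarith) (show 4 * (E.totalEndow + M) < 3 * L by linarith) hMq
  have ha' := ha
  rw [wealthSet_eq hr'] at ha'
  -- The number `T` of descending steps is fixed before `q`, so for small `r` the interest on the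
  -- debt at `x` is at most `m / 2` and consumption at `x` is still at least `m / 4`.
  set x := a - T * (2 * L) with hx
  have hrx : -(m / 2) ≤ r * x := by
    have := mul_le_mul_of_nonneg_left (show -(κ + T * (2 * L)) ≤ x by linarith) hr'.le
    linarith
  have hlox : E.borrowLimit p r < x := by
    have h9 : r * E.borrowLimit p r = -E.minEndow p := by
      rw [borrowLimit]; field_simp
    by_contra! hcon
    have := mul_le_mul_of_nonneg_left hcon hr'.le
    linarith
  have hxA : x ∈ E.wealthSet p r := by
    rw [wealthSet_eq hr']
    exact ⟨hlox.le, by linarith [ha'.2]⟩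
  have hcx := le_consumption hU hp hr' hr1 (hq1.trans hβ1.le) hxA hq2 hrx
  have h1 := marginal_le_pow hU hp hr' hr1 hq1 ha hcL T hlox
  have hm4 : 0 < m / 4 := by linarith
  have h2 : E.marginal p r x ≤ C₁ := by
    refine (deriv_indirectUtility_anti hU hp hm4 hcx).trans (le_trans ?_ hq5.le)
    have h := (indirectUtility_strictConcaveOn hU hp).concaveOn.deriv_le_slope (mem_Ici.2 le_rfl)
      (mem_Ici.2 hm4.le) hm4 (differentiableAt_indirectUtility hU hp hm4)
    rwa [slope_def_field, sub_zero] at h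
  have h3 : C₂ ≤ E.marginal p r a := by
    have hcpos : 0 < a - E.savings p r a :=
      sub_pos.2 (savings_lt hU hp hr' hr1 (by linarith))
    refine le_trans ?_ (deriv_indirectUtility_anti hU hp hcpos hcL)
    have h := (indirectUtility_strictConcaveOn hU hp).concaveOn.slope_le_deriv (mem_Ici.2 hL0.le)
      (mem_Ici.2 (show 0 ≤ L + 1 by linarith)) (lt_add_one L)
      (differentiableAt_indirectUtility hU hp hL0)
    rw [slope_def_field, add_sub_cancel_left, div_one] at h
    linarith
  have h4 := mul_le_mul_of_nonneg_left h2 (pow_nonneg (E.β_pos.trans hβ').le T)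
  linarith

theorem tendsto_l1Norm_excessDemand (hU : E.UtilityAssumption) {u : ℕ → (Fin n → ℝ) × ℝ}
    {z : (Fin n → ℝ) × ℝ} (hu : ∀ q, u q ∈ openPriceSimplex n) (hlim : Tendsto u atTop (𝓝 z))
    (hz : z ∈ closedPriceSimplex n \ openPriceSimplex n) (hk : ∃ k, 0 < z.1 k) :
    Tendsto (fun q => l1Norm (E.excessDemand (u q))) atTop atTop := by
  obtain ⟨k, hk⟩ := hk
  rw [tendsto_atTop]
  intro M
  by_contra hcon
  rw [not_eventually] at hcon
  obtain ⟨φ, hφ, hM⟩ := extraction_of_frequently_atTop hcon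
  have hv : ∀ q, (u ∘ φ) q ∈ openPriceSimplex n := fun q => hu _
  have hlim' := hlim.comp hφ.tendsto_atTop
  have hM' : ∀ q, l1Norm (E.excessDemand ((u ∘ φ) q)) ≤ M := fun q => (not_le.1 (hM q)).le
  -- A boundary point with all goods' prices positive has `r = 0`; otherwise some good is free, and
  -- the cases `r = 0` and `r > 0` need different estimates.
  by_cases hpos : ∀ i, 0 < z.1 i
  · have hr : z.2 = 0 := by
      by_contra hne
      exact hz.2 ⟨hz.1, hpos, lt_of_le_of_ne hz.1.2.1 (Ne.symm hne)⟩
    exact false_of_bounded_of_interior hU hv hlim' hz.1 hpos hr hM'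
  · push Not at hpos
    obtain ⟨i, hi⟩ := hpos
    have hi0 : z.1 i = 0 := le_antisymm hi (hz.1.1 i)
    rcases hz.1.2.1.eq_or_lt with h | h
    · exact false_of_bounded_of_free hU hv hlim' hz.1 hk hi0 h.symm hM'
    · exact false_of_bounded_of_pos hU hv hlim' hz.1 hk hi0 h hM'

end Economy

end

theorem proposition2 {n : ℕ} (hn : 2 ≤ n) (E : Economy n) (hU : E.UtilityAssumption) :
    -- the excess demand function is well defined
    (∀ z ∈ openPriceSimplex n, E.WellDefinedAt z.1 z.2) ∧
    -- (i) continuity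
    ContinuousOn E.excessDemand (openPriceSimplex n) ∧
    -- (ii) Walras' law
    (∀ z ∈ openPriceSimplex n,
      ∑ i, z.1 i * (E.excessDemand z).1 i + z.2 * (E.excessDemand z).2 = 0) ∧
    -- (iii) behaviour at the boundary
    (∀ (u : ℕ → (Fin n → ℝ) × ℝ) (z : (Fin n → ℝ) × ℝ),
      (∀ q, u q ∈ openPriceSimplex n) → Tendsto u atTop (𝓝 z) →
      z ∈ closedPriceSimplex n \ openPriceSimplex n → (∃ k, 0 < z.1 k) →
      Tendsto (fun q => l1Norm (E.excessDemand (u q))) atTop atTop) ∧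
    -- (iv) components with a positive limiting price stay bounded
    (∀ (u : ℕ → (Fin n → ℝ) × ℝ) (z : (Fin n → ℝ) × ℝ),
      (∀ q, u q ∈ openPriceSimplex n) → Tendsto u atTop (𝓝 z) →
      (∀ k, 0 < z.1 k → ∃ M : ℝ, ∀ q, |(E.excessDemand (u q)).1 k| ≤ M) ∧
      (0 < z.2 → z.2 < 1 → ∃ M : ℝ, ∀ q, |(E.excessDemand (u q)).2| ≤ M)) ∧
    -- (v) lower bounds
    (∃ ξ : ℝ, 0 < ξ ∧ ∀ z ∈ openPriceSimplex n, ∀ i, -ξ ≤ (E.excessDemand z).1 i) ∧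
    (∀ δ : ℝ, 0 < δ → δ < 1 →
      ∃ ξ : ℝ, 0 < ξ ∧ ∀ z ∈ openPriceSimplex n, z.2 ≤ δ → -ξ ≤ (E.excessDemand z).2) := by
  refine ⟨fun z hz => Economy.wellDefinedAt hU hz.2.1 hz.2.2 (E.interest_lt_one hz),
    Economy.continuousOn_excessDemand hU,
    fun z hz => Economy.walras hU hz.2.1 hz.2.2 (E.interest_lt_one hz),
    fun u z hu hlim hz hk => Economy.tendsto_l1Norm_excessDemand hU hu hlim hz hk,
    fun u z hu hlim => ⟨fun k hk => Economy.exists_bound_excessGood hU hu hlim hk,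
      fun h0 h1 => Economy.exists_bound_excessSavings hU hu hlim h0 h1⟩,
    ⟨E.totalEndow + 1, by linarith [E.totalEndow_nonneg], fun z hz i => ?_⟩,
    fun δ _ hδ1 => Economy.exists_lower_bound_excessSavings hU hδ1⟩
  have h := Economy.neg_totalEndow_le_excessGood hU hz.2.1 hz.2.2 (E.interest_lt_one hz) i
  change _ ≤ E.excessGood _ _ i
  linarith
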